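/- Let $p\in(0,3/4]$ and $q\in(0,1]$. Let $(X_i)_{i\ge1}$ be the steps of the elephant random walk: $\mathbf P(X_1=1)=q=1-\mathbf P(X_1=-1)$, and for $n\ge1$, $X_{n+1}=\alpha_{n+1}X_{\beta_{n+1}}$, where $\alpha_{n+1}$, $\beta_{n+1}$ and $(X_1,\dots,X_n)$ are independent, $\mathbf P(\alpha_{n+1}=1)=p=1-\mathbf P(\alpha_{n+1}=-1)$, and $\beta_{n+1}$ is uniformly distributed on $\{1,\dots,n\}$. Let $(Z_i)_{i\ge1}$ be positive i.i.d. random variables, independent of $(X_i)_{i\ge1}$, with $\mathbf E Z_1=1$ and $\operatorname{Var}(Z_1)=\sigma^2\ge0$, and put $$S_n=\sum_{i=1}^n X_iZ_i,\qquad a_n=\frac{\Gamma(n)\Gamma(2p)}{\Gamma(n+2p-1)},\qquad v_n=\sum_{i=1}^n a_i^2 .$$ For $r>0$ let $l$ be the natural number with $l<r\le l+1$, let $\Lambda_r$ be the class of $l$-times continuously differentiable functions $f:\mathbf R\to\mathbf R$ with $|f^{(l)}(x)-f^{(l)}(y)|\le|x-y|^{r-l}$ for all $x,y$, and let $\zeta_r(\mu,\nu)=\sup\{\int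 f\,d\mu-\int f\,d\nu: f\in\Lambda_r\}$ be Zolotarev's distance of order $r$ between probability measures on $\mathbf R$; for random variables it is the distance of their laws. Assume that $\mathbf E Z_1^{2+\rho}<\infty$ for some $\rho\in(0,1]$, and let $r\in(0,2]$. Then there is a constant $C>0$, depending only on $p,q,r,\rho,\sigma^2$ and $\mathbf E Z_1^{2+\rho}$, such that for all $n\ge1$, with $\mathcal N$ a standard normal random variable, $$\zeta_r\!\left(\frac{a_nS_n-(2q-1)}{\sqrt{v_n+n a_n^2\sigma^2}},\ \mathcal N\right)\le C\left(\frac1{n^{(r\wedge\rho)/2}}+\frac1{v_n}\right),$$ every $f\in\Lambda_r$ being integrable with respect to both laws. -/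

import Mathlib

open MeasureTheory ProbabilityTheory

universe u

/-- The steps `X 1, X 2, …` of the elephant random walk with memory parameter `p` and first-step
parameter `q`: `X 1` is Rademacher with parameter `q`, and for `n ≥ 1` one has
`X (n+1) = α (n+1) * X (β (n+1))`, where `α (n+1)` is Rademacher with parameter `p`,
`β (n+1)` is uniform on `{1, …, n}`, and `α (n+1)`, `β (n+1)`, `(X 1, …, X n)` are independent.
(Index `0` is not used.) -/
structure IsElephantWalk {Ω : Type u} [MeasurableSpace Ω] (μ : Measure Ω) (p q : ℝ)
    (X α : ℕ → Ω → ℝ) (β : ℕ → Ω → ℕ) : Prop where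
  measurable_X : ∀ n, 1 ≤ n → Measurable (X n)
  measurable_α : ∀ n, 1 ≤ n → Measurable (α (n + 1))
  measurable_β : ∀ n, 1 ≤ n → Measurable (β (n + 1))
  first_pos : μ {ω | X 1 ω = 1} = ENNReal.ofReal q
  first_neg : μ {ω | X 1 ω = -1} = ENNReal.ofReal (1 - q)
  step : ∀ n, 1 ≤ n → ∀ᵐ ω ∂μ, X (n + 1) ω = α (n + 1) ω * X (β (n + 1) ω) ω
  α_pos : ∀ n, 1 ≤ n → μ {ω | α (n + 1) ω = 1} = ENNReal.ofReal p
  α_neg : ∀ n, 1 ≤ n → μ {ω | α (n + 1) ω = -1} = ENNReal.ofReal (1 - p)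
  β_unif : ∀ n, 1 ≤ n → ∀ k, 1 ≤ k → k ≤ n → μ {ω | β (n + 1) ω = k} = (n : ENNReal)⁻¹
  indep_αβ : ∀ n, 1 ≤ n → IndepFun (α (n + 1)) (β (n + 1)) μ
  indep_past : ∀ n, 1 ≤ n →
    IndepFun (fun ω => (α (n + 1) ω, β (n + 1) ω)) (fun ω (i : Fin n) => X (i + 1) ω) μ

/-- Random step sizes `Z 1, Z 2, …` for the steps `X 1, X 2, …`: positive, independent, identically
distributed, with mean `1` and variance `σ ^ 2`, and independent of the sequence `X`.
(Index `0` is not used.) -/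
structure IsStepSizes {Ω : Type u} [MeasurableSpace Ω] (μ : Measure Ω) (σ : ℝ)
    (X Z : ℕ → Ω → ℝ) : Prop where
  measurable_Z : ∀ n, 1 ≤ n → Measurable (Z n)
  pos : ∀ n, 1 ≤ n → ∀ᵐ ω ∂μ, 0 < Z n ω
  indep : iIndepFun (fun n : ℕ => Z (n + 1)) μ
  identDistrib : ∀ n, 1 ≤ n → IdentDistrib (Z n) (Z 1) μ μ
  memLp : MemLp (Z 1) 2 μ
  mean : ∫ ω, Z 1 ω ∂μ = 1
  variance : variance (Z 1) μ = σ ^ 2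
  indep_X : IndepFun (fun ω (n : ℕ) => X (n + 1) ω) (fun ω (n : ℕ) => Z (n + 1) ω) μ

/-- The position at time `n` of the walk with random step sizes, `∑_{i=1}^n X_i Z_i`. -/
def walkPosition {Ω : Type u} (X Z : ℕ → Ω → ℝ) (n : ℕ) (ω : Ω) : ℝ :=
  ∑ i ∈ Finset.Icc 1 n, X i ω * Z i ω

/-- `a_n = Γ(n) Γ(2p) / Γ(n + 2p - 1)`, for `n ≥ 1`. -/
noncomputable def erwA (p : ℝ) (n : ℕ) : ℝ :=
  Real.Gamma n * Real.Gamma (2 * p) / Real.Gamma (n + 2 * p - 1)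

theorem erwA_one {p : ℝ} (hp : 0 < p) : erwA p 1 = 1 := by
  have h : Real.Gamma (2 * p) ≠ 0 := (Real.Gamma_pos_of_pos (by linarith)).ne'
  simp [erwA, h]

/-- `v_n = ∑_{i=1}^n a_i ^ 2`. -/
noncomputable def erwV (p : ℝ) (n : ℕ) : ℝ :=
  ∑ i ∈ Finset.Icc 1 n, erwA p i ^ 2

/-- The class `Λ_r`: with `l` the natural number such that `l < r ≤ l + 1`, the `l`-times
continuously differentiable `f : ℝ → ℝ` with `|f^(l)(x) - f^(l)(y)| ≤ |x - y|^(r - l)`. -/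
def zolotarevClass (r : ℝ) : Set (ℝ → ℝ) :=
  {f | ∃ l : ℕ, (l : ℝ) < r ∧ r ≤ l + 1 ∧ ContDiff ℝ l f ∧
    ∀ x y : ℝ, |iteratedDeriv l f x - iteratedDeriv l f y| ≤ |x - y| ^ (r - l)}

open Classical in
/-- Zolotarev's distance of order `r`, `sup {∫ f dμ - ∫ f dν : f ∈ Λ_r}`, with values in `[0, ∞]`.
It is set to `∞` when the integrals are not all defined, so that an upper bound by a real number
also says that every `f ∈ Λ_r` is integrable for both measures. -/
noncomputable def zolotarevDist (r : ℝ) (μ ν : Measure ℝ) : EReal :=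
  if ∀ f ∈ zolotarevClass r, Integrable f μ ∧ Integrable f ν then
    ⨆ f ∈ zolotarevClass r, ((∫ x, f x ∂μ - ∫ x, f x ∂ν : ℝ) : EReal)
  else ⊤

/-! Let T_n = ∑ X_i be the walk with unit steps, so that S_n = T_n + ∑ X_i (Z_i - 1). Given the
signs, the last sum has independent centred terms of variance σ², and a central limit theorem
uniform in the signs replaces it by a Gaussian of variance nσ² (`exists_walkPosition_clt`). There
remains the martingale a_n T_n - (2q-1), smoothed by a Gaussian, to be compared with a Gaussian of
variance v_n (`exists_elephantWalk_clt`).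

A test function enters only through `HolderTaylor`: it is affine near each point up to B|y|^r.
Rescaling by s multiplies B by s^r, and Gaussian smoothing of width s produces derivatives of orders
k = 2, 3, 4 of size B s^(r-k) (`exists_gaussAvg_derivatives`). Both limit theorems are then
Lindeberg replacements, the Gaussian terms not yet exchanged providing the smoothing.

For independent summands a plain replacement would lose a logarithm at r = ρ. Instead, the error
already known for fewer summands is treated as a bounded function, whose smoothed increments are
summable, while the Gaussian main part is smoothed at the full width √n (`lindeberg_step`,
`exists_convLaw_clt`).

For the martingale, the sign X_{k+1} has mean m_k = (2p-1)T_k/k given the past. The conditional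
variance of the increment differs from a_{k+1}² by a_{k+1}² m_k², and its third moment is a multiple
of m_k too. A fourth-order expansion thus leaves a² m² s^(r-2) + a⁴ s^(r-4), with s² at least the
variance still to come (`exists_twoPoint_step`). Since E a² m² = O(v_k/k²) and a⁴ = O(v_k²/k²), the
early steps add up to 1/v_n plus a power of n, and the last ones to n^(-(r∧1)/2)
(`exists_sum_erwWeight_le`). At p = 3/4, where v_n is logarithmic, the sum needs an argument of its
own. Finally n a_n² ≤ 3 v_n turns a_n^r into v_n^(r/2) n^(-r/2), and the normalization cancels
v_n^(r/2). -/

/-! ### Averages of functions of quadratic growth -/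

/-- Measurable functions of at most quadratic growth. -/
def QuadGrowth (f : ℝ → ℝ) : Prop := Measurable f ∧ ∃ A, ∀ x, |f x| ≤ A * (1 + x ^ 2)

/-- Averaging the translates of `f` against a measure. -/
noncomputable def avg (μ : Measure ℝ) (f : ℝ → ℝ) (y : ℝ) : ℝ := ∫ x, f (x + y) ∂μ

/-- A probability measure on the line with a finite second moment. -/
structure SqProb (μ : Measure ℝ) : Prop where
  prob : IsProbabilityMeasure μ
  sq : Integrable (fun x => x ^ 2) μ

theorem QuadGrowth.bound {f : ℝ → ℝ} (hf : QuadGrowth f) :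
    ∃ A, 0 ≤ A ∧ ∀ x, |f x| ≤ A * (1 + x ^ 2) := by
  obtain ⟨_, A, hA⟩ := hf
  refine ⟨A, ?_, hA⟩
  have := (abs_nonneg _).trans (hA 0)
  simpa using this

theorem QuadGrowth.add {f g : ℝ → ℝ} (hf : QuadGrowth f) (hg : QuadGrowth g) :
    QuadGrowth (fun x => f x + g x) := by
  obtain ⟨mf, A, hA⟩ := hf
  obtain ⟨mg, A', hA'⟩ := hg
  refine ⟨mf.add mg, A + A', fun x => (abs_add_le _ _).trans ?_⟩
  linarith [hA x, hA' x]

theorem QuadGrowth.neg {f : ℝ → ℝ} (hf : QuadGrowth f) : QuadGrowth (fun x => -f x) := by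
  obtain ⟨mf, A, hA⟩ := hf
  exact ⟨mf.neg, A, fun x => by simpa using hA x⟩

theorem QuadGrowth.sub {f g : ℝ → ℝ} (hf : QuadGrowth f) (hg : QuadGrowth g) :
    QuadGrowth (fun x => f x - g x) := by
  simpa only [sub_eq_add_neg] using hf.add hg.neg

theorem QuadGrowth.comp_affine {f : ℝ → ℝ} (hf : QuadGrowth f) (a b : ℝ) :
    QuadGrowth (fun x => f (a * x + b)) := by
  obtain ⟨A, hA0, hA⟩ := hf.bound
  refine ⟨hf.1.comp (by fun_prop), A * (1 + 2 * a ^ 2 + 2 * b ^ 2), fun x => (hA _).trans ?_⟩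
  rw [mul_assoc]
  refine mul_le_mul_of_nonneg_left ?_ hA0
  nlinarith [sq_nonneg (a * x - b), mul_nonneg (sq_nonneg x) (sq_nonneg b), sq_nonneg x,
    sq_nonneg a, sq_nonneg b]

theorem QuadGrowth.comp_add {f : ℝ → ℝ} (hf : QuadGrowth f) (b : ℝ) :
    QuadGrowth (fun x => f (x + b)) := by
  simpa using hf.comp_affine 1 b

theorem SqProb.integrable {μ : Measure ℝ} (hμ : SqProb μ) {f : ℝ → ℝ} (hf : QuadGrowth f) :
    Integrable f μ := by
  obtain ⟨A, hA0, hA⟩ := hf.bound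
  have := hμ.prob
  exact (((integrable_const 1).add hμ.sq).const_mul A).mono' hf.1.aestronglyMeasurable
    (ae_of_all _ hA)

theorem SqProb.integrable_prod {μ ν : Measure ℝ} (hμ : SqProb μ) (hν : SqProb ν) {f : ℝ → ℝ}
    (hf : QuadGrowth f) : Integrable (fun z : ℝ × ℝ => f (z.1 + z.2)) (μ.prod ν) := by
  obtain ⟨A, hA0, hA⟩ := hf.bound
  have := hμ.prob
  have := hν.prob
  have h1 : Integrable (fun z : ℝ × ℝ => z.1 ^ 2) (μ.prod ν) := hμ.sq.comp_fst ν
  have h2 : Integrable (fun z : ℝ × ℝ => z.2 ^ 2) (μ.prod ν) := hν.sq.comp_snd μ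
  refine (((integrable_const 1).add ((h1.const_mul 2).add (h2.const_mul 2))).const_mul A).mono'
    (hf.1.comp (by fun_prop)).aestronglyMeasurable (ae_of_all _ fun z => (hA _).trans ?_)
  refine mul_le_mul_of_nonneg_left ?_ hA0
  simp only [Pi.add_apply]
  nlinarith [sq_nonneg (z.1 - z.2)]

theorem quadGrowth_sq : QuadGrowth (fun x => x ^ 2) :=
  ⟨by fun_prop, 1, fun x => by rw [abs_of_nonneg (sq_nonneg x)]; linarith⟩

theorem SqProb.conv {μ ν : Measure ℝ} (hμ : SqProb μ) (hν : SqProb ν) : SqProb (μ ∗ ν) := by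
  have := hμ.prob
  have := hν.prob
  refine ⟨inferInstance, ?_⟩
  rw [Measure.conv, integrable_map_measure (by fun_prop) (by fun_prop)]
  exact hμ.integrable_prod hν quadGrowth_sq

theorem sqProb_dirac (x : ℝ) : SqProb (Measure.dirac x) :=
  ⟨inferInstance, integrable_dirac (by simp)⟩

theorem sqProb_gaussianReal (m : ℝ) (v : NNReal) : SqProb (gaussianReal m v) := by
  refine ⟨inferInstance, ?_⟩
  simpa using (memLp_id_gaussianReal (μ := m) (v := v) 2).integrable_sq

theorem QuadGrowth.avg {μ : Measure ℝ} (hμ : SqProb μ) {f : ℝ → ℝ} (hf : QuadGrowth f) :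
    QuadGrowth (avg μ f) := by
  obtain ⟨A, hA0, hA⟩ := hf.bound
  have := hμ.prob
  have hm : StronglyMeasurable (fun z : ℝ × ℝ => f (z.2 + z.1)) :=
    (hf.1.comp (by fun_prop)).stronglyMeasurable
  refine ⟨hm.integral_prod_right.measurable, A * (2 + 2 * ∫ x, x ^ 2 ∂μ), fun y => ?_⟩
  have h0 : 0 ≤ ∫ x, x ^ 2 ∂μ := integral_nonneg fun x => sq_nonneg x
  calc |∫ x, f (x + y) ∂μ| ≤ ∫ x, |f (x + y)| ∂μ := abs_integral_le_integral_abs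
    _ ≤ ∫ x, A * (1 + (2 * x ^ 2 + 2 * y ^ 2)) ∂μ := by
        refine integral_mono (hμ.integrable (hf.comp_add y)).abs ?_ fun x => (hA _).trans ?_
        · exact (((integrable_const 1).add ((hμ.sq.const_mul 2).add (integrable_const _))).const_mul A)
        · refine mul_le_mul_of_nonneg_left ?_ hA0
          nlinarith [sq_nonneg (x - y)]
    _ = A * (1 + (2 * (∫ x, x ^ 2 ∂μ) + 2 * y ^ 2)) := by
        have h1 : Integrable (fun x : ℝ => 2 * x ^ 2 + 2 * y ^ 2) μ :=
          (hμ.sq.const_mul 2).add (integrable_const _)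
        rw [integral_const_mul, integral_add (integrable_const 1) h1,
          integral_add (hμ.sq.const_mul 2) (integrable_const _), integral_const_mul]
        simp
    _ ≤ _ := by
        rw [mul_assoc]
        refine mul_le_mul_of_nonneg_left ?_ hA0
        nlinarith [mul_nonneg h0 (sq_nonneg y), sq_nonneg y]

theorem avg_avg {μ ν : Measure ℝ} (hμ : SqProb μ) (hν : SqProb ν) {f : ℝ → ℝ}
    (hf : QuadGrowth f) : avg μ (avg ν f) = avg (μ ∗ ν) f := by
  have := hμ.prob
  have := hν.prob
  funext y
  have hy := hf.comp_add y
  unfold avg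
  rw [integral_conv ((hμ.conv hν).integrable hy)]
  refine integral_congr_ae (ae_of_all _ fun x => ?_)
  refine integral_congr_ae (ae_of_all _ fun z => ?_)
  simp only
  congr 1
  ring

/-- Convolution on the line is commutative; this lets a Gaussian smoothing move past the law of a
partial sum. -/
theorem avg_comm {μ ν : Measure ℝ} (hμ : SqProb μ) (hν : SqProb ν) {f : ℝ → ℝ}
    (hf : QuadGrowth f) : avg μ (avg ν f) = avg ν (avg μ f) := by
  have := hμ.prob
  have := hν.prob
  rw [avg_avg hμ hν hf, avg_avg hν hμ hf, Measure.conv_comm]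

theorem avg_add {μ : Measure ℝ} (hμ : SqProb μ) {f g : ℝ → ℝ} (hf : QuadGrowth f)
    (hg : QuadGrowth g) (y : ℝ) : avg μ (fun x => f x + g x) y = avg μ f y + avg μ g y :=
  integral_add (hμ.integrable (hf.comp_add y)) (hμ.integrable (hg.comp_add y))

theorem avg_dirac_zero (f : ℝ → ℝ) : avg (Measure.dirac 0) f = f := by
  funext y
  simp [avg]

/-- Averaging against the centred Gaussian law of variance `v`. -/
noncomputable abbrev gaussAvg (v : NNReal) (f : ℝ → ℝ) : ℝ → ℝ := avg (gaussianReal 0 v) f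

theorem QuadGrowth.gaussAvg {f : ℝ → ℝ} (hf : QuadGrowth f) (v : NNReal) :
    QuadGrowth (gaussAvg v f) := QuadGrowth.avg (sqProb_gaussianReal 0 v) hf

theorem gaussAvg_gaussAvg (v w : NNReal) {f : ℝ → ℝ} (hf : QuadGrowth f) :
    gaussAvg v (gaussAvg w f) = gaussAvg (v + w) f := by
  unfold gaussAvg
  rw [avg_avg (sqProb_gaussianReal 0 v) (sqProb_gaussianReal 0 w) hf,
    gaussianReal_conv_gaussianReal, add_zero]

theorem integral_gaussianReal_scale {s : ℝ} {v : NNReal} (hv : (v : ℝ) = s ^ 2)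
    {f : ℝ → ℝ} (hf : Measurable f) :
    ∫ x, f x ∂gaussianReal 0 v = ∫ x, f (s * x) ∂gaussianReal 0 1 := by
  have h := gaussianReal_map_const_mul (μ := 0) (v := 1) s
  have hv' : NNReal.mk (s ^ 2) (sq_nonneg s) * 1 = v := by
    ext; simp [hv]
  rw [mul_zero, hv'] at h
  rw [← h, integral_map (by fun_prop) hf.aestronglyMeasurable]

/-! ### Test functions with a first-order Taylor bound -/

/-- The first-order Taylor property of order `r`: every difference of values of `f` is linear up to
an error `B * |y| ^ r`. -/
def HolderTaylor (r B : ℝ) (f : ℝ → ℝ) : Prop :=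
  Measurable f ∧ ∀ x, ∃ c, ∀ y, |f (x + y) - f x - c * y| ≤ B * |y| ^ r

theorem abs_rpow_le_one_add_sq {r : ℝ} (hr : 0 ≤ r) (hr' : r ≤ 2) (y : ℝ) :
    |y| ^ r ≤ 1 + y ^ 2 := by
  rcases le_total |y| 1 with h | h
  · have := Real.rpow_le_one (abs_nonneg y) h hr
    nlinarith [sq_nonneg y]
  · have := Real.rpow_le_rpow_of_exponent_le h hr'
    rw [Real.rpow_two, sq_abs] at this
    linarith

theorem HolderTaylor.nonneg {r B : ℝ} {f : ℝ → ℝ} (hf : HolderTaylor r B f) : 0 ≤ B := by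
  obtain ⟨c, hc⟩ := hf.2 0
  have := (abs_nonneg _).trans (hc 1)
  simpa using this

theorem HolderTaylor.quadGrowth {r B : ℝ} (hr : 0 ≤ r) (hr' : r ≤ 2) {f : ℝ → ℝ}
    (hf : HolderTaylor r B f) : QuadGrowth f := by
  have hB := hf.nonneg
  obtain ⟨c, hc⟩ := hf.2 0
  refine ⟨hf.1, |f 0| + |c| + B, fun x => ?_⟩
  have h1 := hc x
  rw [zero_add] at h1
  have h2 := abs_rpow_le_one_add_sq hr hr' x
  have h3 : |f x| ≤ |f x - f 0 - c * x| + |f 0| + |c * x| := by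
    have : f x = (f x - f 0 - c * x) + f 0 + c * x := by ring
    calc |f x| = |(f x - f 0 - c * x) + f 0 + c * x| := by rw [← this]
      _ ≤ _ := (abs_add_le _ _).trans (add_le_add_left (abs_add_le _ _) _)
  rw [abs_mul] at h3
  have h4 : |x| ≤ 1 + x ^ 2 := by nlinarith [sq_abs x, sq_nonneg (|x| - 1)]
  nlinarith [mul_le_mul_of_nonneg_left h4 (abs_nonneg c), mul_le_mul_of_nonneg_left h2 hB,
    mul_nonneg (abs_nonneg (f 0)) (sq_nonneg x)]

theorem HolderTaylor.comp_affine {r B : ℝ} {f : ℝ → ℝ} (hf : HolderTaylor r B f) (a b : ℝ) :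
    HolderTaylor r (B * |a| ^ r) (fun x => f (a * x + b)) := by
  refine ⟨hf.1.comp (by fun_prop), fun x => ?_⟩
  obtain ⟨c, hc⟩ := hf.2 (a * x + b)
  refine ⟨c * a, fun y => ?_⟩
  have := hc (a * y)
  rw [abs_mul, Real.mul_rpow (abs_nonneg _) (abs_nonneg _), ← mul_assoc, ← mul_assoc,
    show a * x + b + a * y = a * (x + y) + b by ring] at this
  exact this

theorem HolderTaylor.comp_add {r B : ℝ} {f : ℝ → ℝ} (hf : HolderTaylor r B f) (b : ℝ) :
    HolderTaylor r B (fun x => f (x + b)) := by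
  simpa using hf.comp_affine 1 b

/-- The linear coefficient may be taken to be 0. An error known only to be bounded can thereby be
fed into the estimates for test functions, as in `lindeberg_step`. -/
theorem holderTaylor_of_bounded {B : ℝ} {f : ℝ → ℝ} (hm : Measurable f) (hf : ∀ x, |f x| ≤ B) :
    HolderTaylor 0 (2 * B) f := by
  refine ⟨hm, fun x => ⟨0, fun y => ?_⟩⟩
  rw [Real.rpow_zero, zero_mul, sub_zero, mul_one]
  refine (abs_sub _ _).trans ?_
  linarith [hf x, hf (x + y)]

/-- The linear part integrates to zero against a centred Gaussian. The factor 2 is the Gaussian mean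
of 1 + y², which dominates |y|^r. -/
theorem HolderTaylor.abs_gaussAvg_sub_le {r B : ℝ} (hr : 0 ≤ r) (hr' : r ≤ 2) {f : ℝ → ℝ}
    (hf : HolderTaylor r B f) {s : ℝ} (hs : 0 ≤ s) {v : NNReal} (hv : (v : ℝ) = s ^ 2) (x : ℝ) :
    |gaussAvg v f x - f x| ≤ 2 * B * s ^ r := by
  obtain ⟨c, hc⟩ := hf.2 x
  have hB := hf.nonneg
  have hq := hf.quadGrowth hr hr'
  have hG := sqProb_gaussianReal 0 1
  have hqq : QuadGrowth (fun y => f (x + s * y)) := by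
    simpa [add_comm] using hq.comp_affine s x
  have hlin : Integrable (fun y : ℝ => y) (gaussianReal 0 1) := by
    simpa using hG.integrable (f := fun y => y) ⟨measurable_id, 1, fun x => by
      nlinarith [sq_abs x, sq_nonneg (|x| - 1)]⟩
  have hvar : ∫ y, y ^ 2 ∂gaussianReal 0 1 = 1 := by
    have h := variance_fun_id_gaussianReal (μ := 0) (v := 1)
    rw [variance_eq_integral (by fun_prop)] at h
    simpa [integral_id_gaussianReal] using h
  have e1 : gaussAvg v f x - f x = ∫ y, (f (x + s * y) - f x - c * (s * y)) ∂gaussianReal 0 1 := by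
    have h1 : Integrable (fun y => f (x + s * y) - f x) (gaussianReal 0 1) :=
      (hG.integrable hqq).sub (integrable_const _)
    rw [integral_sub h1 ((hlin.const_mul s).const_mul c), integral_sub (hG.integrable hqq) (integrable_const _),
      integral_const_mul, integral_const_mul, integral_id_gaussianReal]
    simp only [integral_const, probReal_univ, one_smul, mul_zero, sub_zero]
    congr 1
    have := integral_gaussianReal_scale hv (hq.comp_add x).1
    simp only [gaussAvg, avg]
    rw [this]
    simp only [add_comm]
  rw [e1]
  calc |∫ y, (f (x + s * y) - f x - c * (s * y)) ∂gaussianReal 0 1|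
      ≤ ∫ y, |f (x + s * y) - f x - c * (s * y)| ∂gaussianReal 0 1 := abs_integral_le_integral_abs
    _ ≤ ∫ y, B * s ^ r * (1 + y ^ 2) ∂gaussianReal 0 1 := by
        refine integral_mono
          (((hG.integrable hqq).sub (integrable_const _)).sub ((hlin.const_mul s).const_mul c)).abs
          (((integrable_const 1).add hG.sq).const_mul _) fun y => ?_
        refine (hc (s * y)).trans ?_
        rw [abs_mul, abs_of_nonneg hs, Real.mul_rpow hs (abs_nonneg _), ← mul_assoc]
        exact mul_le_mul_of_nonneg_left (abs_rpow_le_one_add_sq hr hr' y)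
          (mul_nonneg hB (Real.rpow_nonneg hs _))
    _ = 2 * B * s ^ r := by
        rw [integral_const_mul, integral_add (integrable_const 1) hG.sq, hvar]
        simp
        ring

/-! ### Smoothing by Gaussian kernels -/

/-- Half of the Gaussian decay absorbs the polynomial: for u = |y|^n one has u ≤ 1 + u², and u² is
up to a constant a term of the exponential series of b y²/2. -/
theorem exists_abs_eval_mul_exp_le (P : Polynomial ℝ) {b : ℝ} (hb : 0 < b) :
    ∃ C, 0 ≤ C ∧ ∀ y : ℝ, |P.eval y| * Real.exp (-b * y ^ 2) ≤ C * Real.exp (-(b / 2) * y ^ 2) := by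
  induction P using Polynomial.induction_on' with
  | add P Q hP hQ =>
    obtain ⟨C, hC, h⟩ := hP
    obtain ⟨C', hC', h'⟩ := hQ
    refine ⟨C + C', add_nonneg hC hC', fun y => ?_⟩
    rw [Polynomial.eval_add, add_mul]
    refine le_trans ?_ (add_le_add (h y) (h' y))
    rw [← add_mul]
    exact mul_le_mul_of_nonneg_right (abs_add_le _ _) (Real.exp_pos _).le
  | monomial n a =>
    refine ⟨|a| * (1 + (2 / b) ^ n * n.factorial), by positivity, fun y => ?_⟩
    have h1 : |y| ^ n ≤ (1 + (2 / b) ^ n * n.factorial) * Real.exp (b / 2 * y ^ 2) := by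
      have h2 := Real.pow_div_factorial_le_exp (x := b / 2 * y ^ 2) (by positivity) n
      rw [div_le_iff₀ (by positivity), mul_pow] at h2
      have h3 : (2 / b) ^ n * ((b / 2) ^ n * (y ^ 2) ^ n) = (|y| ^ n) ^ 2 := by
        rw [← mul_assoc, ← mul_pow, show 2 / b * (b / 2) = 1 by field_simp, one_pow, one_mul,
          ← sq_abs y]
        ring
      have h4 : (|y| ^ n) ^ 2 ≤ (2 / b) ^ n * n.factorial * Real.exp (b / 2 * y ^ 2) := by
        rw [← h3]
        calc _ ≤ (2 / b) ^ n * (Real.exp (b / 2 * y ^ 2) * n.factorial) :=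
              mul_le_mul_of_nonneg_left h2 (by positivity)
          _ = _ := by ring
      have h5 : (1 : ℝ) ≤ Real.exp (b / 2 * y ^ 2) := Real.one_le_exp (by positivity)
      nlinarith [sq_nonneg (|y| ^ n - 1)]
    have h6 : Real.exp (b / 2 * y ^ 2) * Real.exp (-b * y ^ 2) = Real.exp (-(b / 2) * y ^ 2) := by
      rw [← Real.exp_add]; congr 1; ring
    rw [Polynomial.eval_monomial, abs_mul, abs_pow, ← h6]
    calc |a| * |y| ^ n * Real.exp (-b * y ^ 2)
        ≤ |a| * ((1 + (2 / b) ^ n * n.factorial) * Real.exp (b / 2 * y ^ 2)) *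
          Real.exp (-b * y ^ 2) := by gcongr
      _ = _ := by ring

theorem integrable_eval_mul_exp (P : Polynomial ℝ) {b : ℝ} (hb : 0 < b) :
    Integrable (fun y : ℝ => P.eval y * Real.exp (-b * y ^ 2)) := by
  obtain ⟨C, hC, h⟩ := exists_abs_eval_mul_exp_le P hb
  refine ((integrable_exp_neg_mul_sq (half_pos hb)).const_mul C).mono' (by fun_prop)
    (ae_of_all _ fun y => ?_)
  rw [norm_mul, Real.norm_eq_abs, Real.norm_eq_abs, abs_of_pos (Real.exp_pos _)]
  exact h y

theorem integrable_quadGrowth_mul_exp {f : ℝ → ℝ} (hf : QuadGrowth f) (P : Polynomial ℝ) {b : ℝ}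
    (hb : 0 < b) (x s : ℝ) :
    Integrable (fun y : ℝ => f (x + s * y) * (P.eval y * Real.exp (-b * y ^ 2))) := by
  obtain ⟨A, hA, hfA⟩ := hf.bound
  have h := (integrable_eval_mul_exp (Polynomial.C A *
    (1 + (Polynomial.C x + Polynomial.C s * Polynomial.X) ^ 2) * P) hb).norm
  refine h.mono' ((hf.1.comp (by fun_prop)).aestronglyMeasurable.mul (by fun_prop))
    (ae_of_all _ fun y => ?_)
  simp only [Polynomial.eval_mul, Polynomial.eval_C, Polynomial.eval_add, Polynomial.eval_one,
    Polynomial.eval_pow, Polynomial.eval_X]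
  rw [norm_mul, mul_assoc _ (Polynomial.eval y P), norm_mul (A * _)]
  refine mul_le_mul_of_nonneg_right ?_ (norm_nonneg _)
  rw [Real.norm_eq_abs, Real.norm_eq_abs, abs_of_nonneg (by positivity : 0 ≤ A * (1 + (x + s * y) ^ 2))]
  exact hfA _

/-- The average of the translates `f (x + s * y)` against the weight `P y * exp (-y ^ 2 / 2)`. -/
noncomputable def gaussWeight (P : Polynomial ℝ) (s : ℝ) (f : ℝ → ℝ) (x : ℝ) : ℝ :=
  ∫ y, f (x + s * y) * (P.eval y * Real.exp (-(1 / 2) * y ^ 2))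

/-- Up to sign, the action of differentiation on the polynomial factor of `P y * exp (-y ^ 2 / 2)`. -/
noncomputable def hermiteStep (P : Polynomial ℝ) : Polynomial ℝ :=
  Polynomial.X * P - Polynomial.derivative P

theorem hasDerivAt_eval_mul_exp (P : Polynomial ℝ) (y : ℝ) :
    HasDerivAt (fun y : ℝ => P.eval y * Real.exp (-(1 / 2) * y ^ 2))
      (-((hermiteStep P).eval y * Real.exp (-(1 / 2) * y ^ 2))) y := by
  have h1 : HasDerivAt (fun y : ℝ => Real.exp (-(1 / 2) * y ^ 2))
      (Real.exp (-(1 / 2) * y ^ 2) * (-(1 / 2) * (2 * y))) y := by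
    have := ((hasDerivAt_pow 2 y).const_mul (-(1 / 2) : ℝ)).exp
    simpa using this
  have := (P.hasDerivAt y).mul h1
  refine this.congr_deriv ?_
  simp only [hermiteStep, Polynomial.eval_sub, Polynomial.eval_mul, Polynomial.eval_X]
  ring

/-- A translation of the integration variable moves x from f into the kernel, so that only the
kernel is differentiated and f need not be smooth. Each derivative costs a factor 1/s. -/
theorem hasDerivAt_gaussWeight {f : ℝ → ℝ} (hf : QuadGrowth f) (P : Polynomial ℝ) {s : ℝ}
    (hs : 0 < s) (x₀ : ℝ) :
    HasDerivAt (gaussWeight P s f) (s⁻¹ * gaussWeight (hermiteStep P) s f x₀) x₀ := by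
  set K : ℝ → ℝ := fun y => P.eval y * Real.exp (-(1 / 2) * y ^ 2) with hK
  set L : ℝ → ℝ := fun y => (hermiteStep P).eval y * Real.exp (-(1 / 2) * y ^ 2) with hL
  have hKc : Measurable K := by fun_prop
  have hLc : Measurable L := by fun_prop
  have e : gaussWeight P s f = fun x => ∫ y, f (x₀ + s * y) * K (y - (x - x₀) / s) := by
    funext x
    have := integral_sub_right_eq_self (μ := volume)
      (fun y => f (x + s * y) * K y) ((x - x₀) / s)
    unfold gaussWeight
    rw [← this]
    refine integral_congr_ae (ae_of_all _ fun y => ?_)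
    dsimp only
    congr 2
    field_simp
    ring
  have hmf : Measurable fun y => f (x₀ + s * y) := hf.1.comp (by fun_prop)
  obtain ⟨C, hC, hCL⟩ := exists_abs_eval_mul_exp_le (hermiteStep P) (b := 1 / 2) (by norm_num)
  -- On the ball of radius s the kernel is shifted by some e with |e| ≤ 1, and (y - e)² ≥ y²/2 - 1.
  -- The decay exp(-(y - e)²/4) is therefore at most exp(1/4) exp(-y²/8).
  have hdom : Integrable (fun y : ℝ => ‖f (x₀ + s * y) * ((Polynomial.C (s⁻¹ * C *
      Real.exp (1 / 4))).eval y * Real.exp (-(1 / 8) * y ^ 2))‖) :=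
    (integrable_quadGrowth_mul_exp hf _ (by norm_num) x₀ s).norm
  have key := hasDerivAt_integral_of_dominated_loc_of_deriv_le (μ := volume)
    (F := fun x y => f (x₀ + s * y) * K (y - (x - x₀) / s))
    (F' := fun x y => f (x₀ + s * y) * (s⁻¹ * L (y - (x - x₀) / s)))
    (x₀ := x₀) (s := Metric.ball x₀ s) (Metric.ball_mem_nhds _ hs)
    (Filter.Eventually.of_forall fun x => (hmf.mul (by fun_prop)).aestronglyMeasurable)
    (by simpa [hK] using integrable_quadGrowth_mul_exp hf P (b := 1 / 2) (by norm_num) x₀ s)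
    (hmf.mul (by fun_prop)).aestronglyMeasurable
    (ae_of_all _ ?_) hdom (ae_of_all _ ?_)
  · rw [e]
    refine key.2.congr_deriv ?_
    simp only [sub_self, zero_div, sub_zero, gaussWeight]
    rw [← integral_const_mul]
    refine integral_congr_ae (ae_of_all _ fun y => ?_)
    simp only [hL]
    ring
  · intro y x hx
    have hnn : 0 ≤ (Polynomial.C (s⁻¹ * C * Real.exp (1 / 4))).eval y *
        Real.exp (-(1 / 8) * y ^ 2) := by
      rw [Polynomial.eval_C]; positivity
    rw [norm_mul, norm_mul, norm_mul (f _)]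
    refine mul_le_mul_of_nonneg_left ?_ (norm_nonneg _)
    rw [Real.norm_of_nonneg hnn, Real.norm_eq_abs, Real.norm_eq_abs, abs_of_pos (inv_pos.2 hs), Polynomial.eval_C,
      mul_assoc, mul_assoc]
    refine mul_le_mul_of_nonneg_left ?_ (inv_pos.2 hs).le
    have hx' : |(x - x₀) / s| ≤ 1 := by
      rw [abs_div, abs_of_pos hs, div_le_one hs]
      exact (Metric.mem_ball.1 hx).le
    set e := (x - x₀) / s
    have h1 := hCL (y - e)
    rw [hL]
    simp only
    rw [abs_mul, abs_of_pos (Real.exp_pos _)]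
    refine h1.trans (mul_le_mul_of_nonneg_left ?_ hC)
    rw [← Real.exp_add]
    apply Real.exp_le_exp.2
    have : e ^ 2 ≤ 1 := by rw [← sq_abs]; exact pow_le_one₀ (abs_nonneg _) hx'
    nlinarith [sq_nonneg (y - 2 * e)]
  · intro y x _
    have h1 : HasDerivAt (fun x => y - (x - x₀) / s) (-(1 / s)) x :=
      (((hasDerivAt_id x).sub_const x₀).div_const s).const_sub y
    have h2 := (hasDerivAt_eval_mul_exp P (y - (x - x₀) / s)).comp x h1
    refine (h2.const_mul _).congr_deriv ?_
    simp only [hL]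
    ring

/-- The weighted average of the constant 1 does not depend on x, so its derivative vanishes. -/
theorem integral_hermiteStep (P : Polynomial ℝ) :
    ∫ y, (hermiteStep P).eval y * Real.exp (-(1 / 2) * y ^ 2) = 0 := by
  have hq : QuadGrowth (fun _ => (1 : ℝ)) :=
    ⟨measurable_const, 1, fun x => by rw [abs_one]; nlinarith [sq_nonneg x]⟩
  have h := hasDerivAt_gaussWeight hq P one_pos 0
  have h' : HasDerivAt (gaussWeight P 1 fun _ => (1 : ℝ)) 0 0 := by
    unfold gaussWeight
    simpa using hasDerivAt_const _ _
  simpa [gaussWeight] using h.unique h'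

theorem quadGrowth_id : QuadGrowth (fun x => x) :=
  ⟨measurable_id, 1, fun x => by nlinarith [sq_abs x, sq_nonneg (|x| - 1)]⟩

/-- The weighted average of the identity is affine in x with slope the integral of the weight.
Together with `integral_hermiteStep`, this makes two Hermite steps annihilate affine functions. -/
theorem integral_mul_hermiteStep (P : Polynomial ℝ) :
    ∫ y, y * ((hermiteStep P).eval y * Real.exp (-(1 / 2) * y ^ 2)) =
      ∫ y, P.eval y * Real.exp (-(1 / 2) * y ^ 2) := by
  have h := hasDerivAt_gaussWeight quadGrowth_id P one_pos 0
  have h' : HasDerivAt (gaussWeight P 1 fun x => x)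
      (∫ y, P.eval y * Real.exp (-(1 / 2) * y ^ 2)) 0 := by
    have e : (gaussWeight P 1 fun x => x) = fun x =>
        x * (∫ y, P.eval y * Real.exp (-(1 / 2) * y ^ 2)) +
          ∫ y, y * (P.eval y * Real.exp (-(1 / 2) * y ^ 2)) := by
      funext x
      unfold gaussWeight
      have h1 := integrable_eval_mul_exp P (b := 1 / 2) (by norm_num)
      have h2 := integrable_quadGrowth_mul_exp quadGrowth_id P (b := 1 / 2) (by norm_num) 0 1
      simp only [zero_add, one_mul] at h2
      rw [← integral_const_mul, ← integral_add (h1.const_mul x) h2]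
      refine integral_congr_ae (ae_of_all _ fun y => ?_)
      simp only
      ring
    rw [e]
    exact ((((hasDerivAt_id (0 : ℝ)).mul_const
      (∫ y, P.eval y * Real.exp (-(1 / 2) * y ^ 2))).add_const
        (∫ y, y * (P.eval y * Real.exp (-(1 / 2) * y ^ 2))))).congr_deriv (one_mul _)
  have := h.unique h'
  simpa [gaussWeight] using this

/-- Twofold Hermite steps kill affine functions, so the weighted averages are controlled by `B`. -/
theorem HolderTaylor.abs_gaussWeight_le {r B : ℝ} (hr : 0 ≤ r) (hr' : r ≤ 2) {f : ℝ → ℝ}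
    (hf : HolderTaylor r B f) (P : Polynomial ℝ) {s : ℝ} (hs : 0 < s) (x : ℝ) :
    |gaussWeight (hermiteStep (hermiteStep P)) s f x| ≤ B * s ^ r *
      ∫ y, (1 + y ^ 2) *
        |(hermiteStep (hermiteStep P)).eval y * Real.exp (-(1 / 2) * y ^ 2)| := by
  obtain ⟨c, hc⟩ := hf.2 x
  have hB := hf.nonneg
  have hq := hf.quadGrowth hr hr'
  set Q := hermiteStep (hermiteStep P) with hQ
  have i1 := integrable_quadGrowth_mul_exp hq Q (b := 1 / 2) (by norm_num) x s
  have i2 := integrable_eval_mul_exp Q (b := 1 / 2) (by norm_num)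
  have i3 := integrable_quadGrowth_mul_exp quadGrowth_id Q (b := 1 / 2) (by norm_num) 0 1
  simp only [zero_add, one_mul] at i3
  have i4 := (integrable_eval_mul_exp ((1 + Polynomial.X ^ 2) * Q) (b := 1 / 2) (by norm_num)).norm
  have e : gaussWeight Q s f x =
      ∫ y, (f (x + s * y) - f x - c * (s * y)) * (Q.eval y * Real.exp (-(1 / 2) * y ^ 2)) := by
    have e1 : ∀ y, (f (x + s * y) - f x - c * (s * y)) * (Q.eval y * Real.exp (-(1 / 2) * y ^ 2)) =
        f (x + s * y) * (Q.eval y * Real.exp (-(1 / 2) * y ^ 2)) -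
        (f x * (Q.eval y * Real.exp (-(1 / 2) * y ^ 2)) +
        c * s * (y * (Q.eval y * Real.exp (-(1 / 2) * y ^ 2)))) := fun y => by ring
    simp only [e1]
    have i5 : Integrable (fun y => f x * (Q.eval y * Real.exp (-(1 / 2) * y ^ 2)) +
        c * s * (y * (Q.eval y * Real.exp (-(1 / 2) * y ^ 2)))) :=
      (i2.const_mul _).add (i3.const_mul _)
    rw [integral_sub i1 i5,
      integral_add (i2.const_mul _) (i3.const_mul _), integral_const_mul, integral_const_mul, hQ,
      integral_hermiteStep, integral_mul_hermiteStep, integral_hermiteStep]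
    simp [gaussWeight]
  rw [e, ← integral_const_mul]
  refine abs_integral_le_integral_abs.trans (integral_mono_of_nonneg
    (ae_of_all _ fun y => abs_nonneg _) ?_ (ae_of_all _ fun y => ?_))
  · refine (i4.const_mul (B * s ^ r)).congr (ae_of_all _ fun y => ?_)
    simp only [Polynomial.eval_mul, Polynomial.eval_add, Polynomial.eval_one, Polynomial.eval_pow,
      Polynomial.eval_X]
    rw [mul_assoc (1 + y ^ 2), norm_mul, Real.norm_eq_abs, abs_of_nonneg (by positivity :
      0 ≤ 1 + y ^ 2), Real.norm_eq_abs]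
  · simp only
    rw [abs_mul, ← mul_assoc (B * s ^ r)]
    refine mul_le_mul_of_nonneg_right ((hc (s * y)).trans ?_) (abs_nonneg _)
    rw [abs_mul, abs_of_pos hs, Real.mul_rpow hs.le (abs_nonneg _), ← mul_assoc]
    exact mul_le_mul_of_nonneg_left (abs_rpow_le_one_add_sq hr hr' y)
      (mul_nonneg hB (Real.rpow_nonneg hs.le _))

theorem gaussAvg_eq_gaussWeight {f : ℝ → ℝ} (hf : QuadGrowth f) {s : ℝ} {v : NNReal}
    (hv : (v : ℝ) = s ^ 2) :
    gaussAvg v f = fun x => (Real.sqrt (2 * Real.pi))⁻¹ * gaussWeight 1 s f x := by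
  funext x
  simp only [gaussAvg, avg]
  rw [integral_gaussianReal_scale hv (hf.comp_add x).1,
    integral_gaussianReal_eq_integral_smul one_ne_zero]
  unfold gaussWeight
  rw [← integral_const_mul]
  refine integral_congr_ae (ae_of_all _ fun y => ?_)
  simp only [gaussianPDFReal, smul_eq_mul, NNReal.coe_one, mul_one, sub_zero, Polynomial.eval_one,
    one_mul]
  rw [add_comm (s * y) x, show -y ^ 2 / 2 = -(1 / 2) * y ^ 2 by ring]
  ring

/-- Gaussian averages of `f` have four derivatives, of sizes governed by the width `s`. -/
theorem exists_gaussAvg_derivatives : ∃ K : ℝ, 0 < K ∧ ∀ (r B : ℝ), 0 ≤ r → r ≤ 2 →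
    ∀ (f : ℝ → ℝ), HolderTaylor r B f → ∀ (s : ℝ) (v : NNReal), 0 < s → (v : ℝ) = s ^ 2 →
    ∃ h₁ h₂ h₃ h₄ : ℝ → ℝ,
      (∀ x, HasDerivAt (gaussAvg v f) (h₁ x) x) ∧ (∀ x, HasDerivAt h₁ (h₂ x) x) ∧
      (∀ x, HasDerivAt h₂ (h₃ x) x) ∧ (∀ x, HasDerivAt h₃ (h₄ x) x) ∧
      (∀ x, |h₂ x| ≤ K * B * s ^ (r - 2)) ∧ (∀ x, |h₃ x| ≤ K * B * s ^ (r - 3)) ∧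
      (∀ x, |h₄ x| ≤ K * B * s ^ (r - 4)) := by
  obtain ⟨c, hc, hcG⟩ : ∃ c : ℝ, 0 ≤ c ∧ ∀ (f : ℝ → ℝ), QuadGrowth f → ∀ (s : ℝ) (v : NNReal),
      (v : ℝ) = s ^ 2 → gaussAvg v f = fun x => c * gaussWeight 1 s f x :=
    ⟨(Real.sqrt (2 * Real.pi))⁻¹, by positivity, fun f hf s v hv => gaussAvg_eq_gaussWeight hf hv⟩
  obtain ⟨I, hI, hIb⟩ : ∃ I : Polynomial ℝ → ℝ, (∀ Q, 0 ≤ I Q) ∧ ∀ (r B : ℝ), 0 ≤ r → r ≤ 2 →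
      ∀ (f : ℝ → ℝ), HolderTaylor r B f → ∀ (P : Polynomial ℝ) (s : ℝ), 0 < s → ∀ x,
      |gaussWeight (hermiteStep (hermiteStep P)) s f x| ≤
        B * s ^ r * I (hermiteStep (hermiteStep P)) :=
    ⟨fun Q => ∫ y, (1 + y ^ 2) * |Q.eval y * Real.exp (-(1 / 2) * y ^ 2)|,
      fun Q => integral_nonneg fun y => by positivity,
      fun r B hr hr' f hf P s hs x => hf.abs_gaussWeight_le hr hr' P hs x⟩
  -- The Q k are the Hermite polynomials. Only from k = 2 on is Q k a twofold Hermite step, which is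
  -- why no bound is available for the first derivative.
  obtain ⟨Q, hQ0, hQ⟩ : ∃ Q : ℕ → Polynomial ℝ, Q 0 = 1 ∧ ∀ k, hermiteStep (Q k) = Q (k + 1) :=
    ⟨fun k => hermiteStep^[k] 1, rfl, fun k => (Function.iterate_succ_apply' _ _ _).symm⟩
  refine ⟨c * (I (Q 2) + I (Q 3) + I (Q 4)) + 1, ?_, ?_⟩
  · have := hI (Q 2)
    have := hI (Q 3)
    have := hI (Q 4)
    positivity
  intro r B hr hr' f hf s v hs hv
  have hq := hf.quadGrowth hr hr'
  have hB := hf.nonneg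
  have hd : ∀ (k : ℕ) (x : ℝ), HasDerivAt (fun x => c * s⁻¹ ^ k * gaussWeight (Q k) s f x)
      (c * s⁻¹ ^ (k + 1) * gaussWeight (Q (k + 1)) s f x) x := fun k x => by
    have := (hasDerivAt_gaussWeight hq (Q k) hs x).const_mul (c * s⁻¹ ^ k)
    refine this.congr_deriv ?_
    rw [hQ]
    ring
  have bd : ∀ (k : ℕ) (K : ℝ) (x : ℝ), c * I (Q (k + 2)) ≤ K →
      |c * s⁻¹ ^ (k + 2) * gaussWeight (Q (k + 2)) s f x| ≤
        K * B * s ^ (r - ((k + 2 : ℕ) : ℝ)) := by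
    intro k K x hK
    have h1 := hIb r B hr hr' f hf (Q k) s hs x
    rw [hQ, hQ] at h1
    rw [abs_mul, abs_of_nonneg (by positivity : 0 ≤ c * s⁻¹ ^ (k + 2)), Real.rpow_sub hs,
      Real.rpow_natCast]
    calc c * s⁻¹ ^ (k + 2) * |gaussWeight (Q (k + 2)) s f x|
        ≤ c * s⁻¹ ^ (k + 2) * (B * s ^ r * I (Q (k + 2))) :=
          mul_le_mul_of_nonneg_left h1 (by positivity)
      _ = c * I (Q (k + 2)) * (B * s ^ r * s⁻¹ ^ (k + 2)) := by ring
      _ ≤ K * (B * s ^ r * s⁻¹ ^ (k + 2)) := by gcongr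
      _ = _ := by rw [inv_pow]; ring
  have h2 := mul_nonneg hc (hI (Q 2))
  have h3 := mul_nonneg hc (hI (Q 3))
  have h4 := mul_nonneg hc (hI (Q 4))
  refine ⟨_, _, _, _, fun x => ?_, hd 1, hd 2, hd 3, fun x => ?_, fun x => ?_, fun x => ?_⟩
  · rw [hcG f hq s v hv]
    simpa [hQ0] using hd 0 x
  · exact_mod_cast bd 0 _ x (by linarith)
  · exact_mod_cast bd 1 _ x (by linarith)
  · exact_mod_cast bd 2 _ x (by linarith)

/-! ### Taylor expansions and the exchange of one summand -/

/-- Mean value inequality, to be iterated: each use raises the order of the Taylor remainder by one.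
The factorials are given up. -/
theorem abs_le_of_abs_deriv_le {g g' : ℝ → ℝ} {C : ℝ} {k : ℕ} (hC : 0 ≤ C) (h0 : g 0 = 0)
    (hg : ∀ t, HasDerivAt g (g' t) t) (hb : ∀ t, |g' t| ≤ C * |t| ^ k) (y : ℝ) :
    |g y| ≤ C * |y| ^ (k + 1) := by
  have h := (convex_uIcc (0 : ℝ) y).norm_image_sub_le_of_norm_hasDerivWithin_le
    (f := g) (f' := g') (C := C * |y| ^ k) (fun t _ => (hg t).hasDerivWithinAt) (fun t ht => ?_)
    Set.left_mem_uIcc Set.right_mem_uIcc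
  · rw [h0, sub_zero, sub_zero, Real.norm_eq_abs, Real.norm_eq_abs] at h
    rw [pow_succ, ← mul_assoc]
    exact h
  · refine (hb t).trans (mul_le_mul_of_nonneg_left (pow_le_pow_left₀ (abs_nonneg _) ?_ _) hC)
    simpa using Set.abs_sub_left_of_mem_uIcc ht

theorem hasDerivAt_comp_add_sub {F h : ℝ → ℝ} (hF : ∀ x, HasDerivAt F (h x) x) (x t : ℝ) :
    HasDerivAt (fun y => F (x + y)) (h (x + t)) t := by
  simpa using HasDerivAt.comp_const_add x t (hF (x + t))

theorem taylor_one {F h₁ h₂ : ℝ → ℝ} {C : ℝ} (hF : ∀ x, HasDerivAt F (h₁ x) x)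
    (h1 : ∀ x, HasDerivAt h₁ (h₂ x) x) (hb : ∀ x, |h₂ x| ≤ C) (x y : ℝ) :
    |F (x + y) - F x - h₁ x * y| ≤ C * |y| ^ 2 := by
  have hC : 0 ≤ C := (abs_nonneg _).trans (hb 0)
  refine abs_le_of_abs_deriv_le (g := fun y => F (x + y) - F x - h₁ x * y)
    (g' := fun y => h₁ (x + y) - h₁ x) (k := 1) hC (by simp) (fun t => ?_) (fun t => ?_) y
  · exact ((hasDerivAt_comp_add_sub hF x t).sub_const _).sub
      (((hasDerivAt_id t).const_mul (h₁ x)).congr_deriv (mul_one _))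
  · refine abs_le_of_abs_deriv_le (g := fun y => h₁ (x + y) - h₁ x)
      (g' := fun y => h₂ (x + y)) (k := 0) hC (by simp) (fun t => ?_) (fun t => ?_) t
    · exact (hasDerivAt_comp_add_sub h1 x t).sub_const _
    · simpa using hb (x + t)

theorem taylor_two {F h₁ h₂ h₃ : ℝ → ℝ} {C : ℝ} (hF : ∀ x, HasDerivAt F (h₁ x) x)
    (h1 : ∀ x, HasDerivAt h₁ (h₂ x) x) (h2 : ∀ x, HasDerivAt h₂ (h₃ x) x)
    (hb : ∀ x, |h₃ x| ≤ C) (x y : ℝ) :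
    |F (x + y) - F x - h₁ x * y - h₂ x * (y ^ 2 / 2)| ≤ C * |y| ^ 3 := by
  have hC : 0 ≤ C := (abs_nonneg _).trans (hb 0)
  refine abs_le_of_abs_deriv_le (g := fun y => F (x + y) - F x - h₁ x * y - h₂ x * (y ^ 2 / 2))
    (g' := fun y => h₁ (x + y) - h₁ x - h₂ x * y) (k := 2) hC (by simp) (fun t => ?_)
    (fun t => taylor_one h1 h2 hb x t) y
  refine (((hasDerivAt_comp_add_sub hF x t).sub_const _).sub
      (((hasDerivAt_id t).const_mul (h₁ x)).congr_deriv (mul_one _))).sub ?_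
  refine (((hasDerivAt_pow 2 t).div_const 2).const_mul (h₂ x)).congr_deriv ?_
  norm_num

theorem taylor_three {F h₁ h₂ h₃ h₄ : ℝ → ℝ} {C : ℝ} (hF : ∀ x, HasDerivAt F (h₁ x) x)
    (h1 : ∀ x, HasDerivAt h₁ (h₂ x) x) (h2 : ∀ x, HasDerivAt h₂ (h₃ x) x)
    (h3 : ∀ x, HasDerivAt h₃ (h₄ x) x) (hb : ∀ x, |h₄ x| ≤ C) (x y : ℝ) :
    |F (x + y) - F x - h₁ x * y - h₂ x * (y ^ 2 / 2) - h₃ x * (y ^ 3 / 6)| ≤ C * |y| ^ 4 := by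
  have hC : 0 ≤ C := (abs_nonneg _).trans (hb 0)
  refine abs_le_of_abs_deriv_le
    (g := fun y => F (x + y) - F x - h₁ x * y - h₂ x * (y ^ 2 / 2) - h₃ x * (y ^ 3 / 6))
    (g' := fun y => h₁ (x + y) - h₁ x - h₂ x * y - h₃ x * (y ^ 2 / 2)) (k := 3) hC (by simp)
    (fun t => ?_) (fun t => taylor_two h1 h2 h3 hb x t) y
  refine ((((hasDerivAt_comp_add_sub hF x t).sub_const _).sub
      (((hasDerivAt_id t).const_mul (h₁ x)).congr_deriv (mul_one _))).sub
      ((((hasDerivAt_pow 2 t).div_const 2).const_mul (h₂ x)).congr_deriv ?_)).sub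
      ((((hasDerivAt_pow 3 t).div_const 6).const_mul (h₃ x)).congr_deriv ?_)
  · norm_num
  · simp only [Nat.cast_ofNat, Nat.add_one_sub_one]
    ring

theorem integral_gaussianReal_pow_scale {a : ℝ} {w : NNReal} (hw : (w : ℝ) = a ^ 2) (k : ℕ) :
    ∫ y, y ^ k ∂gaussianReal 0 w = a ^ k * ∫ y, y ^ k ∂gaussianReal 0 1 := by
  rw [integral_gaussianReal_scale hw (by fun_prop), ← integral_const_mul]
  simp only [mul_pow]

theorem integral_sq_gaussianReal (w : NNReal) : ∫ y, y ^ 2 ∂gaussianReal 0 w = w := by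
  have h := variance_fun_id_gaussianReal (μ := 0) (v := w)
  rw [variance_eq_integral (by fun_prop)] at h
  simpa [integral_id_gaussianReal] using h

theorem integral_cube_gaussianReal (w : NNReal) : ∫ y, y ^ 3 ∂gaussianReal 0 w = 0 := by
  have h := gaussianReal_map_neg (μ := 0) (v := w)
  rw [neg_zero] at h
  have h2 : ∫ y, y ^ 3 ∂gaussianReal 0 w = -∫ y, y ^ 3 ∂gaussianReal 0 w := by
    conv_lhs => rw [← h]
    rw [integral_map (by fun_prop) (by fun_prop), ← integral_neg]
    refine integral_congr_ae (ae_of_all _ fun y => ?_)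
    simp only
    ring
  linarith

theorem integrable_pow_gaussianReal (w : NNReal) (k : ℕ) :
    Integrable (fun y => y ^ k) (gaussianReal 0 w) := by
  have := (memLp_id_gaussianReal (μ := 0) (v := w) k).integrable_norm_pow'
  refine this.mono (by fun_prop) (ae_of_all _ fun y => ?_)
  simp

/-- With equal means and variances only Taylor remainders count. The third-order one, s^(r-3)|y|³,
is used for |y| ≤ s and the second-order one, s^(r-2)|y|², for |y| > s. Both are at most
s^(r-2-ρ)|y|^(2+ρ), so moments of order 2 + ρ suffice. -/
theorem exists_integral_gaussAvg_step : ∃ K : ℝ, 0 < K ∧ ∀ (r ρ B : ℝ), 0 ≤ r → r ≤ 2 → 0 ≤ ρ →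
    ρ ≤ 1 → ∀ (f : ℝ → ℝ), HolderTaylor r B f → ∀ (s : ℝ) (v : NNReal), 0 < s → (v : ℝ) = s ^ 2 →
    ∀ ν₁ ν₂ : Measure ℝ, SqProb ν₁ → SqProb ν₂ → ∫ x, x ∂ν₁ = 0 → ∫ x, x ∂ν₂ = 0 →
    ∫ x, x ^ 2 ∂ν₁ = ∫ x, x ^ 2 ∂ν₂ → Integrable (fun x => |x| ^ (2 + ρ)) ν₁ →
    Integrable (fun x => |x| ^ (2 + ρ)) ν₂ → ∀ y,
    |avg ν₁ (gaussAvg v f) y - avg ν₂ (gaussAvg v f) y| ≤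
      K * B * s ^ (r - 2 - ρ) * (∫ x, |x| ^ (2 + ρ) ∂ν₁ + ∫ x, |x| ^ (2 + ρ) ∂ν₂) := by
  obtain ⟨K, hK, hKd⟩ := exists_gaussAvg_derivatives
  refine ⟨2 * K, by positivity, fun r ρ B hr hr' hρ hρ' f hf s v hs hv => ?_⟩
  obtain ⟨h₁, h₂, h₃, h₄, d0, d1, d2, d3, b2, b3, -⟩ := hKd r B hr hr' f hf s v hs hv
  have hB := hf.nonneg
  set F := gaussAvg v f with hF
  have hFq : QuadGrowth F := (hf.quadGrowth hr hr').gaussAvg v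
  have ht : ∀ x y, |F (x + y) - F x - h₁ x * y - h₂ x * (y ^ 2 / 2)| ≤
      2 * K * B * s ^ (r - 2 - ρ) * |y| ^ (2 + ρ) := by
    intro x y
    have hKB : 0 ≤ K * B := by positivity
    rcases le_or_gt |y| s with hy | hy
    · refine (taylor_two d0 d1 d2 b3 x y).trans ?_
      have e1 : s ^ (r - 3) = s ^ (r - 2 - ρ) * s ^ (ρ - 1) := by
        rw [← Real.rpow_add hs]; congr 1; ring
      have e2 : s ^ (ρ - 1) * |y| ^ 3 ≤ |y| ^ (2 + ρ) := by
        rcases eq_or_lt_of_le (abs_nonneg y) with h0 | h0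
        · rw [← h0, Real.zero_rpow (by linarith)]; simp
        · have : |y| ^ 3 = |y| ^ (2 + ρ) * |y| ^ (1 - ρ) := by
            rw [← Real.rpow_add h0, ← Real.rpow_natCast]; congr 1; push_cast; ring
          rw [this]
          have h1 : |y| ^ (1 - ρ) ≤ s ^ (1 - ρ) := Real.rpow_le_rpow h0.le hy (by linarith)
          have h2 : s ^ (ρ - 1) * s ^ (1 - ρ) = 1 := by
            rw [← Real.rpow_add hs]; simp
          calc s ^ (ρ - 1) * (|y| ^ (2 + ρ) * |y| ^ (1 - ρ))
              ≤ s ^ (ρ - 1) * (|y| ^ (2 + ρ) * s ^ (1 - ρ)) := by gcongr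
            _ = |y| ^ (2 + ρ) * (s ^ (ρ - 1) * s ^ (1 - ρ)) := by ring
            _ = _ := by rw [h2, mul_one]
      rw [e1]
      calc K * B * (s ^ (r - 2 - ρ) * s ^ (ρ - 1)) * |y| ^ 3
          = K * B * s ^ (r - 2 - ρ) * (s ^ (ρ - 1) * |y| ^ 3) := by ring
        _ ≤ K * B * s ^ (r - 2 - ρ) * |y| ^ (2 + ρ) := by gcongr
        _ ≤ _ := by
          have : 0 ≤ K * B * s ^ (r - 2 - ρ) * |y| ^ (2 + ρ) := by positivity
          linarith
    · have h0 : 0 < |y| := hs.trans hy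
      have h1 := taylor_one d0 d1 b2 x y
      have h2 : |h₂ x * (y ^ 2 / 2)| ≤ K * B * s ^ (r - 2) * |y| ^ 2 := by
        rw [abs_mul, abs_of_nonneg (by positivity : 0 ≤ y ^ 2 / 2), sq_abs]
        refine mul_le_mul (b2 x) (by linarith [sq_nonneg y]) (by positivity) (by positivity)
      refine (abs_sub _ _).trans ((add_le_add h1 h2).trans ?_)
      have e1 : s ^ (r - 2) = s ^ (r - 2 - ρ) * s ^ ρ := by
        rw [← Real.rpow_add hs]; congr 1; ring
      have e2 : s ^ ρ * |y| ^ 2 ≤ |y| ^ (2 + ρ) := by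
        have : |y| ^ (2 + ρ) = |y| ^ 2 * |y| ^ ρ := by
          rw [Real.rpow_add h0, Real.rpow_two]
        rw [this, mul_comm]
        have h1 : s ^ ρ ≤ |y| ^ ρ := Real.rpow_le_rpow hs.le hy.le hρ
        gcongr
      rw [e1]
      calc _ = 2 * K * B * s ^ (r - 2 - ρ) * (s ^ ρ * |y| ^ 2) := by ring
        _ ≤ _ := by gcongr
  have hone : ∀ ν : Measure ℝ, SqProb ν → ∫ x, x ∂ν = 0 → Integrable (fun x => |x| ^ (2 + ρ)) ν →
      ∀ y, |avg ν F y - F y - h₂ y * ((∫ x, x ^ 2 ∂ν) / 2)| ≤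
        2 * K * B * s ^ (r - 2 - ρ) * ∫ x, |x| ^ (2 + ρ) ∂ν := by
    intro ν hν hm hi y
    have := hν.prob
    have i1 : Integrable (fun x => F (y + x)) ν := by
      simpa only [add_comm] using hν.integrable (hFq.comp_add y)
    have i2 : Integrable (fun x => F (y + x) - F y) ν := i1.sub (integrable_const _)
    have i3 : Integrable (fun x => h₁ y * x) ν := (hν.integrable quadGrowth_id).const_mul _
    have i4 : Integrable (fun x => h₂ y * (x ^ 2 / 2)) ν := (hν.sq.div_const 2).const_mul _
    have i5 : Integrable (fun x => F (y + x) - F y - h₁ y * x) ν := i2.sub i3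
    have e : avg ν F y - F y - h₂ y * ((∫ x, x ^ 2 ∂ν) / 2) =
        ∫ x, (F (y + x) - F y - h₁ y * x - h₂ y * (x ^ 2 / 2)) ∂ν := by
      rw [integral_sub i5 i4, integral_sub i2 i3, integral_sub i1 (integrable_const _),
        integral_const_mul, integral_const_mul, hm, integral_div]
      simp [avg, add_comm]
    rw [e, ← integral_const_mul]
    exact abs_integral_le_integral_abs.trans
      (integral_mono (i5.sub i4).abs (hi.const_mul _) fun x => ht y x)
  intro ν₁ ν₂ hν₁ hν₂ hm₁ hm₂ hsq hi₁ hi₂ y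
  have H₁ := hone ν₁ hν₁ hm₁ hi₁ y
  have H₂ := hone ν₂ hν₂ hm₂ hi₂ y
  rw [hsq] at H₁
  rw [abs_le] at H₁ H₂ ⊢
  constructor <;> linarith [H₁.1, H₁.2, H₂.1, H₂.2]

/-- The cubic term integrates to zero by symmetry, so that the error is of fourth order. -/
theorem abs_gaussAvg_expansion_le {F : ℝ → ℝ} (hFq : QuadGrowth F) {x c₁ c₂ c₃ C a : ℝ} {w : NNReal}
    (hw : (w : ℝ) = a ^ 2)
    (ht : ∀ y, |F (x + y) - F x - c₁ * y - c₂ * (y ^ 2 / 2) - c₃ * (y ^ 3 / 6)| ≤ C * |y| ^ 4) :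
    |gaussAvg w F x - F x - c₂ * (a ^ 2 / 2)| ≤ C * (a ^ 4 * ∫ y, y ^ 4 ∂gaussianReal 0 1) := by
  have hν := sqProb_gaussianReal 0 w
  have i1 : Integrable (fun y => F (x + y)) (gaussianReal 0 w) := by
    simpa only [add_comm] using hν.integrable (hFq.comp_add x)
  have i2 : Integrable (fun y => F (x + y) - F x) (gaussianReal 0 w) :=
    i1.sub (integrable_const _)
  have i3 : Integrable (fun y => c₁ * y) (gaussianReal 0 w) :=
    (hν.integrable quadGrowth_id).const_mul _
  have i4 : Integrable (fun y => c₂ * (y ^ 2 / 2)) (gaussianReal 0 w) :=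
    (hν.sq.div_const 2).const_mul _
  have i5 : Integrable (fun y => F (x + y) - F x - c₁ * y) (gaussianReal 0 w) := i2.sub i3
  have i6 : Integrable (fun y => F (x + y) - F x - c₁ * y - c₂ * (y ^ 2 / 2))
    (gaussianReal 0 w) := i5.sub i4
  have i7 : Integrable (fun y => c₃ * (y ^ 3 / 6)) (gaussianReal 0 w) :=
    ((integrable_pow_gaussianReal w 3).div_const 6).const_mul _
  have e : gaussAvg w F x - F x - c₂ * (a ^ 2 / 2) =
      ∫ y, (F (x + y) - F x - c₁ * y - c₂ * (y ^ 2 / 2) - c₃ * (y ^ 3 / 6))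
        ∂gaussianReal 0 w := by
    rw [integral_sub i6 i7, integral_sub i5 i4, integral_sub i2 i3,
      integral_sub i1 (integrable_const _), integral_const_mul, integral_const_mul,
      integral_const_mul, integral_div, integral_div, integral_cube_gaussianReal,
      integral_sq_gaussianReal, integral_id_gaussianReal, hw]
    simp [gaussAvg, avg, add_comm]
  rw [e, ← integral_gaussianReal_pow_scale hw, ← integral_const_mul]
  refine abs_integral_le_integral_abs.trans (integral_mono (i6.sub i7).abs
    ((integrable_pow_gaussianReal w 4).const_mul _) fun y => ?_)
  have := ht y
  rwa [Even.pow_abs (by decide)] at this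

/-- A sign of mean m, once centred, has moments 0, 1 - m² and -2m(1 - m²) of orders 1, 2 and 3. The
factor 16 is 2⁴, since the centred sign is bounded by 2. -/
theorem abs_twoPoint_expansion_le {F : ℝ → ℝ} {x c₁ c₂ c₃ C a m : ℝ} (hC : 0 ≤ C) (hm : |m| ≤ 1)
    (ht : ∀ y, |F (x + y) - F x - c₁ * y - c₂ * (y ^ 2 / 2) - c₃ * (y ^ 3 / 6)| ≤ C * |y| ^ 4) :
    |(1 + m) / 2 * F (x + a * (1 - m)) + (1 - m) / 2 * F (x + a * (-1 - m)) - F x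
      - c₂ * (a ^ 2 * (1 - m ^ 2) / 2) + c₃ * (a ^ 3 * (m * (1 - m ^ 2)) / 3)| ≤
      C * (16 * a ^ 4) := by
  obtain ⟨hm1, hm2⟩ := abs_le.1 hm
  have ha : 0 ≤ a ^ 4 := by positivity
  have q1 : |a * (1 - m)| ^ 4 ≤ 16 * a ^ 4 := by
    rw [Even.pow_abs (by decide), mul_pow]
    have : (1 - m) ^ 4 ≤ 2 ^ 4 := pow_le_pow_left₀ (by linarith) (by linarith) 4
    nlinarith
  have q2 : |a * (-1 - m)| ^ 4 ≤ 16 * a ^ 4 := by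
    rw [Even.pow_abs (by decide), mul_pow, show (-1 - m) ^ 4 = (1 + m) ^ 4 by ring]
    have : (1 + m) ^ 4 ≤ 2 ^ 4 := pow_le_pow_left₀ (by linarith) (by linarith) 4
    nlinarith
  have hp := (ht (a * (1 - m))).trans (mul_le_mul_of_nonneg_left q1 hC)
  have hn := (ht (a * (-1 - m))).trans (mul_le_mul_of_nonneg_left q2 hC)
  have key : (1 + m) / 2 * F (x + a * (1 - m)) + (1 - m) / 2 * F (x + a * (-1 - m)) - F x
      - c₂ * (a ^ 2 * (1 - m ^ 2) / 2) + c₃ * (a ^ 3 * (m * (1 - m ^ 2)) / 3) =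
      (1 + m) / 2 * (F (x + a * (1 - m)) - F x - c₁ * (a * (1 - m)) - c₂ * ((a * (1 - m)) ^ 2 / 2)
        - c₃ * ((a * (1 - m)) ^ 3 / 6)) +
      (1 - m) / 2 * (F (x + a * (-1 - m)) - F x - c₁ * (a * (-1 - m))
        - c₂ * ((a * (-1 - m)) ^ 2 / 2) - c₃ * ((a * (-1 - m)) ^ 3 / 6)) := by
    ring
  rw [key]
  refine (abs_add_le _ _).trans ?_
  rw [abs_mul, abs_mul, abs_of_nonneg (by linarith : 0 ≤ (1 + m) / 2),
    abs_of_nonneg (by linarith : 0 ≤ (1 - m) / 2)]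
  have h1 := mul_le_mul_of_nonneg_left hp (by linarith : 0 ≤ (1 + m) / 2)
  have h2 := mul_le_mul_of_nonneg_left hn (by linarith : 0 ≤ (1 - m) / 2)
  refine (add_le_add h1 h2).trans (le_of_eq ?_)
  ring

/-- Compared with the Gaussian of variance a², the second-order terms differ by a multiple of a² m²,
and the cubic term is at most |a|³|m| s^(r-3). By the arithmetic-geometric mean inequality the
latter is absorbed into the other two: s|a|³|m| ≤ (s² a² m² + a⁴)/2. -/
theorem exists_twoPoint_step : ∃ K : ℝ, 0 < K ∧ ∀ (r B : ℝ), 0 ≤ r → r ≤ 2 →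
    ∀ (f : ℝ → ℝ), HolderTaylor r B f → ∀ (s : ℝ) (v : NNReal), 0 < s → (v : ℝ) = s ^ 2 →
    ∀ (a m : ℝ) (w : NNReal), (w : ℝ) = a ^ 2 → |m| ≤ 1 → ∀ x,
    |((1 + m) / 2 * gaussAvg v f (x + a * (1 - m)) + (1 - m) / 2 * gaussAvg v f (x + a * (-1 - m)))
        - gaussAvg w (gaussAvg v f) x| ≤
      K * B * (a ^ 2 * m ^ 2 * s ^ (r - 2) + a ^ 4 * s ^ (r - 4)) := by
  obtain ⟨K, hK, hKd⟩ := exists_gaussAvg_derivatives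
  obtain ⟨m4, hm4⟩ : ∃ m4 : ℝ, m4 = ∫ y, y ^ 4 ∂gaussianReal 0 1 := ⟨_, rfl⟩
  have hm40 : 0 ≤ m4 := hm4 ▸ integral_nonneg fun y => by positivity
  refine ⟨K * (m4 + 18), by positivity, fun r B hr hr' f hf s v hs hv a m w hw hm x => ?_⟩
  obtain ⟨h₁, h₂, h₃, h₄, d0, d1, d2, d3, b2, b3, b4⟩ := hKd r B hr hr' f hf s v hs hv
  have hB := hf.nonneg
  have hFq : QuadGrowth (gaussAvg v f) := (hf.quadGrowth hr hr').gaussAvg v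
  have ht := fun y => taylor_three d0 d1 d2 d3 b4 x y
  obtain ⟨S, hS⟩ : ∃ S : ℝ, S = s ^ (r - 4) := ⟨_, rfl⟩
  have hS0 : 0 ≤ S := hS ▸ by positivity
  have e3 : s ^ (r - 3) = S * s := by
    rw [hS, ← Real.rpow_add_one hs.ne']; congr 1; ring
  have e2 : s ^ (r - 2) = S * s ^ 2 := by
    rw [hS, ← Real.rpow_natCast s 2, ← Real.rpow_add hs]; congr 1; push_cast; ring
  have hg := abs_gaussAvg_expansion_le hFq hw ht
  have hp := abs_twoPoint_expansion_le (a := a) (by positivity) hm ht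
  rw [← hS, ← hm4] at hg
  rw [← hS] at hp
  have b2 := b2 x
  have b3 := b3 x
  rw [e2] at b2 ⊢
  rw [e3] at b3
  rw [← hS]
  generalize (1 + m) / 2 * gaussAvg v f (x + a * (1 - m)) +
    (1 - m) / 2 * gaussAvg v f (x + a * (-1 - m)) = T at *
  generalize gaussAvg w (gaussAvg v f) x = G at *
  generalize gaussAvg v f x = F at *
  generalize h₂ x = c₂ at *
  generalize h₃ x = c₃ at *
  clear d0 d1 d2 d3 b4 ht hFq hKd e2 e3 hm4
  obtain ⟨hm1, hm2⟩ := abs_le.1 hm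
  have hb2 : |c₂ * (a ^ 2 * m ^ 2 / 2)| ≤ K * B * (S * s ^ 2) * (a ^ 2 * m ^ 2) := by
    rw [abs_mul, abs_of_nonneg (by positivity : 0 ≤ a ^ 2 * m ^ 2 / 2)]
    exact mul_le_mul b2 (by linarith [show 0 ≤ a ^ 2 * m ^ 2 by positivity]) (by positivity)
      (by positivity)
  have hb3 : |c₃ * (a ^ 3 * (m * (1 - m ^ 2)) / 3)| ≤
      K * B * S * ((s ^ 2 * (a ^ 2 * m ^ 2) + a ^ 4) / 2) := by
    have h1 : |a ^ 3 * (m * (1 - m ^ 2)) / 3| ≤ |a| ^ 3 * |m| := by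
      rw [abs_div, abs_mul, abs_mul, abs_pow]
      have : |1 - m ^ 2| ≤ 1 := by rw [abs_le]; constructor <;> nlinarith
      have h3 : |m| * |1 - m ^ 2| ≤ |m| := mul_le_of_le_one_right (abs_nonneg _) this
      have h4 : |a| ^ 3 * (|m| * |1 - m ^ 2|) ≤ |a| ^ 3 * |m| := by gcongr
      have h5 : 0 ≤ |a| ^ 3 * (|m| * |1 - m ^ 2|) := by positivity
      rw [abs_of_pos (by norm_num : (0 : ℝ) < 3)]
      linarith
    have h2 : s * (|a| ^ 3 * |m|) ≤ (s ^ 2 * (a ^ 2 * m ^ 2) + a ^ 4) / 2 := by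
      have e1 : a ^ 4 = (|a| ^ 2) ^ 2 := by rw [sq_abs]; ring
      have e5 : s ^ 2 * (a ^ 2 * m ^ 2) = (s * |a| * |m|) ^ 2 := by
        rw [mul_pow, mul_pow, sq_abs, sq_abs]; ring
      rw [e1, e5]
      nlinarith [sq_nonneg (s * |a| * |m| - |a| ^ 2)]
    rw [abs_mul]
    calc |c₃| * |a ^ 3 * (m * (1 - m ^ 2)) / 3| ≤ K * B * (S * s) * (|a| ^ 3 * |m|) :=
          mul_le_mul b3 h1 (abs_nonneg _) (by positivity)
      _ = K * B * S * (s * (|a| ^ 3 * |m|)) := by ring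
      _ ≤ _ := by gcongr
  have htri : |T - G| ≤ K * B * S * (16 * a ^ 4) + K * B * S * (a ^ 4 * m4) +
        K * B * (S * s ^ 2) * (a ^ 2 * m ^ 2) +
        K * B * S * ((s ^ 2 * (a ^ 2 * m ^ 2) + a ^ 4) / 2) := by
    obtain ⟨l1, u1⟩ := abs_le.1 hp
    obtain ⟨l2, u2⟩ := abs_le.1 hg
    obtain ⟨l3, u3⟩ := abs_le.1 hb2
    obtain ⟨l4, u4⟩ := abs_le.1 hb3
    rw [abs_le]
    constructor <;> linarith
  refine htri.trans ?_
  have p1 : 0 ≤ K * B * S * (s ^ 2 * (a ^ 2 * m ^ 2)) := by positivity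
  have p2 : 0 ≤ K * B * S * a ^ 4 := by positivity
  nlinarith [mul_nonneg hm40 p1, mul_nonneg hm40 p2]

/-! ### The central limit theorem for independent summands -/

theorem abs_avg_sub_avg_le {μ : Measure ℝ} (hμ : SqProb μ) {f g : ℝ → ℝ} (hf : QuadGrowth f)
    (hg : QuadGrowth g) {C : ℝ} (h : ∀ x, |f x - g x| ≤ C) (y : ℝ) :
    |avg μ f y - avg μ g y| ≤ C := by
  have := hμ.prob
  have i1 := hμ.integrable (hf.comp_add y)
  have i2 := hμ.integrable (hg.comp_add y)
  unfold avg
  rw [← integral_sub i1 i2]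
  refine abs_integral_le_integral_abs.trans
    ((integral_mono (i1.sub i2).abs (integrable_const C) fun x => h (x + y)).trans ?_)
  simp

/-- The law of the sum of the first `n` of independent variables with laws `ν 0, ν 1, …`. -/
noncomputable def convLaw (ν : ℕ → Measure ℝ) : ℕ → Measure ℝ
  | 0 => Measure.dirac 0
  | n + 1 => convLaw ν n ∗ ν n

theorem sqProb_convLaw {ν : ℕ → Measure ℝ} (hν : ∀ k, SqProb (ν k)) (n : ℕ) :
    SqProb (convLaw ν n) := by
  induction n with
  | zero => exact sqProb_dirac 0
  | succ n ih => exact ih.conv (hν n)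

/-- The growth `max 1 n ^ ((r - ρ) / 2)` of the error in the central limit theorem of order `r`. -/
noncomputable def cltGrowth (r ρ : ℝ) (n : ℕ) : ℝ := max 1 ((n : ℝ) ^ ((r - ρ) / 2))

theorem one_le_cltGrowth (r ρ : ℝ) (n : ℕ) : 1 ≤ cltGrowth r ρ n := le_max_left _ _

theorem cltGrowth_mono (r ρ : ℝ) {k n : ℕ} (h : k ≤ n) : cltGrowth r ρ k ≤ cltGrowth r ρ n := by
  refine max_le (le_max_left _ _) ?_
  rcases le_or_gt 0 ((r - ρ) / 2) with h0 | h0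
  · exact le_max_of_le_right (Real.rpow_le_rpow (by positivity) (by exact_mod_cast h) h0)
  · refine le_max_of_le_left ?_
    rcases Nat.eq_zero_or_pos k with rfl | hk
    · simp [Real.zero_rpow h0.ne]
    · exact Real.rpow_le_one_of_one_le_of_nonpos (by exact_mod_cast hk) h0.le

/-- Tails of a convergent series are small. The shift T becomes the number of extra Gaussian
summands that makes the induction in `exists_convLaw_clt` contract. -/
theorem exists_sum_rpow_le {e : ℝ} (he : 1 < e) {ε : ℝ} (hε : 0 < ε) :
    ∃ T : ℕ, 1 ≤ T ∧ ∀ n : ℕ, ∑ i ∈ Finset.range n, ((i + T : ℕ) : ℝ) ^ (-e) ≤ ε := by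
  have hs : Summable (fun n : ℕ => (n : ℝ) ^ (-e)) := Real.summable_nat_rpow.2 (by linarith)
  have ht := tendsto_sum_nat_add (fun n : ℕ => (n : ℝ) ^ (-e))
  obtain ⟨T, hT1, hT⟩ := ((Filter.eventually_ge_atTop 1).and
    (ht.eventually (Iic_mem_nhds hε))).exists
  refine ⟨T, hT1, fun n => ?_⟩
  refine le_trans ?_ hT
  exact ((summable_nat_add_iff T).2 hs).sum_le_tsum _ fun i _ => by positivity

/-- The function f averaged over L is split into its Gaussian approximation and an error D bounded
by E. The error is smoothed only by t and used as a test function of order 0, which gives E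
s^(-2-ρ). The main part has the larger width s' of t + w and keeps the order r. -/
theorem lindeberg_step {K : ℝ} (hK : ∀ (r ρ B : ℝ), 0 ≤ r → r ≤ 2 → 0 ≤ ρ →
    ρ ≤ 1 → ∀ (f : ℝ → ℝ), HolderTaylor r B f → ∀ (s : ℝ) (v : NNReal), 0 < s → (v : ℝ) = s ^ 2 →
    ∀ ν₁ ν₂ : Measure ℝ, SqProb ν₁ → SqProb ν₂ → ∫ x, x ∂ν₁ = 0 → ∫ x, x ∂ν₂ = 0 →
    ∫ x, x ^ 2 ∂ν₁ = ∫ x, x ^ 2 ∂ν₂ → Integrable (fun x => |x| ^ (2 + ρ)) ν₁ →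
    Integrable (fun x => |x| ^ (2 + ρ)) ν₂ → ∀ y,
    |avg ν₁ (gaussAvg v f) y - avg ν₂ (gaussAvg v f) y| ≤
      K * B * s ^ (r - 2 - ρ) * (∫ x, |x| ^ (2 + ρ) ∂ν₁ + ∫ x, |x| ^ (2 + ρ) ∂ν₂))
    {r ρ B E : ℝ} (hr : 0 ≤ r) (hr' : r ≤ 2) (hρ : 0 ≤ ρ) (hρ' : ρ ≤ 1) {f : ℝ → ℝ}
    (hf : HolderTaylor r B f) {L ν : Measure ℝ} (hL : SqProb L) (hν : SqProb ν)
    {v w t : NNReal} {s s' : ℝ} (hs : 0 < s) (hs' : 0 < s') (ht : (t : ℝ) = s ^ 2)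
    (ht' : ((t + w : NNReal) : ℝ) = s' ^ 2)
    (hE : ∀ y, |avg L f y - gaussAvg w f y| ≤ E)
    (hm : ∫ x, x ∂ν = 0) (hv : ∫ x, x ^ 2 ∂ν = v) (hi : Integrable (fun x => |x| ^ (2 + ρ)) ν)
    (hg : Integrable (fun x => |x| ^ (2 + ρ)) (gaussianReal 0 v)) (y : ℝ) :
    |avg (L ∗ ν) (gaussAvg t f) y - avg L (gaussAvg (v + t) f) y| ≤
      K * (2 * E * s ^ (-2 - ρ) + B * s' ^ (r - 2 - ρ)) *
        (∫ x, |x| ^ (2 + ρ) ∂ν + ∫ x, |x| ^ (2 + ρ) ∂gaussianReal 0 v) := by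
  have hfq := hf.quadGrowth hr hr'
  have hG := fun v => sqProb_gaussianReal 0 v
  have hLp := hL.prob
  have hνp := hν.prob
  set D : ℝ → ℝ := fun y => avg L f y - gaussAvg w f y with hD
  have hDq : QuadGrowth D := (hfq.avg hL).sub (hfq.gaussAvg w)
  have hDH : HolderTaylor 0 (2 * E) D := holderTaylor_of_bounded hDq.1 hE
  have hH : avg L (gaussAvg t f) = fun y => gaussAvg t D y + gaussAvg (t + w) f y := by
    funext y
    rw [gaussAvg, avg_comm hL (hG t) hfq]
    have : avg L f = fun y => D y + gaussAvg w f y := by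
      funext y; simp [hD]
    rw [this, avg_add (hG t) hDq (hfq.gaussAvg w), ← gaussAvg_gaussAvg t w hfq]
  have e1 : avg (L ∗ ν) (gaussAvg t f) y =
      avg ν (gaussAvg t D) y + avg ν (gaussAvg (t + w) f) y := by
    rw [Measure.conv_comm, ← avg_avg hν hL (hfq.gaussAvg t), hH,
      avg_add hν (hDq.gaussAvg t) (hfq.gaussAvg _)]
  have e2 : avg L (gaussAvg (v + t) f) y =
      gaussAvg v (gaussAvg t D) y + gaussAvg v (gaussAvg (t + w) f) y := by
    rw [← gaussAvg_gaussAvg v t hfq, gaussAvg, avg_comm hL (hG v) (hfq.gaussAvg t), hH,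
      avg_add (hG v) (hDq.gaussAvg t) (hfq.gaussAvg _)]
  have hsq : ∫ x, x ^ 2 ∂ν = ∫ x, x ^ 2 ∂gaussianReal 0 v := by
    rw [hv, integral_sq_gaussianReal]
  have h1 := hK 0 ρ (2 * E) le_rfl (by norm_num) hρ hρ' D hDH s t hs ht ν (gaussianReal 0 v) hν
    (hG v) hm integral_id_gaussianReal hsq hi hg y
  have h2 := hK r ρ B hr hr' hρ hρ' f hf s' (t + w) hs' ht' ν (gaussianReal 0 v) hν
    (hG v) hm integral_id_gaussianReal hsq hi hg y
  rw [zero_sub] at h1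
  rw [e1, e2]
  generalize (∫ x, |x| ^ (2 + ρ) ∂ν + ∫ x, |x| ^ (2 + ρ) ∂gaussianReal 0 v) = I at *
  have e3 : avg ν (gaussAvg t D) y + avg ν (gaussAvg (t + w) f) y -
      (gaussAvg v (gaussAvg t D) y + gaussAvg v (gaussAvg (t + w) f) y) =
      (avg ν (gaussAvg t D) y - gaussAvg v (gaussAvg t D) y) +
      (avg ν (gaussAvg (t + w) f) y - gaussAvg v (gaussAvg (t + w) f) y) := by ring
  rw [e3]
  refine (abs_add_le _ _).trans ((add_le_add h1 h2).trans (le_of_eq ?_))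
  ring

theorem integrable_abs_rpow_gaussianReal (v : NNReal) {ρ : ℝ} (hρ : 0 ≤ ρ) :
    Integrable (fun x => |x| ^ (2 + ρ)) (gaussianReal 0 v) := by
  have := (memLp_id_gaussianReal' (μ := 0) (v := v) (ENNReal.ofReal (2 + ρ))
    ENNReal.ofReal_ne_top).integrable_norm_rpow
      (by simp; linarith) ENNReal.ofReal_ne_top
  rw [ENNReal.toReal_ofReal (by linarith)] at this
  simpa using this

/-- Rate of convergence in the central limit theorem for independent summands with a common
variance and bounded moments of order `2 + ρ`. -/
theorem exists_convLaw_clt {r ρ M : ℝ} (hr : 0 ≤ r) (hr' : r ≤ 2) (hρ : 0 < ρ) (hρ' : ρ ≤ 1)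
    (v : NNReal) (hv : 0 < v) : ∃ A : ℝ, 0 < A ∧ ∀ ν : ℕ → Measure ℝ, (∀ k, SqProb (ν k)) →
    (∀ k, ∫ x, x ∂ν k = 0) → (∀ k, ∫ x, x ^ 2 ∂ν k = v) →
    (∀ k, Integrable (fun x => |x| ^ (2 + ρ)) (ν k)) → (∀ k, ∫ x, |x| ^ (2 + ρ) ∂ν k ≤ M) →
    ∀ (n : ℕ) (B : ℝ) (f : ℝ → ℝ), HolderTaylor r B f → ∀ y,
    |avg (convLaw ν n) f y - gaussAvg (n * v) f y| ≤ A * B * cltGrowth r ρ n := by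
  obtain ⟨K, hK0, hK⟩ := exists_integral_gaussAvg_step
  set Mg : ℝ := ∫ x, |x| ^ (2 + ρ) ∂gaussianReal 0 v
  set M' : ℝ := |M| + Mg with hM'
  have hMg : 0 ≤ Mg := integral_nonneg fun x => by positivity
  have hM0 : 0 ≤ M' := by positivity
  set σ : ℝ := Real.sqrt v with hσ
  have hv' : (0 : ℝ) < v := by exact_mod_cast hv
  have hσ0 : 0 < σ := Real.sqrt_pos.2 hv'
  have hσ2 : σ ^ 2 = v := Real.sq_sqrt hv'.le
  set c : ℝ := 2 * K * σ ^ (-2 - ρ) * M' with hc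
  have hc0 : 0 ≤ c := by positivity
  set d : ℝ := K * σ ^ (r - 2 - ρ) * M' with hd
  have hd0 : 0 ≤ d := by positivity
  -- This makes the accumulated effect of the earlier errors at most c/(2(c+1)) ≤ 1/2 of the bound
  -- being proved.
  obtain ⟨T, hT1, hT⟩ := exists_sum_rpow_le (e := 1 + ρ / 2) (by linarith)
    (ε := 1 / (2 * (c + 1))) (by positivity)
  set a : ℝ := 4 * (σ * Real.sqrt T) ^ r with ha
  have ha0 : 0 ≤ a := by positivity
  -- The recursive inequality reads A/2 + d + a ≤ A, which this choice satisfies.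
  refine ⟨2 * (a + d) + 1, by positivity, fun ν hν hm hsq hi hM n => ?_⟩
  set A := 2 * (a + d) + 1 with hA
  have hA0 : 0 < A := by positivity
  -- The bounds for k < n, made uniform by monotonicity of the growth factor, serve as the constant
  -- E of `lindeberg_step`.
  induction n using Nat.strong_induction_on with
  | _ n ih =>
  intro B f hf y
  have hB := hf.nonneg
  have hfq := hf.quadGrowth hr hr'
  have hLn := sqProb_convLaw hν
  have hw1 := one_le_cltGrowth r ρ n
  set w := cltGrowth r ρ n with hw
  have hsc : ∀ j : ℕ, (((j : NNReal) * v : NNReal) : ℝ) = (σ * Real.sqrt j) ^ 2 := fun j => by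
    rw [mul_pow, hσ2, Real.sq_sqrt (by positivity)]; push_cast; ring
  have hpow : ∀ (j : ℕ) (e : ℝ), (σ * Real.sqrt j) ^ e = σ ^ e * (j : ℝ) ^ (e / 2) := fun j e => by
    rw [Real.mul_rpow hσ0.le (Real.sqrt_nonneg _), Real.sqrt_eq_rpow, ← Real.rpow_mul (by positivity)]
    congr 2; ring
  -- The first k summands are genuine, the remaining n - k Gaussian. The T additional Gaussian
  -- summands keep the smoothing away from zero and are removed at both ends at a cost independent
  -- of n.
  set Φ : ℕ → ℝ := fun k => avg (convLaw ν k) (gaussAvg (((n - k + T : ℕ) : NNReal) * v) f) y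
    with hΦ
  have hstep : ∀ k ∈ Finset.range n, |Φ (k + 1) - Φ k| ≤
      A * B * w * c * ((n - 1 - k + T : ℕ) : ℝ) ^ (-(1 + ρ / 2)) +
        B * d * (n : ℝ) ^ ((r - 2 - ρ) / 2) := by
    intro k hk
    have hkn := Finset.mem_range.1 hk
    have hE : ∀ y, |avg (convLaw ν k) f y - gaussAvg (k * v) f y| ≤ A * B * w := fun y =>
      (ih k hkn B f hf y).trans
        (mul_le_mul_of_nonneg_left (cltGrowth_mono r ρ hkn.le) (by positivity))
    set j := n - 1 - k + T with hj
    have hj1 : 1 ≤ j := by omega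
    have hj0 : (0 : ℝ) < j := by exact_mod_cast hj1
    have hn0 : (0 : ℝ) < (n - 1 + T : ℕ) := by
      have : 1 ≤ n - 1 + T := by omega
      exact_mod_cast this
    have e1 : ((n - (k + 1) + T : ℕ) : NNReal) = j := by
      congr 1; omega
    have e2 : ((n - k + T : ℕ) : NNReal) * v = v + j * v := by
      rw [show n - k + T = j + 1 by omega]; push_cast; ring
    have h := lindeberg_step hK hr hr' hρ.le hρ' hf (hLn k) (hν k) (v := v)
      (w := (k : NNReal) * v) (t := (j : NNReal) * v)
      (s := σ * Real.sqrt j) (s' := σ * Real.sqrt (n - 1 + T : ℕ))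
      (mul_pos hσ0 (Real.sqrt_pos.2 hj0)) (mul_pos hσ0 (Real.sqrt_pos.2 hn0)) (hsc j)
      (by rw [← hsc, show n - 1 + T = j + k by omega]; push_cast; ring)
      hE (hm k) (hsq k) (hi k) (integrable_abs_rpow_gaussianReal v hρ.le) y
    simp only [hΦ]
    rw [e1, e2]
    refine h.trans ?_
    have hI : ∫ x, |x| ^ (2 + ρ) ∂ν k + ∫ x, |x| ^ (2 + ρ) ∂gaussianReal 0 v ≤ M' :=
      add_le_add ((hM k).trans (le_abs_self M)) le_rfl
    have hn1 : ((n - 1 + T : ℕ) : ℝ) ^ ((r - 2 - ρ) / 2) ≤ (n : ℝ) ^ ((r - 2 - ρ) / 2) :=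
      Real.rpow_le_rpow_of_nonpos (by exact_mod_cast (by omega : 0 < n))
        (by exact_mod_cast (by omega : n ≤ n - 1 + T)) (by linarith)
    rw [hpow, hpow, show (-2 - ρ) / 2 = -(1 + ρ / 2) by ring]
    calc _ ≤ K * (2 * (A * B * w) * (σ ^ (-2 - ρ) * (j : ℝ) ^ (-(1 + ρ / 2))) +
          B * (σ ^ (r - 2 - ρ) * ((n - 1 + T : ℕ) : ℝ) ^ ((r - 2 - ρ) / 2))) * M' :=
          mul_le_mul_of_nonneg_left hI (by positivity)
      _ ≤ K * (2 * (A * B * w) * (σ ^ (-2 - ρ) * (j : ℝ) ^ (-(1 + ρ / 2))) +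
          B * (σ ^ (r - 2 - ρ) * (n : ℝ) ^ ((r - 2 - ρ) / 2))) * M' := by gcongr
      _ = _ := by rw [hc, hd]; ring
  have hsum : |Φ n - Φ 0| ≤ A * B * w / 2 + B * d * w := by
    rw [← Finset.sum_range_sub]
    refine (Finset.abs_sum_le_sum_abs _ _).trans ((Finset.sum_le_sum hstep).trans ?_)
    rw [Finset.sum_add_distrib, ← Finset.mul_sum,
      Finset.sum_range_reflect (fun i => ((i + T : ℕ) : ℝ) ^ (-(1 + ρ / 2))) n,
      Finset.sum_const, Finset.card_range, nsmul_eq_mul]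
    refine add_le_add ?_ ?_
    · calc _ ≤ A * B * w * c * (1 / (2 * (c + 1))) :=
            mul_le_mul_of_nonneg_left (hT n) (by positivity)
        _ = A * B * w / 2 * (c / (c + 1)) := by field_simp
        _ ≤ A * B * w / 2 * 1 := by
            refine mul_le_mul_of_nonneg_left ?_ (by positivity)
            rw [div_le_one (by positivity)]; linarith
        _ = _ := mul_one _
    · rcases Nat.eq_zero_or_pos n with h0 | h0
      · rw [h0, Nat.cast_zero, zero_mul]
        positivity
      · have hn0 : (0 : ℝ) < n := by exact_mod_cast h0
        have : (n : ℝ) * (n : ℝ) ^ ((r - 2 - ρ) / 2) ≤ w := by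
          nth_rewrite 1 [← Real.rpow_one (n : ℝ)]
          rw [← Real.rpow_add hn0]
          refine (le_of_eq ?_).trans (le_max_right _ _)
          congr 1; ring
        calc _ = B * d * ((n : ℝ) * (n : ℝ) ^ ((r - 2 - ρ) / 2)) := by ring
          _ ≤ _ := mul_le_mul_of_nonneg_left this (by positivity)
  have hend := fun x => hf.abs_gaussAvg_sub_le hr hr' (by positivity) (hsc T) x
  have hend1 : |Φ n - avg (convLaw ν n) f y| ≤ 2 * B * (σ * Real.sqrt T) ^ r := by
    simp only [hΦ, Nat.sub_self, zero_add]
    exact abs_avg_sub_avg_le (hLn n) (hfq.gaussAvg _) hfq hend y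
  have hend0 : |Φ 0 - gaussAvg (n * v) f y| ≤ 2 * B * (σ * Real.sqrt T) ^ r := by
    have : Φ 0 = gaussAvg (n * v) (gaussAvg (T * v) f) y := by
      simp only [hΦ, convLaw, avg_dirac_zero, gaussAvg_gaussAvg _ _ hfq]
      congr 1
      push_cast [Nat.sub_zero]
      ring
    rw [this]
    exact abs_avg_sub_avg_le (sqProb_gaussianReal _ _) (hfq.gaussAvg _) hfq hend y
  have hfin : |avg (convLaw ν n) f y - gaussAvg (n * v) f y| ≤
      A * B * w / 2 + B * d * w + B * a := by
    rw [ha]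
    rw [abs_le] at *
    constructor <;> linarith [hsum.1, hsum.2, hend1.1, hend1.2, hend0.1, hend0.2]
  refine hfin.trans ?_
  rw [hA]
  have h1 : B * a ≤ B * a * w := le_mul_of_one_le_right (by positivity) hw1
  have h2 : 0 ≤ B * w := by positivity
  nlinarith

/-! ### Size of the coefficients a_n and of v_n -/

theorem erwA_pos {p : ℝ} (hp : 0 < p) {n : ℕ} (hn : 1 ≤ n) : 0 < erwA p n := by
  have hn' : (1 : ℝ) ≤ n := by exact_mod_cast hn
  unfold erwA
  have h1 := Real.Gamma_pos_of_pos (by linarith : (0 : ℝ) < n)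
  have h2 := Real.Gamma_pos_of_pos (by linarith : 0 < 2 * p)
  have h3 := Real.Gamma_pos_of_pos (by linarith : 0 < n + 2 * p - 1)
  positivity

theorem erwA_succ {p : ℝ} (hp : 0 < p) {n : ℕ} (hn : 1 ≤ n) :
    erwA p (n + 1) * (n + 2 * p - 1) = n * erwA p n := by
  have hn' : (1 : ℝ) ≤ n := by exact_mod_cast hn
  have h0 : (n : ℝ) + 2 * p - 1 ≠ 0 := by
    have : 0 < (n : ℝ) + 2 * p - 1 := by linarith
    exact this.ne'
  have h3 := (Real.Gamma_pos_of_pos (by linarith : 0 < n + 2 * p - 1)).ne'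
  unfold erwA
  push_cast
  rw [Real.Gamma_add_one (by positivity), show (n : ℝ) + 1 + 2 * p - 1 = n + 2 * p - 1 + 1 by ring,
    Real.Gamma_add_one h0]
  field_simp

theorem erwV_zero (p : ℝ) : erwV p 0 = 0 := by simp [erwV]

theorem erwV_succ (p : ℝ) (n : ℕ) : erwV p (n + 1) = erwV p n + erwA p (n + 1) ^ 2 := by
  unfold erwV
  rw [Finset.sum_Icc_succ_top (by omega)]

theorem erwV_mono (p : ℝ) : Monotone (erwV p) :=
  monotone_nat_of_le_succ fun n => by rw [erwV_succ]; nlinarith [sq_nonneg (erwA p (n + 1))]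

theorem one_le_erwV {p : ℝ} (hp : 0 < p) {n : ℕ} (hn : 1 ≤ n) : 1 ≤ erwV p n := by
  refine le_trans ?_ (erwV_mono p hn)
  simp [erwV, erwA_one hp]

/-- The relation between consecutive squares. -/
theorem erwA_sq_succ {p : ℝ} (hp : 0 < p) {n : ℕ} (hn : 1 ≤ n) :
    n * erwA p n ^ 2 = erwA p (n + 1) ^ 2 * (n + 1 - (3 - 4 * p) + (2 * p - 1) ^ 2 / n) := by
  have hn' : (n : ℝ) ≠ 0 := by positivity
  have h := erwA_succ hp hn
  field_simp
  have : (n * erwA p n) ^ 2 = (erwA p (n + 1) * (n + 2 * p - 1)) ^ 2 := by rw [h]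
  linear_combination this

/-- Induction through `erwA_sq_succ`: passing from n to n + 1 increases n a_n² by at most (3 - 4p)
a_{n+1}², hence by less than three times the increase of v_n. -/
theorem mul_erwA_sq_le {p : ℝ} (hp : 0 < p) {n : ℕ} (hn : 1 ≤ n) :
    n * erwA p n ^ 2 ≤ 3 * erwV p n := by
  induction n, hn using Nat.le_induction with
  | base => simp [erwV, erwA_one hp]
  | succ n hn ih =>
    rw [erwV_succ]
    rw [erwA_sq_succ hp hn] at ih
    have h1 : 0 ≤ (2 * p - 1) ^ 2 / (n : ℝ) := by positivity
    have h2 := sq_nonneg (erwA p (n + 1))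
    push_cast
    nlinarith [mul_nonneg h2 h1, mul_nonneg h2 hp.le]

theorem erwA_sq_le_erwV {p : ℝ} {n : ℕ} (hn : 1 ≤ n) : erwA p n ^ 2 ≤ erwV p n := by
  unfold erwV
  exact Finset.single_le_sum (f := fun i => erwA p i ^ 2) (fun i _ => sq_nonneg _)
    (Finset.mem_Icc.2 ⟨hn, le_rfl⟩)

theorem erwV_eq_sum_range (p : ℝ) (n : ℕ) :
    erwV p n = ∑ i ∈ Finset.range n, erwA p (i + 1) ^ 2 := by
  induction n with
  | zero => simp [erwV]
  | succ n ih => rw [erwV_succ, Finset.sum_range_succ, ih]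

/-- The remaining variance after time `k` is at least proportional to the remaining time. -/
theorem mul_erwA_sq_le_remaining {p : ℝ} (hp : 0 < p) {k n : ℕ} (hn : 1 ≤ n) (hk : k ≤ n) :
    ((n : ℝ) - k) * erwA p n ^ 2 ≤ 3 * (erwV p n - erwV p k) := by
  rcases le_total (1 / 2) p with h | h
  · have hanti : ∀ m, 1 ≤ m → ∀ j, m ≤ j → erwA p j ≤ erwA p m := by
      intro m hm j hj
      induction j, hj using Nat.le_induction with
      | base => rfl
      | succ j hj ih =>
        refine le_trans ?_ ih
        have h1 := erwA_succ hp (hm.trans hj)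
        have h2 := erwA_pos hp (n := j + 1) (by omega)
        have h3 : (1 : ℝ) ≤ j := by exact_mod_cast hm.trans hj
        nlinarith
    have key : ∀ d, k + d ≤ n → (d : ℝ) * erwA p n ^ 2 ≤ erwV p (k + d) - erwV p k := by
      intro d hd
      induction d with
      | zero => simp
      | succ d ih =>
        have h1 := ih (by omega)
        rw [← add_assoc, erwV_succ]
        have h2 : erwA p n ^ 2 ≤ erwA p (k + d + 1) ^ 2 :=
          pow_le_pow_left₀ (erwA_pos hp hn).le (hanti _ (by omega) _ (by omega)) 2
        push_cast
        linarith
    have := key (n - k) (by omega)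
    rw [Nat.add_sub_cancel' hk, Nat.cast_sub hk] at this
    nlinarith [erwV_mono p hk]
  · have hmono : ∀ m, 1 ≤ m → ∀ j, m ≤ j → erwA p m ≤ erwA p j := by
      intro m hm j hj
      induction j, hj using Nat.le_induction with
      | base => rfl
      | succ j hj ih =>
        refine ih.trans ?_
        have h1 := erwA_succ hp (hm.trans hj)
        have h2 := erwA_pos hp (n := j + 1) (by omega)
        have h3 : (1 : ℝ) ≤ j := by exact_mod_cast hm.trans hj
        nlinarith
    rcases hk.eq_or_lt with rfl | hk'
    · simp
    -- For increasing a_i the mean of a_i² over i ≤ k is at most its mean over k < i ≤ n, whence (n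
    -- - k) v_n ≤ n (v_n - v_k). The bound n a_n² ≤ 3 v_n then finishes.
    have h1 : erwV p k ≤ k * erwA p (k + 1) ^ 2 := by
      rw [erwV_eq_sum_range]
      refine (Finset.sum_le_card_nsmul _ _ (erwA p (k + 1) ^ 2) fun i hi => ?_).trans
        (by rw [Finset.card_range, nsmul_eq_mul])
      exact pow_le_pow_left₀ (erwA_pos hp (by omega)).le
        (hmono _ (by omega) _ (by have := Finset.mem_range.1 hi; omega)) 2
    have key : ∀ d : ℕ, (d : ℝ) * erwA p (k + 1) ^ 2 ≤ erwV p (k + d) - erwV p k := by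
      intro d
      induction d with
      | zero => simp
      | succ d ih =>
        rw [← add_assoc, erwV_succ]
        have h2 : erwA p (k + 1) ^ 2 ≤ erwA p (k + d + 1) ^ 2 :=
          pow_le_pow_left₀ (erwA_pos hp (by omega)).le (hmono _ (by omega) _ (by omega)) 2
        push_cast
        linarith
    have h2 := key (n - k)
    rw [Nat.add_sub_cancel' hk, Nat.cast_sub hk] at h2
    have h3 := mul_erwA_sq_le hp hn
    have hkn : (0 : ℝ) < n - k := by
      have : (k : ℝ) < n := by exact_mod_cast hk'
      linarith
    have hn0 : (0 : ℝ) < n := by exact_mod_cast hn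
    have h4 : ((n : ℝ) - k) * erwV p k ≤ k * (erwV p n - erwV p k) := by
      have := mul_le_mul_of_nonneg_left h1 hkn.le
      have h5 := mul_le_mul_of_nonneg_left h2 (Nat.cast_nonneg (α := ℝ) k)
      linarith
    have h5 := mul_le_mul_of_nonneg_left h3 hkn.le
    refine le_of_mul_le_mul_left ?_ hn0
    linarith

/-- Euler's product sequence for Γ(2p) appears when the quotient of Gamma values is expanded; its
limit yields that a_n is of order n^(1-2p). -/
theorem erwA_eq_gammaSeq {p : ℝ} (hp : 0 < p) (n : ℕ) (hn : 1 ≤ n) :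
    erwA p (n + 2) * (n : ℝ) ^ (2 * p) = (n + 1) * Real.GammaSeq (2 * p) n := by
  have hG : ∀ m : ℕ, Real.Gamma (2 * p) * ∏ j ∈ Finset.range m, (2 * p + j) =
      Real.Gamma (2 * p + m) := by
    intro m
    induction m with
    | zero => simp
    | succ m ih =>
      rw [Finset.prod_range_succ, ← mul_assoc, ih]
      push_cast
      rw [← add_assoc, Real.Gamma_add_one (by positivity)]
      ring
  have hP : ∏ j ∈ Finset.range (n + 1), (2 * p + (j : ℝ)) ≠ 0 :=
    (Finset.prod_pos fun j _ => by positivity).ne'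
  have h2 := (Real.Gamma_pos_of_pos (by linarith : 0 < 2 * p)).ne'
  unfold erwA Real.GammaSeq
  have e1 : ((n + 2 : ℕ) : ℝ) + 2 * p - 1 = 2 * p + (n + 1 : ℕ) := by push_cast; ring
  have e2 : Real.Gamma ((n + 2 : ℕ) : ℝ) = (n + 1) * (n.factorial : ℝ) := by
    have := Real.Gamma_nat_eq_factorial (n + 1)
    push_cast at this ⊢
    rw [show (n : ℝ) + 2 = n + 1 + 1 by ring, this, Nat.factorial_succ]
    push_cast
    ring
  rw [e1, e2, ← hG]
  field_simp

/-- The limit controls all large indices, and finitely many positive values remain. -/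
theorem exists_bounds_of_tendsto {u : ℕ → ℝ} (hpos : ∀ n, 1 ≤ n → 0 < u n) {l : ℝ} (hl : 0 < l)
    (h : Filter.Tendsto u Filter.atTop (nhds l)) :
    ∃ c C : ℝ, 0 < c ∧ 0 < C ∧ ∀ n, 1 ≤ n → c ≤ u n ∧ u n ≤ C := by
  obtain ⟨N, hN⟩ := Filter.eventually_atTop.1
    ((h.eventually (lt_mem_nhds (half_lt_self hl))).and (h.eventually (gt_mem_nhds (lt_add_one l))))
  have hne : (Finset.Icc 1 (N + 1)).Nonempty := ⟨1, by simp⟩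
  obtain ⟨i, hi, hmin⟩ := Finset.exists_min_image (Finset.Icc 1 (N + 1)) u hne
  obtain ⟨j, hj, hmax⟩ := Finset.exists_max_image (Finset.Icc 1 (N + 1)) u hne
  have hi' := hpos i (Finset.mem_Icc.1 hi).1
  have hj' := hpos j (Finset.mem_Icc.1 hj).1
  refine ⟨min (l / 2) (u i), max (l + 1) (u j), by positivity, by positivity, fun n hn => ?_⟩
  rcases le_total n N with h1 | h1
  · have hm : n ∈ Finset.Icc 1 (N + 1) := Finset.mem_Icc.2 ⟨hn, by omega⟩
    exact ⟨(min_le_right _ _).trans (hmin n hm), (hmax n hm).trans (le_max_right _ _)⟩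
  · exact ⟨(min_le_left _ _).trans (hN n h1).1.le, (hN n h1).2.le.trans (le_max_left _ _)⟩

theorem exists_erwA_bounds {p : ℝ} (hp : 0 < p) :
    ∃ c C : ℝ, 0 < c ∧ 0 < C ∧ ∀ n : ℕ, 1 ≤ n →
      c ≤ erwA p n * (n : ℝ) ^ (2 * p - 1) ∧ erwA p n * (n : ℝ) ^ (2 * p - 1) ≤ C := by
  refine exists_bounds_of_tendsto (fun n hn => ?_)
    (Real.Gamma_pos_of_pos (by linarith : 0 < 2 * p)) ?_
  · have := erwA_pos hp hn
    have : (0 : ℝ) < n := by exact_mod_cast hn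
    positivity
  · rw [← Filter.tendsto_add_atTop_iff_nat 2]
    have h1 := Real.GammaSeq_tendsto_Gamma (2 * p)
    have ha : Filter.Tendsto (fun n : ℕ => ((n : ℝ) + 1) / n) Filter.atTop (nhds 1) := by
      have := tendsto_natCast_div_add_atTop (1 : ℝ)
      simpa using this.inv₀ one_ne_zero
    have hb : Filter.Tendsto (fun n : ℕ => ((n : ℝ) + 2) / n) Filter.atTop (nhds 1) := by
      have := tendsto_natCast_div_add_atTop (2 : ℝ)
      simpa using this.inv₀ one_ne_zero
    have hb' := hb.rpow_const (p := 2 * p - 1) (Or.inl one_ne_zero)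
    rw [Real.one_rpow] at hb'
    have := (ha.mul hb').mul h1
    rw [one_mul, one_mul] at this
    refine this.congr' ?_
    filter_upwards [Filter.eventually_ge_atTop 1] with n hn
    have hn0 : (0 : ℝ) < n := by exact_mod_cast hn
    have e := erwA_eq_gammaSeq hp n hn
    rw [Real.div_rpow (by positivity) hn0.le]
    have e2 : (n : ℝ) ^ (2 * p) = n * (n : ℝ) ^ (2 * p - 1) := by
      rw [Real.rpow_sub_one hn0.ne']; field_simp
    have h0 : (n : ℝ) ^ (2 * p - 1) ≠ 0 := (Real.rpow_pos_of_pos hn0 _).ne'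
    rw [e2] at e
    push_cast
    field_simp
    linear_combination -e

theorem exists_erwA_sq_bounds {p : ℝ} (hp : 0 < p) :
    ∃ c C : ℝ, 0 < c ∧ 0 < C ∧ ∀ n : ℕ, 1 ≤ n →
      c * (n : ℝ) ^ (2 - 4 * p) ≤ erwA p n ^ 2 ∧ erwA p n ^ 2 ≤ C * (n : ℝ) ^ (2 - 4 * p) := by
  obtain ⟨c, C, hc, hC, h⟩ := exists_erwA_bounds hp
  refine ⟨c ^ 2, C ^ 2, by positivity, by positivity, fun n hn => ?_⟩
  have hn0 : (0 : ℝ) < n := by exact_mod_cast hn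
  have ha := erwA_pos hp hn
  obtain ⟨h1, h2⟩ := h n hn
  have e : erwA p n ^ 2 = (erwA p n * (n : ℝ) ^ (2 * p - 1)) ^ 2 * (n : ℝ) ^ (2 - 4 * p) := by
    rw [mul_pow, ← Real.rpow_natCast ((n : ℝ) ^ (2 * p - 1)), ← Real.rpow_mul hn0.le, mul_assoc,
      ← Real.rpow_add hn0, show (2 * p - 1) * ((2 : ℕ) : ℝ) + (2 - 4 * p) = 0 by push_cast; ring,
      Real.rpow_zero, mul_one]
  rw [e]
  constructor
  · gcongr
  · gcongr

/-- For e ≥ 1 the last term is the largest. For e ≤ 1 Bernoulli's inequality gives e (n+1)^(e-1) ≤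
(n+1)^e - n^e, and the sum telescopes. -/
theorem sum_rpow_sub_one_le {e : ℝ} (he : 0 < e) : ∃ C : ℝ, 0 < C ∧ ∀ n : ℕ,
    ∑ i ∈ Finset.range n, ((i + 1 : ℕ) : ℝ) ^ (e - 1) ≤ C * (n : ℝ) ^ e := by
  rcases le_total 1 e with h1 | h1
  · refine ⟨1, one_pos, fun n => ?_⟩
    rcases Nat.eq_zero_or_pos n with rfl | hn
    · simp [Real.zero_rpow he.ne']
    have hn0 : (0 : ℝ) < n := by exact_mod_cast hn
    refine (Finset.sum_le_card_nsmul _ _ ((n : ℝ) ^ (e - 1)) fun i hi => ?_).trans (le_of_eq ?_)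
    · exact Real.rpow_le_rpow (by positivity)
        (by exact_mod_cast Finset.mem_range.1 hi) (by linarith)
    · rw [Finset.card_range, nsmul_eq_mul, Real.rpow_sub_one hn0.ne']
      field_simp
  · refine ⟨1 / e, by positivity, fun n => ?_⟩
    induction n with
    | zero => simp [Real.zero_rpow he.ne']
    | succ n ih =>
      rw [Finset.sum_range_succ]
      have hn0 : (0 : ℝ) < (n + 1 : ℕ) := by positivity
      have hb := rpow_one_add_le_one_add_mul_self (s := -(1 / ((n + 1 : ℕ) : ℝ)))
        (by rw [neg_le_neg_iff, div_le_one hn0]; exact_mod_cast Nat.succ_pos n) he.le h1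
      have e1 : 1 + -(1 / ((n + 1 : ℕ) : ℝ)) = n / (n + 1 : ℕ) := by
        push_cast; field_simp; ring
      rw [e1, Real.div_rpow (by positivity) hn0.le, div_le_iff₀ (by positivity)] at hb
      have e2 : ((n + 1 : ℕ) : ℝ) ^ (e - 1) = ((n + 1 : ℕ) : ℝ) ^ e / (n + 1 : ℕ) :=
        Real.rpow_sub_one hn0.ne' _
      rw [e2]
      have e3 : 1 / e * ((1 + e * -(1 / ((n + 1 : ℕ) : ℝ))) * ((n + 1 : ℕ) : ℝ) ^ e) =
          1 / e * ((n + 1 : ℕ) : ℝ) ^ e - ((n + 1 : ℕ) : ℝ) ^ e / (n + 1 : ℕ) := by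
        field_simp; ring
      have := mul_le_mul_of_nonneg_left hb (by positivity : 0 ≤ 1 / e)
      rw [e3] at this
      linarith

/-- The freedom in e matters at p = 3/4, where v_n is logarithmic and lies below every positive
power of n. -/
theorem exists_erwV_le {p e : ℝ} (hp : 0 < p) (he : 0 < e) (hpe : 3 - 4 * p ≤ e) :
    ∃ C : ℝ, 0 < C ∧ ∀ n : ℕ, erwV p n ≤ C * (n : ℝ) ^ e := by
  obtain ⟨c, C, hc, hC, h⟩ := exists_erwA_sq_bounds hp
  obtain ⟨C', hC', h'⟩ := sum_rpow_sub_one_le he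
  refine ⟨C * C', by positivity, fun n => ?_⟩
  rw [erwV_eq_sum_range, mul_assoc]
  refine le_trans ?_ (mul_le_mul_of_nonneg_left (h' n) hC.le)
  rw [Finset.mul_sum]
  refine Finset.sum_le_sum fun i _ => ((h (i + 1) (by omega)).2).trans ?_
  refine mul_le_mul_of_nonneg_left ?_ hC.le
  exact Real.rpow_le_rpow_of_exponent_le (by exact_mod_cast Nat.succ_pos i) (by linarith)

theorem exists_le_erwV {p : ℝ} (hp : 0 < p) :
    ∃ c : ℝ, 0 < c ∧ ∀ n : ℕ, 1 ≤ n → c * (n : ℝ) ^ (3 - 4 * p) ≤ n * erwA p n ^ 2 ∧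
      c * (n : ℝ) ^ (3 - 4 * p) ≤ erwV p n := by
  obtain ⟨c, C, hc, hC, h⟩ := exists_erwA_sq_bounds hp
  refine ⟨c / 3, by positivity, fun n hn => ?_⟩
  have hn0 : (0 : ℝ) < n := by exact_mod_cast hn
  have h1 := mul_le_mul_of_nonneg_left (h n hn).1 hn0.le
  have h2 := mul_erwA_sq_le hp hn
  have e : (n : ℝ) ^ (3 - 4 * p) = n * (n : ℝ) ^ (2 - 4 * p) := by
    rw [show 3 - 4 * p = 1 + (2 - 4 * p) by ring, Real.rpow_add hn0, Real.rpow_one]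
  have h3 : 0 ≤ c * ((n : ℝ) * (n : ℝ) ^ (2 - 4 * p)) := by positivity
  rw [e]
  constructor <;> linarith

/-- At p = 3/4 the squares a_i² are comparable to 1/i, so v_n is comparable to a harmonic number. -/
theorem exists_log_bounds_erwV :
    ∃ c C : ℝ, 0 < c ∧ 0 < C ∧ ∀ n : ℕ, 1 ≤ n →
      c * Real.log n ≤ erwV (3 / 4) n ∧ erwV (3 / 4) n ≤ C * (1 + Real.log n) := by
  obtain ⟨c, C, hc, hC, h⟩ := exists_erwA_sq_bounds (p := 3 / 4) (by norm_num)
  refine ⟨c, C, hc, hC, fun n hn => ?_⟩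
  have hn0 : (0 : ℝ) < n := by exact_mod_cast hn
  have e : ∀ i : ℕ, ((i + 1 : ℕ) : ℝ) ^ (2 - 4 * (3 / 4 : ℝ)) = (((i + 1 : ℕ) : ℝ))⁻¹ := fun i => by
    rw [← Real.rpow_neg_one]; norm_num
  have hh : ∑ i ∈ Finset.range n, (((i + 1 : ℕ) : ℝ))⁻¹ = (harmonic n : ℝ) := by
    simp [harmonic]
  rw [erwV_eq_sum_range]
  constructor
  · calc c * Real.log n ≤ c * (harmonic n : ℝ) := by
          refine mul_le_mul_of_nonneg_left ?_ hc.le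
          refine le_trans ?_ (log_add_one_le_harmonic n)
          exact Real.log_le_log hn0 (by push_cast; linarith)
      _ ≤ _ := by
          rw [← hh, Finset.mul_sum]
          exact Finset.sum_le_sum fun i _ => by rw [← e]; exact (h (i + 1) (by omega)).1
  · calc _ ≤ C * (harmonic n : ℝ) := by
          rw [← hh, Finset.mul_sum]
          exact Finset.sum_le_sum fun i _ => by rw [← e]; exact (h (i + 1) (by omega)).2
      _ ≤ _ := mul_le_mul_of_nonneg_left (harmonic_le_one_add_log n) hC.le

/-! ### Summation of the step errors -/

/-- With j = n - i and t = r ∧ 1, the second kind of term equals n^(-r/2) j^((r-4)/2) ≤ n^(-t/2)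
j^((t-4)/2), and (t - 4)/2 ≤ -3/2 is a summable exponent. Capping r at 1 is harmless, since the
final rate only involves r ∧ ρ with ρ ≤ 1. -/
theorem exists_sum_le_of_le (r : ℝ) : ∃ C : ℝ, 0 < C ∧
    ∀ (n : ℕ) (x : ℕ → ℝ) (G H : ℝ), 1 ≤ n → 0 ≤ G → 0 ≤ H →
    (∀ i < n, x i ≤ G * ((i + 1 : ℕ) : ℝ) ^ (-(3 / 2) : ℝ) +
      H * (((n : ℝ) ^ 2)⁻¹ * (((n : ℝ) - i) / n) ^ ((r - 4) / 2))) →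
    ∑ i ∈ Finset.range n, x i ≤ C * (G + H * (n : ℝ) ^ (-(min r 1 / 2))) := by
  have hs : Summable (fun i : ℕ => ((i + 1 : ℕ) : ℝ) ^ (-(3 / 2) : ℝ)) :=
    (summable_nat_add_iff 1).2 (Real.summable_nat_rpow.2 (by norm_num))
  set C := ∑' i : ℕ, ((i + 1 : ℕ) : ℝ) ^ (-(3 / 2) : ℝ) with hC
  have hsum : ∀ n, ∑ i ∈ Finset.range n, ((i + 1 : ℕ) : ℝ) ^ (-(3 / 2) : ℝ) ≤ C := fun n =>
    hs.sum_le_tsum _ fun i _ => by positivity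
  have hC0 : 0 ≤ C := tsum_nonneg fun i => by positivity
  refine ⟨C + 1, by positivity, fun n x G H hn hG hH hx => ?_⟩
  have hn0 : (0 : ℝ) < n := by exact_mod_cast hn
  set t := min r 1 with ht
  have ht1 : t ≤ 1 := min_le_right _ _
  have htr : t ≤ r := min_le_left _ _
  have h2 : ∑ i ∈ Finset.range n, ((n : ℝ) ^ 2)⁻¹ * (((n : ℝ) - i) / n) ^ ((r - 4) / 2) ≤
      C * (n : ℝ) ^ (-(t / 2)) := by
    have e1 : ∀ i ∈ Finset.range n, ((n : ℝ) ^ 2)⁻¹ * (((n : ℝ) - i) / n) ^ ((r - 4) / 2) ≤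
        (n : ℝ) ^ (-(t / 2)) * ((n - 1 - i + 1 : ℕ) : ℝ) ^ (-(3 / 2) : ℝ) := by
      intro i hi
      have hin := Finset.mem_range.1 hi
      have e2 : (n : ℝ) - i = (n - 1 - i + 1 : ℕ) := by
        rw [show n - 1 - i + 1 = n - i by omega, Nat.cast_sub hin.le]
      rw [e2]
      set j := n - 1 - i + 1 with hj
      have hj1 : (1 : ℝ) ≤ j := by exact_mod_cast (by omega : 1 ≤ j)
      have hj0 : (0 : ℝ) < j := by linarith
      have hjn : (j : ℝ) ≤ n := by exact_mod_cast (by omega : j ≤ n)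
      rw [Real.div_rpow hj0.le hn0.le]
      have e3 : ((n : ℝ) ^ 2)⁻¹ * ((j : ℝ) ^ ((r - 4) / 2) / (n : ℝ) ^ ((r - 4) / 2)) =
          (n : ℝ) ^ (-(r / 2)) * (j : ℝ) ^ ((r - 4) / 2) := by
        rw [show -(r / 2) = -2 - (r - 4) / 2 by ring, Real.rpow_sub hn0, Real.rpow_neg hn0.le,
          Real.rpow_two]
        ring
      have e4 : (j : ℝ) ^ ((r - 4) / 2) = (j : ℝ) ^ ((r - t) / 2) * (j : ℝ) ^ ((t - 4) / 2) := by
        rw [← Real.rpow_add hj0]; congr 1; ring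
      have e5 : (n : ℝ) ^ (-(t / 2)) = (n : ℝ) ^ (-(r / 2)) * (n : ℝ) ^ ((r - t) / 2) := by
        rw [← Real.rpow_add hn0]; congr 1; ring
      rw [e3, e4, e5, mul_assoc]
      have h6 : (j : ℝ) ^ ((r - t) / 2) ≤ (n : ℝ) ^ ((r - t) / 2) :=
        Real.rpow_le_rpow hj0.le hjn (by linarith)
      have h7 : (j : ℝ) ^ ((t - 4) / 2) ≤ (j : ℝ) ^ (-(3 / 2) : ℝ) :=
        Real.rpow_le_rpow_of_exponent_le hj1 (by linarith)
      gcongr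
    refine (Finset.sum_le_sum e1).trans ?_
    rw [← Finset.mul_sum, Finset.sum_range_reflect
      (fun i => ((i + 1 : ℕ) : ℝ) ^ (-(3 / 2) : ℝ)) n, mul_comm]
    exact mul_le_mul_of_nonneg_right (hsum n) (by positivity)
  refine (Finset.sum_le_sum fun i hi => hx i (Finset.mem_range.1 hi)).trans ?_
  rw [Finset.sum_add_distrib, ← Finset.mul_sum, ← Finset.mul_sum]
  have h3 := mul_le_mul_of_nonneg_left (hsum n) hG
  have h4 := mul_le_mul_of_nonneg_left h2 hH
  have h5 : 0 ≤ H * (n : ℝ) ^ (-(t / 2)) := by positivity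
  nlinarith

/-- In the first half of the time interval the remaining fraction is at least 1/2 and its power at
most 4. In the second half (i+1)^(-2) ≤ 4 n^(-2). -/
theorem split_term {r : ℝ} (hr : 0 < r) (hr' : r ≤ 2) {n i : ℕ} (hi : i < n) {x : ℝ}
    (hx : 0 ≤ x) (hx1 : x ≤ 1) :
    x * (((i + 1 : ℕ) : ℝ) ^ 2)⁻¹ * (((n : ℝ) - i) / n) ^ ((r - 4) / 2) ≤
      4 * (x * (((i + 1 : ℕ) : ℝ) ^ 2)⁻¹) +
        4 * (((n : ℝ) ^ 2)⁻¹ * (((n : ℝ) - i) / n) ^ ((r - 4) / 2)) := by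
  have hin : (i : ℝ) + 1 ≤ n := by exact_mod_cast hi
  have hi0 : (0 : ℝ) ≤ i := by positivity
  have hn0 : (0 : ℝ) < n := by linarith
  have hτ : 0 < ((n : ℝ) - i) / n := div_pos (by linarith) hn0
  have hτp := Real.rpow_pos_of_pos hτ ((r - 4) / 2)
  rcases le_or_gt (2 * (i + 1 : ℝ)) n with h | h
  · have h1 : (1 : ℝ) / 2 ≤ ((n : ℝ) - i) / n := by rw [div_le_div_iff₀ (by norm_num) hn0]; linarith
    have h2 : (((n : ℝ) - i) / n) ^ ((r - 4) / 2) ≤ 4 := by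
      refine (Real.rpow_le_rpow_of_nonpos (by norm_num) h1 (by linarith)).trans ?_
      rw [one_div, Real.inv_rpow (by norm_num), ← Real.rpow_neg (by norm_num)]
      calc (2 : ℝ) ^ (-((r - 4) / 2)) ≤ 2 ^ (2 : ℝ) :=
            Real.rpow_le_rpow_of_exponent_le (by norm_num) (by linarith)
        _ = 4 := by norm_num
    have h3 : 0 ≤ x * (((i + 1 : ℕ) : ℝ) ^ 2)⁻¹ := by positivity
    have h4 : 0 ≤ ((n : ℝ) ^ 2)⁻¹ * (((n : ℝ) - i) / n) ^ ((r - 4) / 2) := by positivity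
    nlinarith
  · have h1 : (((i + 1 : ℕ) : ℝ) ^ 2)⁻¹ ≤ 4 * ((n : ℝ) ^ 2)⁻¹ := by
      rw [← div_eq_mul_inv, inv_eq_one_div, div_le_div_iff₀ (by positivity) (by positivity)]
      push_cast
      nlinarith
    have h2 : x * (((i + 1 : ℕ) : ℝ) ^ 2)⁻¹ ≤ 4 * ((n : ℝ) ^ 2)⁻¹ := by
      refine le_trans ?_ h1
      exact mul_le_of_le_one_left (by positivity) hx1
    have h3 : 0 ≤ x * (((i + 1 : ℕ) : ℝ) ^ 2)⁻¹ := by positivity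
    have h4 := mul_le_mul_of_nonneg_right h2 hτp.le
    linarith

/-- The normalized contribution of step `i + 1` to the error, up to constants. -/
noncomputable def erwWeight (p r : ℝ) (n i : ℕ) : ℝ :=
  erwV p (i + 1) / erwV p n * (((i + 1 : ℕ) : ℝ) ^ 2)⁻¹ *
    ((erwV p n - erwV p (i + 1) + erwA p n ^ 2) / erwV p n) ^ ((r - 4) / 2)

/-- After step i + 1 only n - i - 1 steps remain; the additional a_n² supplies the missing unit. -/
theorem mul_erwA_sq_le_width {p : ℝ} (hp : 0 < p) {n i : ℕ} (hi : i < n) :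
    ((n : ℝ) - i) * erwA p n ^ 2 ≤ 3 * (erwV p n - erwV p (i + 1) + erwA p n ^ 2) := by
  have := mul_erwA_sq_le_remaining hp (k := i + 1) (n := n) (by omega) (by omega)
  push_cast at this
  nlinarith [sq_nonneg (erwA p n)]

theorem sq_inv_eq (k : ℕ) (hk : 1 ≤ k) (x : ℝ) :
    (k : ℝ) ^ x * ((k : ℝ) ^ 2)⁻¹ = (k : ℝ) ^ (x - 2) := by
  have hk0 : (0 : ℝ) < k := by exact_mod_cast hk
  rw [Real.rpow_sub hk0, Real.rpow_two, div_eq_mul_inv]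

/-- Here v_n is of order n^δ with δ = 3 - 4p > 0, the same order as n a_n². The remaining fraction
of the variance is then at least proportional to the remaining fraction (n - i)/n of the time, and
the previous two summation lemmas apply. -/
theorem exists_sum_erwWeight_le_of_lt {p r : ℝ} (hp : 0 < p) (hp' : p < 3 / 4) (hr : 0 < r)
    (hr' : r ≤ 2) : ∃ C : ℝ, 0 < C ∧ ∀ n : ℕ, 1 ≤ n →
      ∑ i ∈ Finset.range n, erwWeight p r n i ≤
        C * ((n : ℝ) ^ (-(min r 1 / 2)) + 1 / erwV p n) := by
  obtain ⟨C₀, hC₀, hsum⟩ := exists_sum_le_of_le r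
  obtain ⟨c, hc, hlow⟩ := exists_le_erwV hp
  set δ := 3 - 4 * p with hδ
  have hδ0 : 0 < δ := by linarith
  obtain ⟨C, hC, hup⟩ := exists_erwV_le hp hδ0 le_rfl
  -- For δ ≤ 1/2 one has v_k = O(k^(1/2)), and the summand 1/v_n is used. For δ ≥ 1/2 the quotient
  -- is of order at most (k/n)^δ ≤ (k/n)^(1/2). In both cases division by k² leaves the summable
  -- k^(-3/2).
  have hratio : ∃ D : ℝ, 0 < D ∧ ∀ k n : ℕ, 1 ≤ k → k ≤ n →
      erwV p k / erwV p n ≤ D * ((k : ℝ) ^ (1 / 2 : ℝ) *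
        (1 / erwV p n + (n : ℝ) ^ (-(1 / 2) : ℝ))) := by
    rcases le_total δ (1 / 2) with h | h
    · obtain ⟨D, hD, hDn⟩ := exists_erwV_le (e := 1 / 2) hp (by norm_num) h
      refine ⟨D, hD, fun k n hk hkn => ?_⟩
      have hv : 0 < erwV p n := one_pos.trans_le (one_le_erwV hp (hk.trans hkn))
      rw [div_eq_mul_one_div, ← mul_assoc]
      have h1 : (1 : ℝ) / erwV p n ≤ 1 / erwV p n + (n : ℝ) ^ (-(1 / 2) : ℝ) := by
        have : 0 ≤ (n : ℝ) ^ (-(1 / 2) : ℝ) := by positivity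
        linarith
      exact mul_le_mul (hDn k) h1 (by positivity) (by positivity)
    · refine ⟨C / c, by positivity, fun k n hk hkn => ?_⟩
      have hv : 0 < erwV p n := one_pos.trans_le (one_le_erwV hp (hk.trans hkn))
      have hk0 : (0 : ℝ) < k := by exact_mod_cast hk
      have hn0 : (0 : ℝ) < n := by exact_mod_cast hk.trans hkn
      have hknR : (k : ℝ) ≤ n := by exact_mod_cast hkn
      have h1 : (n : ℝ) ^ (-(1 / 2) : ℝ) ≤ 1 / erwV p n + (n : ℝ) ^ (-(1 / 2) : ℝ) := by
        have : 0 < 1 / erwV p n := by positivity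
        linarith
      have h2 : (k : ℝ) ^ δ = (k : ℝ) ^ (1 / 2 : ℝ) * (k : ℝ) ^ (δ - 1 / 2) := by
        rw [← Real.rpow_add hk0]; congr 1; ring
      have h3 : (k : ℝ) ^ (δ - 1 / 2) ≤ (n : ℝ) ^ δ * (n : ℝ) ^ (-(1 / 2) : ℝ) := by
        rw [← Real.rpow_add hn0]
        exact Real.rpow_le_rpow hk0.le hknR (by linarith)
      have h4 := (hlow n (hk.trans hkn)).2
      rw [div_le_iff₀ hv]
      calc erwV p k ≤ C * ((k : ℝ) ^ (1 / 2 : ℝ) * (k : ℝ) ^ (δ - 1 / 2)) := h2 ▸ hup k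
        _ ≤ C * ((k : ℝ) ^ (1 / 2 : ℝ) * ((n : ℝ) ^ δ * (n : ℝ) ^ (-(1 / 2) : ℝ))) := by gcongr
        _ = C / c * ((k : ℝ) ^ (1 / 2 : ℝ) * (n : ℝ) ^ (-(1 / 2) : ℝ)) * (c * (n : ℝ) ^ δ) := by
            field_simp
        _ ≤ C / c * ((k : ℝ) ^ (1 / 2 : ℝ) * (1 / erwV p n + (n : ℝ) ^ (-(1 / 2) : ℝ))) *
            erwV p n := by gcongr
  obtain ⟨D, hD, hratio⟩ := hratio
  set c' := c / (3 * C) with hc'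
  have hc'0 : 0 < c' := by positivity
  set q := c' ^ ((r - 4) / 2) with hq
  have hq0 : 0 < q := Real.rpow_pos_of_pos hc'0 _
  refine ⟨C₀ * (4 * q * D + 4 * q), by positivity, fun n hn => ?_⟩
  have hv : 0 < erwV p n := one_pos.trans_le (one_le_erwV hp hn)
  have hn1 : (1 : ℝ) ≤ n := by exact_mod_cast hn
  have hn0 : (0 : ℝ) < n := by linarith
  refine (hsum n _ (4 * q * D * (1 / erwV p n + (n : ℝ) ^ (-(1 / 2) : ℝ))) (4 * q) hn
    (by positivity) (by positivity) fun i hi => ?_).trans ?_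
  · have hi' : (i : ℝ) + 1 ≤ n := by exact_mod_cast hi
    have hτ : 0 < ((n : ℝ) - i) / n := div_pos (by linarith) hn0
    have hvi : 0 < erwV p (i + 1) := one_pos.trans_le (one_le_erwV hp (by omega))
    have hx1 : erwV p (i + 1) / erwV p n ≤ 1 := (div_le_one hv).2 (erwV_mono p hi)
    have hθ : c' * (((n : ℝ) - i) / n) ≤
        (erwV p n - erwV p (i + 1) + erwA p n ^ 2) / erwV p n := by
      rw [le_div_iff₀ hv]
      have h1 := mul_erwA_sq_le_width hp hi
      have h2 := (hlow n hn).1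
      have h3 := hup n
      calc c' * (((n : ℝ) - i) / n) * erwV p n
          ≤ c' * (((n : ℝ) - i) / n) * (C * (n : ℝ) ^ δ) := by gcongr
        _ = (((n : ℝ) - i) / n) * (c * (n : ℝ) ^ δ) / 3 := by rw [hc']; field_simp
        _ ≤ (((n : ℝ) - i) / n) * (n * erwA p n ^ 2) / 3 := by gcongr
        _ = (((n : ℝ) - i) * erwA p n ^ 2) / 3 := by field_simp
        _ ≤ _ := by linarith
    have hθ' : ((erwV p n - erwV p (i + 1) + erwA p n ^ 2) / erwV p n) ^ ((r - 4) / 2) ≤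
        q * (((n : ℝ) - i) / n) ^ ((r - 4) / 2) := by
      rw [hq, ← Real.mul_rpow hc'0.le hτ.le]
      exact Real.rpow_le_rpow_of_nonpos (by positivity) hθ (by linarith)
    have hs := split_term hr hr' hi (by positivity : 0 ≤ erwV p (i + 1) / erwV p n) hx1
    have hra := hratio (i + 1) n (by omega) hi
    have hk := sq_inv_eq (i + 1) (by omega) (1 / 2)
    rw [show (1 / 2 : ℝ) - 2 = -(3 / 2) by norm_num] at hk
    unfold erwWeight
    set x := erwV p (i + 1) / erwV p n with hx
    have hx0 : 0 ≤ x := by positivity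
    set W := 1 / erwV p n + (n : ℝ) ^ (-(1 / 2) : ℝ) with hW
    rw [← hk]
    calc x * (((i + 1 : ℕ) : ℝ) ^ 2)⁻¹ *
          ((erwV p n - erwV p (i + 1) + erwA p n ^ 2) / erwV p n) ^ ((r - 4) / 2)
        ≤ x * (((i + 1 : ℕ) : ℝ) ^ 2)⁻¹ * (q * (((n : ℝ) - i) / n) ^ ((r - 4) / 2)) := by gcongr
      _ = q * (x * (((i + 1 : ℕ) : ℝ) ^ 2)⁻¹ * (((n : ℝ) - i) / n) ^ ((r - 4) / 2)) := by ring
      _ ≤ q * (4 * (x * (((i + 1 : ℕ) : ℝ) ^ 2)⁻¹) +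
        4 * (((n : ℝ) ^ 2)⁻¹ * (((n : ℝ) - i) / n) ^ ((r - 4) / 2))) := by gcongr
      _ ≤ q * (4 * (D * (((i + 1 : ℕ) : ℝ) ^ (1 / 2 : ℝ) * W) * (((i + 1 : ℕ) : ℝ) ^ 2)⁻¹) +
        4 * (((n : ℝ) ^ 2)⁻¹ * (((n : ℝ) - i) / n) ^ ((r - 4) / 2))) := by gcongr
      _ = _ := by ring
  · have h1 : (n : ℝ) ^ (-(1 / 2) : ℝ) ≤ (n : ℝ) ^ (-(min r 1 / 2)) :=
      Real.rpow_le_rpow_of_exponent_le hn1 (by linarith [min_le_right r 1])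
    have h2 : 0 < 1 / erwV p n := by positivity
    set Y := (n : ℝ) ^ (-(min r 1 / 2))
    rw [mul_assoc C₀]
    refine mul_le_mul_of_nonneg_left ?_ hC₀.le
    have h3 : 0 ≤ 4 * q * D := by positivity
    nlinarith [mul_le_mul_of_nonneg_left h1 h3]

/-- Since n a_n² stays of order 1 while v_n grows, comparing remaining variance with remaining time
costs a factor up to v_n². Steps with v_k ≤ v_n/2 avoid the comparison. For the others, k is at
least of the order of a power of n, which outweighs any power of v_n. -/
theorem exists_sum_erwWeight_critical_le {r : ℝ} (hr : 0 < r)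
    (hr' : r ≤ 2) : ∃ C : ℝ, 0 < C ∧ ∀ n : ℕ, 1 ≤ n →
      ∑ i ∈ Finset.range n, erwWeight (3 / 4) r n i ≤ C * (1 / erwV (3 / 4) n) := by
  have hp : (0 : ℝ) < 3 / 4 := by norm_num
  obtain ⟨C₀, hC₀, hsum⟩ := exists_sum_le_of_le r
  obtain ⟨c, hc, hlow⟩ := exists_le_erwV hp
  obtain ⟨l, L, hl, hL, hlog⟩ := exists_log_bounds_erwV
  set t := min r 1 with ht
  have ht0 : 0 < t := by positivity
  -- From v_n < 2 v_k follows l log n ≤ 2L (1 + log k), so that k is at least of order n^(l/(2L));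
  -- the last division by 2 accounts for the power k^(-1/2).
  set κ := l / (2 * L) / 2 with hκ
  have hκ0 : 0 < κ := by positivity
  have hlate : ∀ k n : ℕ, 1 ≤ k → 1 ≤ n → erwV (3 / 4) n < 2 * erwV (3 / 4) k →
      (k : ℝ) ^ (-(1 / 2) : ℝ) ≤ Real.exp (1 / 2) * (n : ℝ) ^ (-κ) := by
    intro k n hk hn h
    have hk0 : (0 : ℝ) < k := by exact_mod_cast hk
    have hn0 : (0 : ℝ) < n := by exact_mod_cast hn
    have h1 := (hlog n hn).1
    have h2 := (hlog k hk).2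
    rw [Real.rpow_def_of_pos hk0, Real.rpow_def_of_pos hn0, ← Real.exp_add]
    apply Real.exp_le_exp.2
    have h3 : l * Real.log n ≤ 2 * L * (1 + Real.log k) := by linarith
    have h4 : κ * Real.log n ≤ (1 + Real.log k) / 2 := by
      have : κ * Real.log n = l * Real.log n / (4 * L) := by rw [hκ]; field_simp; ring
      rw [this, div_le_iff₀ (by positivity)]
      linarith
    linarith
  obtain ⟨C₁, hC₁, hv1⟩ := exists_erwV_le (e := 1 / 2) hp (by norm_num) (by norm_num)
  obtain ⟨C₂, hC₂, hv2⟩ := exists_erwV_le (e := κ / 3) hp (by positivity) (by linarith)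
  obtain ⟨C₃, hC₃, hv3⟩ := exists_erwV_le (e := t / 2 / 3) hp (by positivity) (by linarith)
  -- A bound of v_n by n^(e/3) lets n^(-e) pay for v_n³: two factors are the loss in the late steps,
  -- the third gives the rate 1/v_n.
  have hcube : ∀ (n : ℕ) (e D : ℝ), 1 ≤ n → 0 ≤ D → erwV (3 / 4) n ≤ D * (n : ℝ) ^ (e / 3) →
      erwV (3 / 4) n ^ 2 * (n : ℝ) ^ (-e) ≤ D ^ 3 * (1 / erwV (3 / 4) n) := by
    intro n e D hn hD h
    have hv : 0 < erwV (3 / 4) n := one_pos.trans_le (one_le_erwV hp hn)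
    have hn0 : (0 : ℝ) < n := by exact_mod_cast hn
    have h1 : erwV (3 / 4) n ^ 3 ≤ D ^ 3 * (n : ℝ) ^ e := by
      have := pow_le_pow_left₀ hv.le h 3
      rw [mul_pow, ← Real.rpow_natCast ((n : ℝ) ^ (e / 3)), ← Real.rpow_mul hn0.le] at this
      rwa [show e / 3 * ((3 : ℕ) : ℝ) = e by push_cast; ring] at this
    rw [Real.rpow_neg hn0.le, mul_one_div, le_div_iff₀ hv, ← div_eq_mul_inv, div_mul_eq_mul_div,
      div_le_iff₀ (by positivity)]
    linarith [h1]
  set c' := c / 3 with hc'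
  have hc'0 : 0 < c' := by positivity
  set q := c' ^ ((r - 4) / 2) with hq
  have hq0 : 0 < q := Real.rpow_pos_of_pos hc'0 _
  refine ⟨C₀ * (4 * C₁ + 4 * q * Real.exp (1 / 2) * C₂ ^ 3 + 4 * q * C₃ ^ 3), by positivity,
    fun n hn => ?_⟩
  set p : ℝ := 3 / 4 with hpe
  have hv1n := one_le_erwV hp hn
  have hv : 0 < erwV p n := one_pos.trans_le hv1n
  have hn1 : (1 : ℝ) ≤ n := by exact_mod_cast hn
  have hn0 : (0 : ℝ) < n := by linarith
  have hK2 := hcube n κ C₂ hn hC₂.le (hv2 n)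
  have hK3 := hcube n (t / 2) C₃ hn hC₃.le (hv3 n)
  refine (hsum n _ (4 * C₁ * (1 / erwV p n) +
    4 * q * Real.exp (1 / 2) * (erwV p n ^ 2 * (n : ℝ) ^ (-κ))) (4 * q * erwV p n ^ 2) hn
    (by positivity) (by positivity) fun i hi => ?_).trans ?_
  · have hi' : (i : ℝ) + 1 ≤ n := by exact_mod_cast hi
    have hτ : 0 < ((n : ℝ) - i) / n := div_pos (by linarith) hn0
    have hvi : 0 < erwV p (i + 1) := one_pos.trans_le (one_le_erwV hp (by omega))
    have hx1 : erwV p (i + 1) / erwV p n ≤ 1 := (div_le_one hv).2 (erwV_mono p hi)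
    have hk0 : (0 : ℝ) < ((i + 1 : ℕ) : ℝ) := by positivity
    have hτp := Real.rpow_pos_of_pos hτ ((r - 4) / 2)
    unfold erwWeight
    set Y := ((i + 1 : ℕ) : ℝ) ^ (-(3 / 2) : ℝ) with hY
    have hY0 : 0 ≤ Y := by positivity
    have hx0 : 0 ≤ erwV p (i + 1) / erwV p n := by positivity
    rcases le_or_gt (2 * erwV p (i + 1)) (erwV p n) with h | h
    · have hθ : 1 / 2 ≤ (erwV p n - erwV p (i + 1) + erwA p n ^ 2) / erwV p n := by
        rw [le_div_iff₀ hv]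
        nlinarith [sq_nonneg (erwA p n)]
      have hθ' : ((erwV p n - erwV p (i + 1) + erwA p n ^ 2) / erwV p n) ^ ((r - 4) / 2) ≤ 4 := by
        refine (Real.rpow_le_rpow_of_nonpos (by norm_num) hθ (by linarith)).trans ?_
        rw [one_div, Real.inv_rpow (by norm_num), ← Real.rpow_neg (by norm_num)]
        calc (2 : ℝ) ^ (-((r - 4) / 2)) ≤ 2 ^ (2 : ℝ) :=
              Real.rpow_le_rpow_of_exponent_le (by norm_num) (by linarith)
          _ = 4 := by norm_num
      have hk := sq_inv_eq (i + 1) (by omega) (1 / 2)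
      rw [show (1 / 2 : ℝ) - 2 = -(3 / 2) by norm_num, ← hY] at hk
      have hvk := hv1 (i + 1)
      calc _ ≤ erwV p (i + 1) / erwV p n * (((i + 1 : ℕ) : ℝ) ^ 2)⁻¹ * 4 := by gcongr
        _ ≤ C₁ * ((i + 1 : ℕ) : ℝ) ^ (1 / 2 : ℝ) / erwV p n * (((i + 1 : ℕ) : ℝ) ^ 2)⁻¹ * 4 := by
            gcongr
        _ = 4 * C₁ * (1 / erwV p n) *
            (((i + 1 : ℕ) : ℝ) ^ (1 / 2 : ℝ) * (((i + 1 : ℕ) : ℝ) ^ 2)⁻¹) := by ring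
        _ = 4 * C₁ * (1 / erwV p n) * Y := by rw [hk]
        _ ≤ _ := by
            have h1 : 0 ≤ 4 * q * Real.exp (1 / 2) * (erwV p n ^ 2 * (n : ℝ) ^ (-κ)) * Y := by
              positivity
            have h2 : 0 ≤ 4 * q * erwV p n ^ 2 *
              (((n : ℝ) ^ 2)⁻¹ * (((n : ℝ) - i) / n) ^ ((r - 4) / 2)) := by positivity
            linarith
    · have hla := hlate (i + 1) n (by omega) hn h
      have hθ : c' * (((n : ℝ) - i) / n) / erwV p n ≤
          (erwV p n - erwV p (i + 1) + erwA p n ^ 2) / erwV p n := by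
        refine div_le_div_of_nonneg_right ?_ hv.le
        have h1 := mul_erwA_sq_le_width hp hi
        have h2 := (hlow n hn).1
        rw [show 3 - 4 * p = 0 by rw [hpe]; norm_num, Real.rpow_zero, mul_one] at h2
        calc c' * (((n : ℝ) - i) / n) = (((n : ℝ) - i) / n) * c / 3 := by rw [hc']; ring
          _ ≤ (((n : ℝ) - i) / n) * (n * erwA p n ^ 2) / 3 := by gcongr
          _ = (((n : ℝ) - i) * erwA p n ^ 2) / 3 := by field_simp
          _ ≤ _ := by linarith
      have hθ' : ((erwV p n - erwV p (i + 1) + erwA p n ^ 2) / erwV p n) ^ ((r - 4) / 2) ≤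
          q * erwV p n ^ 2 * (((n : ℝ) - i) / n) ^ ((r - 4) / 2) := by
        refine (Real.rpow_le_rpow_of_nonpos (by positivity) hθ (by linarith)).trans ?_
        rw [Real.div_rpow (by positivity) hv.le, Real.mul_rpow hc'0.le hτ.le, ← hq, div_eq_mul_inv,
          ← Real.rpow_neg hv.le]
        have : erwV p n ^ (-((r - 4) / 2)) ≤ erwV p n ^ 2 := by
          rw [← Real.rpow_two]
          exact Real.rpow_le_rpow_of_exponent_le hv1n (by linarith)
        calc _ ≤ q * (((n : ℝ) - i) / n) ^ ((r - 4) / 2) * erwV p n ^ 2 := by gcongr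
          _ = _ := by ring
      have hs := split_term hr hr' hi hx0 hx1
      have hk : (((i + 1 : ℕ) : ℝ) ^ 2)⁻¹ = Y * ((i + 1 : ℕ) : ℝ) ^ (-(1 / 2) : ℝ) := by
        rw [hY, ← Real.rpow_add hk0, ← Real.rpow_natCast, ← Real.rpow_neg hk0.le]
        norm_num
      set x := erwV p (i + 1) / erwV p n with hx
      calc x * (((i + 1 : ℕ) : ℝ) ^ 2)⁻¹ *
            ((erwV p n - erwV p (i + 1) + erwA p n ^ 2) / erwV p n) ^ ((r - 4) / 2)
          ≤ x * (((i + 1 : ℕ) : ℝ) ^ 2)⁻¹ *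
            (q * erwV p n ^ 2 * (((n : ℝ) - i) / n) ^ ((r - 4) / 2)) := by gcongr
        _ = q * erwV p n ^ 2 *
            (x * (((i + 1 : ℕ) : ℝ) ^ 2)⁻¹ * (((n : ℝ) - i) / n) ^ ((r - 4) / 2)) := by ring
        _ ≤ q * erwV p n ^ 2 * (4 * (x * (((i + 1 : ℕ) : ℝ) ^ 2)⁻¹) +
          4 * (((n : ℝ) ^ 2)⁻¹ * (((n : ℝ) - i) / n) ^ ((r - 4) / 2))) := by gcongr
        _ ≤ q * erwV p n ^ 2 * (4 * (1 * (Y * (Real.exp (1 / 2) * (n : ℝ) ^ (-κ)))) +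
          4 * (((n : ℝ) ^ 2)⁻¹ * (((n : ℝ) - i) / n) ^ ((r - 4) / 2))) := by
            rw [hk]; gcongr
        _ = 4 * q * Real.exp (1 / 2) * (erwV p n ^ 2 * (n : ℝ) ^ (-κ)) * Y +
          4 * q * erwV p n ^ 2 *
            (((n : ℝ) ^ 2)⁻¹ * (((n : ℝ) - i) / n) ^ ((r - 4) / 2)) := by ring
        _ ≤ _ := by
            have h1 : 0 ≤ 4 * C₁ * (1 / erwV p n) * Y := by positivity
            linarith
  · rw [mul_assoc C₀]
    refine mul_le_mul_of_nonneg_left ?_ hC₀.le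
    have h1 := mul_le_mul_of_nonneg_left hK2 (by positivity : 0 ≤ 4 * q * Real.exp (1 / 2))
    have h2 := mul_le_mul_of_nonneg_left hK3 (by positivity : 0 ≤ 4 * q)
    linarith

theorem exists_sum_erwWeight_le {p r : ℝ} (hp : 0 < p) (hp' : p ≤ 3 / 4) (hr : 0 < r)
    (hr' : r ≤ 2) : ∃ C : ℝ, 0 < C ∧ ∀ n : ℕ, 1 ≤ n →
      ∑ i ∈ Finset.range n, erwWeight p r n i ≤
        C * ((n : ℝ) ^ (-(min r 1 / 2)) + 1 / erwV p n) := by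
  rcases hp'.lt_or_eq with h | rfl
  · exact exists_sum_erwWeight_le_of_lt hp h hr hr'
  · obtain ⟨C, hC, h⟩ := exists_sum_erwWeight_critical_le hr hr'
    refine ⟨C, hC, fun n hn => (h n hn).trans (mul_le_mul_of_nonneg_left ?_ hC.le)⟩
    have : 0 ≤ (n : ℝ) ^ (-(min r 1 / 2)) := by positivity
    linarith

/-! ### Markov property and second moment of the walk with unit steps -/

/-- The position at time n is almost surely at most n in absolute value, so local boundedness
settles integrability. -/
theorem QuadGrowth.exists_bound {h : ℝ → ℝ} (hh : QuadGrowth h) (R : ℝ) :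
    ∃ C, ∀ x, |x| ≤ R → ‖h x‖ ≤ C := by
  obtain ⟨A, hA, hb⟩ := hh.bound
  refine ⟨A * (1 + R ^ 2), fun x hx => (hb x).trans (mul_le_mul_of_nonneg_left ?_ hA)⟩
  have := pow_le_pow_left₀ (abs_nonneg x) hx 2
  rw [sq_abs] at this
  linarith

/-- The position at time `n` of the walk with unit steps. -/
def unitPosition {Ω : Type u} (X : ℕ → Ω → ℝ) (n : ℕ) (ω : Ω) : ℝ := ∑ i : Fin n, X (i + 1) ω

theorem unitPosition_succ {Ω : Type u} (X : ℕ → Ω → ℝ) (n : ℕ) (ω : Ω) :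
    unitPosition X (n + 1) ω = unitPosition X n ω + X (n + 1) ω := by
  simp [unitPosition, Fin.sum_univ_castSucc]

theorem IsElephantWalk.measurable_unitPosition {Ω : Type u} [MeasurableSpace Ω]
    {μ : Measure Ω} {p q : ℝ} {X α : ℕ → Ω → ℝ} {β : ℕ → Ω → ℕ}
    (W : IsElephantWalk μ p q X α β) (n : ℕ) :
    Measurable (unitPosition X n) :=
  Finset.measurable_sum _ fun i _ => W.measurable_X (i + 1) (by omega)

theorem abs_unitPosition_le {Ω : Type u} {X : ℕ → Ω → ℝ} {n : ℕ} {ω : Ω}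
    (h : ∀ j : Fin n, X (j + 1) ω = 1 ∨ X (j + 1) ω = -1) :
    |unitPosition X n ω| ≤ n := by
  refine (Finset.abs_sum_le_sum_abs _ _).trans ?_
  refine (Finset.sum_le_card_nsmul _ _ 1 fun j _ => ?_).trans (by simp)
  rcases h j with h | h <;> rw [h] <;> norm_num

section ElephantWalk

variable {Ω : Type u} [MeasurableSpace Ω] {μ : Measure Ω} [IsProbabilityMeasure μ]

theorem ae_sign_of_measure {Y : Ω → ℝ} (hY : Measurable Y) {q : ℝ} (hq : 0 ≤ q) (hq' : q ≤ 1)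
    (h1 : μ {ω | Y ω = 1} = ENNReal.ofReal q) (h2 : μ {ω | Y ω = -1} = ENNReal.ofReal (1 - q)) :
    ∀ᵐ ω ∂μ, Y ω = 1 ∨ Y ω = -1 := by
  have m1 : MeasurableSet {ω | Y ω = 1} := hY (measurableSet_singleton 1)
  have m2 : MeasurableSet {ω | Y ω = -1} := hY (measurableSet_singleton (-1))
  have hd : Disjoint {ω | Y ω = 1} {ω | Y ω = -1} := by
    rw [Set.disjoint_left]
    intro ω (h : Y ω = 1) (h' : Y ω = -1)
    linarith
  have := measure_union (μ := μ) hd m2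
  rw [h1, h2, ← ENNReal.ofReal_add hq (by linarith), add_sub_cancel, ENNReal.ofReal_one] at this
  exact (prob_compl_eq_zero_iff (m1.union m2)).2 this

variable {p q : ℝ} {X α : ℕ → Ω → ℝ} {β : ℕ → Ω → ℕ}

theorem IsElephantWalk.ae_memory (W : IsElephantWalk μ p q X α β) {n : ℕ} (hn : 1 ≤ n) :
    ∀ᵐ ω ∂μ, ∃ j : Fin n, β (n + 1) ω = j + 1 := by
  have hm : ∀ j : Fin n, MeasurableSet {ω | β (n + 1) ω = (j : ℕ) + 1} := fun j =>
    W.measurable_β n hn (measurableSet_singleton _)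
  have hd : Pairwise (Function.onFun Disjoint fun j : Fin n => {ω | β (n + 1) ω = (j : ℕ) + 1}) := by
    intro i j hij
    rw [Function.onFun, Set.disjoint_left]
    intro ω (h : β (n + 1) ω = (i : ℕ) + 1) (h' : β (n + 1) ω = (j : ℕ) + 1)
    exact hij (Fin.ext (by omega))
  have := measure_iUnion (μ := μ) hd hm
  rw [tsum_fintype, Finset.sum_congr rfl fun (j : Fin n) _ =>
    W.β_unif n hn (j + 1) (by omega) (by omega)] at this
  rw [Finset.sum_const, Finset.card_univ, Fintype.card_fin, nsmul_eq_mul,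
    ENNReal.mul_inv_cancel (by simp; omega) (by simp)] at this
  have := (prob_compl_eq_zero_iff (MeasurableSet.iUnion hm)).2 this
  filter_upwards [show (⋃ j : Fin n, {ω | β (n + 1) ω = (j : ℕ) + 1}) ∈ ae μ from this] with ω hω
  simpa using hω

theorem IsElephantWalk.ae_sign (W : IsElephantWalk μ p q X α β) (hp : 0 ≤ p) (hp' : p ≤ 1)
    (hq : 0 ≤ q) (hq' : q ≤ 1) (n : ℕ) (hn : 1 ≤ n) : ∀ᵐ ω ∂μ, X n ω = 1 ∨ X n ω = -1 := by
  induction n using Nat.strong_induction_on with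
  | _ n ih =>
  rcases hn.eq_or_lt with rfl | h1
  · exact ae_sign_of_measure (W.measurable_X 1 le_rfl) hq hq' W.first_pos W.first_neg
  obtain ⟨m, rfl⟩ : ∃ m, n = m + 1 := ⟨n - 1, by omega⟩
  have hm : 1 ≤ m := by omega
  have hall : ∀ᵐ ω ∂μ, ∀ j : Fin m, X (j + 1) ω = 1 ∨ X (j + 1) ω = -1 :=
    ae_all_iff.2 fun j => ih (j + 1) (by omega) (by omega)
  filter_upwards [hall, W.ae_memory hm, W.step m hm, ae_sign_of_measure (W.measurable_α m hm) hp hp'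
    (W.α_pos m hm) (W.α_neg m hm)] with ω h2 ⟨j, hj⟩ h3 h4
  rw [h3, hj]
  rcases h4 with h4 | h4 <;> rcases h2 j with h5 | h5 <;> rw [h4, h5] <;> norm_num

theorem IsElephantWalk.ae_signs (W : IsElephantWalk μ p q X α β) (hp : 0 ≤ p) (hp' : p ≤ 1)
    (hq : 0 ≤ q) (hq' : q ≤ 1) (n : ℕ) :
    ∀ᵐ ω ∂μ, ∀ j : Fin n, X (j + 1) ω = 1 ∨ X (j + 1) ω = -1 :=
  ae_all_iff.2 fun j => W.ae_sign hp hp' hq hq' (j + 1) (by omega)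

/-- Functions of quadratic growth of the position are integrable. -/
theorem IsElephantWalk.integrable_comp (W : IsElephantWalk μ p q X α β) (hp : 0 ≤ p) (hp' : p ≤ 1)
    (hq : 0 ≤ q) (hq' : q ≤ 1) {h : ℝ → ℝ} (hh : QuadGrowth h) (n : ℕ) :
    Integrable (fun ω => h (unitPosition X n ω)) μ := by
  obtain ⟨C, hC⟩ := hh.exists_bound n
  refine Integrable.of_bound (C := C)
    (hh.1.comp (W.measurable_unitPosition n)).aestronglyMeasurable ?_
  filter_upwards [W.ae_signs hp hp' hq hq' n] with ω hω
  exact hC _ (abs_unitPosition_le hω)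

/-- The Markov property of the position of the walk, in integrated form. -/
theorem IsElephantWalk.integral_succ (W : IsElephantWalk μ p q X α β) (hp : 0 ≤ p) (hp' : p ≤ 1)
    (hq : 0 ≤ q) (hq' : q ≤ 1) {h : ℝ → ℝ} (hh : QuadGrowth h) {n : ℕ} (hn : 1 ≤ n) :
    ∫ ω, h (unitPosition X (n + 1) ω) ∂μ =
      ∫ ω, ((1 + (2 * p - 1) * unitPosition X n ω / n) / 2 * h (unitPosition X n ω + 1) +
        (1 - (2 * p - 1) * unitPosition X n ω / n) / 2 * h (unitPosition X n ω - 1)) ∂μ := by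
  have hn0 : (n : ℝ) ≠ 0 := by positivity
  set π : Ω → Fin n → ℝ := fun ω i => X (i + 1) ω with hπ
  have hπm : Measurable π := measurable_pi_iff.2 fun i => W.measurable_X (i + 1) (by omega)
  have hsm := W.measurable_unitPosition n
  have hαβ : Measurable fun ω => (α (n + 1) ω, β (n + 1) ω) :=
    (W.measurable_α n hn).prodMk (W.measurable_β n hn)
  obtain ⟨C, hC⟩ := hh.exists_bound (n + 1)
  set g : ℝ → Fin n → (Fin n → ℝ) → ℝ := fun e j x => h (∑ i, x i + e * x j) with hg
  have hgm : ∀ e j, Measurable (g e j) := fun e j => hh.1.comp (by fun_prop)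
  set ind : ℝ → Fin n → ℝ × ℕ → ℝ := fun e j => Set.indicator {(e, (j : ℕ) + 1)} 1 with hind
  have hindm : ∀ e j, Measurable (ind e j) := fun e j =>
    measurable_one.indicator (measurableSet_singleton _)
  have hsig := W.ae_signs hp hp' hq hq' n
  have hgb : ∀ e j, |e| = 1 → ∀ᵐ ω ∂μ, ‖g e j (π ω)‖ ≤ C := by
    intro e j he
    filter_upwards [hsig] with ω hω
    refine hC _ ((abs_add_le _ _).trans (add_le_add (abs_unitPosition_le hω) ?_))
    rw [abs_mul, he, one_mul]
    rcases hω j with h | h <;> simp [hπ, h]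
  have hgi : ∀ e j, |e| = 1 → Integrable (fun ω => g e j (π ω)) μ := fun e j he =>
    Integrable.of_bound ((hgm e j).comp hπm).aestronglyMeasurable C (hgb e j he)
  have higi : ∀ e j, |e| = 1 →
      Integrable (fun ω => ind e j (α (n + 1) ω, β (n + 1) ω) * g e j (π ω)) μ := fun e j he =>
    (hgi e j he).bdd_mul (c := 1) ((hindm e j).comp hαβ).aestronglyMeasurable
      (ae_of_all _ fun ω => by
        simp only [hind, Set.indicator]
        split_ifs <;> simp)
  have hprob : ∀ (e r : ℝ) (j : Fin n), 0 ≤ r → μ {ω | α (n + 1) ω = e} = ENNReal.ofReal r →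
      ∫ ω, ind e j (α (n + 1) ω, β (n + 1) ω) * g e j (π ω) ∂μ =
        r / n * ∫ ω, g e j (π ω) ∂μ := by
    intro e r j hr he
    rw [(W.indep_past n hn).integral_fun_comp_mul_comp hαβ.aemeasurable hπm.aemeasurable
      (hindm e j).aestronglyMeasurable (hgm e j).aestronglyMeasurable]
    congr 1
    have hset : (fun ω => ind e j (α (n + 1) ω, β (n + 1) ω)) =
        Set.indicator ((α (n + 1)) ⁻¹' {e} ∩ (β (n + 1)) ⁻¹' {(j : ℕ) + 1}) 1 := by
      funext ω
      simp only [hind, Set.indicator, Set.mem_singleton_iff, Prod.mk.injEq, Set.mem_inter_iff,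
        Set.mem_preimage]
      rfl
    rw [hset, integral_indicator_one ((W.measurable_α n hn (measurableSet_singleton _)).inter
      (W.measurable_β n hn (measurableSet_singleton _))), Measure.real,
      (W.indep_αβ n hn).measure_inter_preimage_eq_mul _ _ (measurableSet_singleton _)
        (measurableSet_singleton _)]
    have h1 : μ ((α (n + 1)) ⁻¹' {e}) = ENNReal.ofReal r := he
    have h2 : μ ((β (n + 1)) ⁻¹' {(j : ℕ) + 1}) = (n : ENNReal)⁻¹ :=
      W.β_unif n hn (j + 1) (by omega) (by omega)
    rw [h1, h2, ENNReal.toReal_mul, ENNReal.toReal_ofReal hr, ENNReal.toReal_inv,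
      ENNReal.toReal_natCast, div_eq_mul_inv]
  have hone : |(1 : ℝ)| = 1 := by norm_num
  have hneg : |(-1 : ℝ)| = 1 := by norm_num
  -- Almost surely exactly one pair (sign, remembered index) occurs, so only one of the indicators
  -- is nonzero.
  have hdecomp : ∀ᵐ ω ∂μ, h (unitPosition X (n + 1) ω) =
      ∑ j, (ind 1 j (α (n + 1) ω, β (n + 1) ω) * g 1 j (π ω) +
        ind (-1) j (α (n + 1) ω, β (n + 1) ω) * g (-1) j (π ω)) := by
    filter_upwards [W.ae_memory hn, W.step n hn, ae_sign_of_measure (W.measurable_α n hn) hp hp'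
      (W.α_pos n hn) (W.α_neg n hn)] with ω ⟨j, hj⟩ h3 h4
    rw [Finset.sum_eq_single j]
    · rw [unitPosition_succ, h3, hj]
      rcases h4 with h4 | h4
      · rw [h4]
        simp [hind, hg, hπ, unitPosition]
        norm_num
      · rw [h4]
        simp [hind, hg, hπ, unitPosition]
        norm_num
    · intro i _ hij
      have : (j : ℕ) ≠ i := fun h => hij (Fin.ext h.symm)
      simp [hind, hj, this]
    · simp
  have hi1 : ∀ j ∈ (Finset.univ : Finset (Fin n)),
      Integrable (fun ω => ind 1 j (α (n + 1) ω, β (n + 1) ω) * g 1 j (π ω) +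
        ind (-1) j (α (n + 1) ω, β (n + 1) ω) * g (-1) j (π ω)) μ := fun j _ =>
    (higi 1 j hone).add (higi (-1) j hneg)
  have hi2 : ∀ j ∈ (Finset.univ : Finset (Fin n)),
      Integrable (fun ω => p / n * g 1 j (π ω) + (1 - p) / n * g (-1) j (π ω)) μ := fun j _ =>
    ((hgi 1 j hone).const_mul _).add ((hgi (-1) j hneg).const_mul _)
  rw [integral_congr_ae hdecomp, integral_finsetSum _ hi1]
  have hj : ∀ j : Fin n, ∫ ω, (ind 1 j (α (n + 1) ω, β (n + 1) ω) * g 1 j (π ω) +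
        ind (-1) j (α (n + 1) ω, β (n + 1) ω) * g (-1) j (π ω)) ∂μ =
      ∫ ω, (p / n * g 1 j (π ω) + (1 - p) / n * g (-1) j (π ω)) ∂μ := fun j => by
    rw [integral_add (higi 1 j hone) (higi (-1) j hneg), hprob 1 p j hp (W.α_pos n hn),
      hprob (-1) (1 - p) j (by linarith) (W.α_neg n hn),
      integral_add ((hgi 1 j hone).const_mul _) ((hgi (-1) j hneg).const_mul _),
      integral_const_mul, integral_const_mul]
  rw [Finset.sum_congr rfl fun j _ => hj j, ← integral_finsetSum _ hi2]
  refine integral_congr_ae ?_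
  filter_upwards [hsig] with ω hω
  set T := unitPosition X n ω with hT
  -- A function of a sign is affine in that sign. Summing over j therefore involves the past only
  -- through T = ∑ X_j, which makes the position alone Markov.
  have hterm : ∀ j : Fin n, p / n * g 1 j (π ω) + (1 - p) / n * g (-1) j (π ω) =
      (h (T + 1) + h (T - 1)) / 2 / n + X (j + 1) ω * ((2 * p - 1) / n * ((h (T + 1) - h (T - 1)) / 2)) := by
    intro j
    have e1 : g 1 j (π ω) = h (T + 1 * X (j + 1) ω) := rfl
    have e2 : g (-1) j (π ω) = h (T + -1 * X (j + 1) ω) := rfl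
    rw [e1, e2]
    rcases hω j with h | h
    · rw [h, mul_one, mul_one, ← sub_eq_add_neg]
      field_simp
      ring
    · rw [h, show T + 1 * -1 = T - 1 by ring, show T + -1 * -1 = T + 1 by ring]
      field_simp
      ring
  rw [Finset.sum_congr rfl fun j _ => hterm j, Finset.sum_add_distrib, ← Finset.sum_mul,
    Finset.sum_const, Finset.card_univ, Fintype.card_fin, nsmul_eq_mul]
  have : ∑ j : Fin n, X (j + 1) ω = T := rfl
  rw [this]
  field_simp
  ring

end ElephantWalk

section ElephantWalk

variable {Ω : Type u} [MeasurableSpace Ω] {μ : Measure Ω} [IsProbabilityMeasure μ]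
variable {p q : ℝ} {X α : ℕ → Ω → ℝ} {β : ℕ → Ω → ℕ}

theorem IsElephantWalk.integral_first (W : IsElephantWalk μ p q X α β)
    (hq : 0 ≤ q) (hq' : q ≤ 1) (h : ℝ → ℝ) :
    ∫ ω, h (unitPosition X 1 ω) ∂μ = q * h 1 + (1 - q) * h (-1) := by
  have hX := W.measurable_X 1 le_rfl
  have m1 : MeasurableSet {ω | X 1 ω = 1} := hX (measurableSet_singleton 1)
  have m2 : MeasurableSet {ω | X 1 ω = -1} := hX (measurableSet_singleton (-1))
  have h1 : (fun ω => h (unitPosition X 1 ω)) =ᵐ[μ]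
      fun ω => Set.indicator {ω | X 1 ω = 1} (fun _ => h 1) ω +
        Set.indicator {ω | X 1 ω = -1} (fun _ => h (-1)) ω := by
    filter_upwards [ae_sign_of_measure hX hq hq' W.first_pos W.first_neg] with ω hω
    have : unitPosition X 1 ω = X 1 ω := by simp [unitPosition]
    rw [this]
    rcases hω with hω | hω
    · simp [Set.indicator, hω]; norm_num
    · simp [Set.indicator, hω]; norm_num
  rw [integral_congr_ae h1, integral_add ((integrable_const _).indicator m1)
    ((integrable_const _).indicator m2), integral_indicator_const _ m1,
    integral_indicator_const _ m2, Measure.real, Measure.real, W.first_pos, W.first_neg,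
    ENNReal.toReal_ofReal hq, ENNReal.toReal_ofReal (by linarith), smul_eq_mul, smul_eq_mul]

/-- The second moment obeys E T_{n+1}² = (1 + 2(2p-1)/n) E T_n² + 1, and a_{n+1}² (1 + (2p-1)/n)² =
a_n². Expanding the last square and dropping ((2p-1)/n)² gives the induction step. -/
theorem IsElephantWalk.mul_integral_sq_le (W : IsElephantWalk μ p q X α β) (hp : 0 < p)
    (hp' : p ≤ 1) (hq : 0 ≤ q) (hq' : q ≤ 1) {n : ℕ} (hn : 1 ≤ n) :
    erwA p n ^ 2 * ∫ ω, unitPosition X n ω ^ 2 ∂μ ≤ erwV p n := by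
  induction n, hn using Nat.le_induction with
  | base =>
    rw [W.integral_first hq hq' (fun x => x ^ 2)]
    simp [erwV, erwA_one hp]
  | succ n hn ih =>
    have hn0 : (0 : ℝ) < n := by exact_mod_cast hn
    have i2 := W.integrable_comp hp.le hp' hq hq' quadGrowth_sq n
    have e : ∫ ω, unitPosition X (n + 1) ω ^ 2 ∂μ =
        (1 + 2 * (2 * p - 1) / n) * ∫ ω, unitPosition X n ω ^ 2 ∂μ + 1 := by
      rw [W.integral_succ hp.le hp' hq hq' quadGrowth_sq hn]
      have : ∀ T : ℝ, (1 + (2 * p - 1) * T / n) / 2 * (T + 1) ^ 2 +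
          (1 - (2 * p - 1) * T / n) / 2 * (T - 1) ^ 2 = (1 + 2 * (2 * p - 1) / n) * T ^ 2 + 1 :=
        fun T => by ring
      simp only [this]
      rw [integral_add (i2.const_mul _) (integrable_const _), integral_const_mul]
      simp
    set I := ∫ ω, unitPosition X n ω ^ 2 ∂μ with hI
    have hI0 : 0 ≤ I := integral_nonneg fun ω => sq_nonneg _
    rw [e, erwV_succ]
    have h1 : erwA p (n + 1) ^ 2 * (1 + (2 * p - 1) / n) ^ 2 = erwA p n ^ 2 := by
      have := erwA_succ hp hn
      rw [← mul_pow]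
      congr 1
      field_simp
      linarith
    have h2 : erwA p (n + 1) ^ 2 * (1 + 2 * (2 * p - 1) / n) ≤ erwA p n ^ 2 := by
      rw [← h1]
      refine mul_le_mul_of_nonneg_left ?_ (sq_nonneg _)
      have : (1 + (2 * p - 1) / n) ^ 2 = 1 + 2 * (2 * p - 1) / n + ((2 * p - 1) / n) ^ 2 := by ring
      rw [this]
      linarith [sq_nonneg ((2 * p - 1) / n)]
    nlinarith [mul_le_mul_of_nonneg_right h2 hI0]

/-- The mean of the next step given the present, in squared and weighted form. -/
theorem IsElephantWalk.mul_integral_drift_sq_le (W : IsElephantWalk μ p q X α β) (hp : 0 < p)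
    (hp' : p ≤ 3 / 4) (hq : 0 ≤ q) (hq' : q ≤ 1) {n : ℕ} (hn : 1 ≤ n) :
    erwA p (n + 1) ^ 2 * ∫ ω, ((2 * p - 1) * unitPosition X n ω / n) ^ 2 ∂μ ≤
      4 / p ^ 2 * (erwV p (n + 1) / ((n + 1 : ℕ) : ℝ) ^ 2) := by
  have hn1 : (1 : ℝ) ≤ n := by exact_mod_cast hn
  have h0 := W.mul_integral_sq_le hp (by linarith) hq hq' hn
  have e1 : ∀ T : ℝ, ((2 * p - 1) * T / n) ^ 2 = ((2 * p - 1) / n) ^ 2 * T ^ 2 := fun T => by ring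
  simp only [e1]
  rw [integral_const_mul]
  set I := ∫ ω, unitPosition X n ω ^ 2 ∂μ with hI
  have hI0 : 0 ≤ I := integral_nonneg fun ω => sq_nonneg _
  have hd : 0 < (n : ℝ) + 2 * p - 1 := by linarith
  have e2 : erwA p (n + 1) = n * erwA p n / (n + 2 * p - 1) := by
    rw [eq_div_iff hd.ne', erwA_succ hp hn]
  -- This replaces n + 2p - 1 by a multiple of n + 1 also at n = 1, where it equals 2p; hence the
  -- constant 4/p².
  have h2 : p * ((n + 1 : ℕ) : ℝ) / 2 ≤ n + 2 * p - 1 := by push_cast; nlinarith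
  have h3 : (2 * p - 1) ^ 2 ≤ 1 := by nlinarith
  have hv := erwV_mono p (Nat.le_succ n)
  have hv0 : 0 ≤ erwV p n := (one_le_erwV hp hn).trans' zero_le_one
  calc erwA p (n + 1) ^ 2 * (((2 * p - 1) / n) ^ 2 * I)
      = (2 * p - 1) ^ 2 * (erwA p n ^ 2 * I) / (n + 2 * p - 1) ^ 2 := by
        rw [e2]; field_simp
    _ ≤ 1 * erwV p n / (p * ((n + 1 : ℕ) : ℝ) / 2) ^ 2 := by
        have : 0 ≤ erwA p n ^ 2 * I := by positivity
        gcongr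
    _ ≤ 1 * erwV p (n + 1) / (p * ((n + 1 : ℕ) : ℝ) / 2) ^ 2 := by gcongr
    _ = _ := by field_simp; norm_num

end ElephantWalk

/-! ### The central limit theorem for the martingale of the walk -/

/-- Both error terms are expressed through U^((r-4)/2), where U is the remaining variance plus a_n².
In the first, U ≤ 2 v_n gives the factor 2; in the second, the square of a_k² ≤ 3 v_k/k gives 9. -/
theorem remaining_rpow_le {p r : ℝ} (hp : 0 < p) (hr' : r ≤ 2) {n i : ℕ} (hi : i < n)
    {s D : ℝ} (hD : 0 ≤ D) (hs : 0 < s)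
    (hsU : erwV p n - erwV p (i + 1) + erwA p n ^ 2 ≤ s ^ 2) :
    D * (erwV p (i + 1) / ((i + 1 : ℕ) : ℝ) ^ 2) * s ^ (r - 2) + erwA p (i + 1) ^ 4 * s ^ (r - 4) ≤
      (2 * D + 9) * erwV p n ^ (r / 2) * erwWeight p r n i := by
  have hn : 1 ≤ n := by omega
  set U := erwV p n - erwV p (i + 1) + erwA p n ^ 2 with hU
  have ha := erwA_pos hp hn
  have hv : 0 < erwV p n := one_pos.trans_le (one_le_erwV hp hn)
  have hvi : 0 < erwV p (i + 1) := one_pos.trans_le (one_le_erwV hp (by omega))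
  have hvm := erwV_mono p hi
  have hU0 : 0 < U := by
    have : 0 < erwA p n ^ 2 := by positivity
    simp only [Nat.succ_eq_add_one] at hvm
    linarith
  have hU2 : U ≤ 2 * erwV p n := by linarith [erwA_sq_le_erwV (p := p) hn]
  have hsq : ∀ e : ℝ, s ^ e = (s ^ 2) ^ (e / 2) := fun e => by
    rw [← Real.rpow_natCast s 2, ← Real.rpow_mul hs.le]; congr 1; push_cast; ring
  set Y := U ^ ((r - 4) / 2) with hY
  have hY0 : 0 < Y := Real.rpow_pos_of_pos hU0 _
  have h4 : s ^ (r - 4) ≤ Y := by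
    rw [hsq]; exact Real.rpow_le_rpow_of_nonpos hU0 hsU (by linarith)
  have h2 : s ^ (r - 2) ≤ 2 * erwV p n * Y := by
    rw [hsq]
    refine (Real.rpow_le_rpow_of_nonpos hU0 hsU (by linarith)).trans ?_
    have : U ^ ((r - 2) / 2) = U * Y := by
      rw [show (r - 2) / 2 = 1 + (r - 4) / 2 by ring, Real.rpow_add hU0, Real.rpow_one]
    rw [this]
    gcongr
  have ha4 : erwA p (i + 1) ^ 4 ≤ 9 * (erwV p (i + 1) / ((i + 1 : ℕ) : ℝ) ^ 2) * erwV p n := by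
    have h := mul_erwA_sq_le hp (n := i + 1) (by omega)
    have h' : erwA p (i + 1) ^ 2 ≤ 3 * erwV p (i + 1) / (i + 1 : ℕ) := by
      rw [le_div_iff₀ (by positivity)]; linarith
    calc erwA p (i + 1) ^ 4 = (erwA p (i + 1) ^ 2) ^ 2 := by ring
      _ ≤ (3 * erwV p (i + 1) / (i + 1 : ℕ)) ^ 2 := pow_le_pow_left₀ (by positivity) h' 2
      _ = 9 * (erwV p (i + 1) / ((i + 1 : ℕ) : ℝ) ^ 2) * erwV p (i + 1) := by
          rw [div_pow]; ring
      _ ≤ _ := by gcongr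
  have e : erwV p n ^ (r / 2) * erwWeight p r n i =
      erwV p (i + 1) / ((i + 1 : ℕ) : ℝ) ^ 2 * erwV p n * Y := by
    unfold erwWeight
    rw [← hU, Real.div_rpow hU0.le hv.le, ← hY, show r / 2 = (r - 4) / 2 + 2 by ring,
      Real.rpow_add hv, Real.rpow_two]
    have : erwV p n ^ ((r - 4) / 2) ≠ 0 := (Real.rpow_pos_of_pos hv _).ne'
    field_simp
  rw [mul_assoc (2 * D + 9), e]
  calc _ ≤ D * (erwV p (i + 1) / ((i + 1 : ℕ) : ℝ) ^ 2) * (2 * erwV p n * Y) +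
        9 * (erwV p (i + 1) / ((i + 1 : ℕ) : ℝ) ^ 2) * erwV p n * Y := by gcongr
    _ = _ := by ring

/-- This is n a_n² ≤ 3 v_n raised to the power r/2. It converts every cost a_n^r into the factor
n^(-r/2) of the final rate. -/
theorem erwA_rpow_le {p r : ℝ} (hp : 0 < p) (hr : 0 < r) (hr' : r ≤ 2) {n : ℕ} (hn : 1 ≤ n) :
    erwA p n ^ r ≤ 3 * erwV p n ^ (r / 2) * (n : ℝ) ^ (-(r / 2)) := by
  have hn0 : (0 : ℝ) < n := by exact_mod_cast hn
  have ha := erwA_pos hp hn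
  have hv : 0 < erwV p n := one_pos.trans_le (one_le_erwV hp hn)
  have h1 : erwA p n ^ 2 ≤ 3 * erwV p n / n := by
    rw [le_div_iff₀ hn0]; linarith [mul_erwA_sq_le hp hn]
  have h2 : erwA p n ^ r = (erwA p n ^ 2) ^ (r / 2) := by
    rw [← Real.rpow_natCast _ 2, ← Real.rpow_mul ha.le]; congr 1; push_cast; ring
  rw [h2]
  refine (Real.rpow_le_rpow (by positivity) h1 (by positivity)).trans ?_
  rw [Real.div_rpow (by positivity) hn0.le, Real.mul_rpow (by norm_num) hv.le, div_eq_mul_inv,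
    ← Real.rpow_neg hn0.le]
  have : (3 : ℝ) ^ (r / 2) ≤ 3 := by
    calc (3 : ℝ) ^ (r / 2) ≤ 3 ^ (1 : ℝ) := Real.rpow_le_rpow_of_exponent_le (by norm_num) (by linarith)
      _ = 3 := Real.rpow_one 3
  gcongr

/-- Rate of convergence in the central limit theorem for the martingale attached to the walk, with
an independent Gaussian perturbation of variance `w`. -/
theorem exists_elephantWalk_clt {p r : ℝ} (hp : 0 < p) (hp' : p ≤ 3 / 4) (hr : 0 < r)
    (hr' : r ≤ 2) : ∃ C : ℝ, 0 < C ∧ ∀ (q : ℝ), 0 ≤ q → q ≤ 1 → ∀ (Ω : Type u) [MeasurableSpace Ω]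
      (μ : Measure Ω) [IsProbabilityMeasure μ] (X α : ℕ → Ω → ℝ) (β : ℕ → Ω → ℕ),
      IsElephantWalk μ p q X α β → ∀ (n : ℕ), 1 ≤ n → ∀ (B : ℝ) (f : ℝ → ℝ), HolderTaylor r B f →
      ∀ (w V : NNReal), (V : ℝ) = erwV p n →
      |∫ ω, gaussAvg w f (erwA p n * unitPosition X n ω - (2 * q - 1)) ∂μ - gaussAvg (w + V) f 0| ≤
        C * B * erwV p n ^ (r / 2) * ((n : ℝ) ^ (-(min r 1 / 2)) + 1 / erwV p n) := by
  obtain ⟨K, hK, hstep⟩ := exists_twoPoint_step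
  obtain ⟨C₁, hC₁, hsum⟩ := exists_sum_erwWeight_le hp hp' hr hr'
  -- The first summand comes from the drift estimate; the 1 covers the first step, where v_1 = 1 has
  -- to dominate (2q-1)² ≤ 1.
  set D : ℝ := 4 / p ^ 2 + 1 with hD
  have hD0 : 0 < D := by positivity
  refine ⟨K * (2 * D + 9) * C₁ + 12, by positivity, ?_⟩
  intro q hq hq' Ω _ μ _ X α β W n hn B f hf w V hV
  have hB := hf.nonneg
  have hfq := hf.quadGrowth hr.le hr'
  have ha := erwA_pos hp hn
  have hp1 : p ≤ 1 := by linarith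
  have hv : 0 < erwV p n := one_pos.trans_le (one_le_erwV hp hn)
  -- The additional a_n² keeps the smoothing positive up to the last step; removing it at both ends
  -- costs multiples of a_n^r.
  set U : ℕ → ℝ := fun k => erwV p n - erwV p k + erwA p n ^ 2 with hU
  have hU0 : ∀ k ≤ n, 0 < U k := fun k hk => by
    have := erwV_mono p hk
    have : 0 < erwA p n ^ 2 := by positivity
    simp only [hU]; linarith
  set S : ℕ → NNReal := fun k => w + (U k).toNNReal with hS
  have hSc : ∀ k ≤ n, ((S k : NNReal) : ℝ) = w + U k := fun k hk => by
    simp [hS, Real.coe_toNNReal _ (hU0 k hk).le]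
  -- At k = 0 the martingale starts at 0, whereas a_0 T_0 - (2q-1) would give -(2q-1), so this case
  -- is set apart.
  set Φ : ℕ → ℝ := fun k => if k = 0 then gaussAvg (S 0) f 0 else
    ∫ ω, gaussAvg (S k) f (erwA p k * unitPosition X k ω - (2 * q - 1)) ∂μ with hΦ
  have hone : ∀ i ∈ Finset.range n, |Φ (i + 1) - Φ i| ≤
      K * B * ((2 * D + 9) * erwV p n ^ (r / 2) * erwWeight p r n i) := by
    intro i hi
    have hin := Finset.mem_range.1 hi
    have hin1 : i + 1 ≤ n := hin
    set s := Real.sqrt (S (i + 1)) with hs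
    have hS1 := hSc (i + 1) hin
    have hSpos : (0 : ℝ) < S (i + 1) := by
      rw [hS1]; have := hU0 (i + 1) hin; positivity
    have hs0 : 0 < s := Real.sqrt_pos.2 hSpos
    have hs2 : ((S (i + 1) : NNReal) : ℝ) = s ^ 2 := (Real.sq_sqrt hSpos.le).symm
    have hsU : U (i + 1) ≤ s ^ 2 := by
      rw [← hs2, hS1]; linarith [w.coe_nonneg]
    set a := erwA p (i + 1) with hadef
    have ha0 : 0 < a := erwA_pos hp (by omega)
    have hST : S i = (a ^ 2).toNNReal + S (i + 1) := by
      apply NNReal.coe_injective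
      rw [hSc i (by omega), NNReal.coe_add, hS1, Real.coe_toNNReal _ (sq_nonneg a)]
      simp only [hU, erwV_succ]
      ring
    have htp := hstep r B hr.le hr' f hf s (S (i + 1)) hs0 hs2 a
    have hwa : (((a ^ 2).toNNReal : NNReal) : ℝ) = a ^ 2 := Real.coe_toNNReal _ (sq_nonneg a)
    have hfin := remaining_rpow_le hp hr' hin hD0.le hs0 hsU (D := D)
    rw [← hadef] at hfin
    have hKB : 0 ≤ K * B := by positivity
    have hgq := hfq.gaussAvg (S (i + 1))
    rcases Nat.eq_zero_or_pos i with rfl | hi0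
    -- The first step is a sign of mean 2q - 1 with coefficient a_1 = 1, so the two-point comparison
    -- applies with m = 2q - 1.
    · have ha1 : a = 1 := erwA_one hp
      have h1 := htp (2 * q - 1) _ hwa (by rw [abs_le]; constructor <;> linarith) 0
      have e0 : Φ 0 = gaussAvg (a ^ 2).toNNReal (gaussAvg (S (0 + 1)) f) 0 := by
        simp only [hΦ, if_true]
        rw [gaussAvg_gaussAvg _ _ hfq, ← hST]
      have e1 : Φ (0 + 1) = (1 + (2 * q - 1)) / 2 * gaussAvg (S (0 + 1)) f (0 + a * (1 - (2 * q - 1)))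
          + (1 - (2 * q - 1)) / 2 * gaussAvg (S (0 + 1)) f (0 + a * (-1 - (2 * q - 1))) := by
        simp only [hΦ, zero_add, one_ne_zero, if_false]
        rw [W.integral_first hq hq' (fun x => gaussAvg (S 1) f (erwA p 1 * x - (2 * q - 1))),
          show erwA p 1 = 1 from ha1, ha1]
        congr 1
        · congr 1
          · ring
          · congr 1; ring
        · congr 1
          · ring
          · congr 1; ring
      rw [e0, e1]
      refine h1.trans (mul_le_mul_of_nonneg_left (le_trans ?_ hfin) hKB)
      refine add_le_add (mul_le_mul_of_nonneg_right ?_ (Real.rpow_nonneg hs0.le _)) le_rfl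
      have hm : (2 * q - 1) ^ 2 ≤ 1 := by nlinarith
      have hv1 : erwV p (0 + 1) = 1 := by simp [erwV, erwA_one hp]
      rw [ha1, hv1]
      have : 1 ≤ D := by rw [hD]; have : 0 < 4 / p ^ 2 := by positivity
                         linarith
      norm_num
      linarith
    · have hi1 : 1 ≤ i := hi0
      have hiR : (1 : ℝ) ≤ i := by exact_mod_cast hi1
      have hi00 : (i : ℝ) ≠ 0 := by positivity
      have hrec := erwA_succ hp hi1
      rw [← hadef] at hrec
      set m : Ω → ℝ := fun ω => (2 * p - 1) * unitPosition X i ω / i with hm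
      set Mi : Ω → ℝ := fun ω => erwA p i * unitPosition X i ω - (2 * q - 1) with hMi
      have hcomp := hgq.comp_affine a (-(2 * q - 1))
      simp only [← sub_eq_add_neg] at hcomp
      have e1 : Φ (i + 1) = ∫ ω, ((1 + m ω) / 2 * gaussAvg (S (i + 1)) f (Mi ω + a * (1 - m ω)) +
          (1 - m ω) / 2 * gaussAvg (S (i + 1)) f (Mi ω + a * (-1 - m ω))) ∂μ := by
        simp only [hΦ, Nat.succ_ne_zero, if_false]
        rw [W.integral_succ hp.le hp1 hq hq' hcomp hi1]
        refine integral_congr_ae (ae_of_all _ fun ω => ?_)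
        -- The recursion for the coefficients says a_{i+1} (T_i + m_i) = a_i T_i, which is the
        -- martingale property.
        have k1 : a * (unitPosition X i ω + 1) - (2 * q - 1) = Mi ω + a * (1 - m ω) := by
          simp only [hm, hMi]
          field_simp
          linear_combination (unitPosition X i ω) * hrec
        have k2 : a * (unitPosition X i ω - 1) - (2 * q - 1) = Mi ω + a * (-1 - m ω) := by
          simp only [hm, hMi]
          field_simp
          linear_combination (unitPosition X i ω) * hrec
        simp only [k1, k2, hm]
      have e0 : Φ i = ∫ ω, gaussAvg (a ^ 2).toNNReal (gaussAvg (S (i + 1)) f) (Mi ω) ∂μ := by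
        simp only [hΦ, hi0.ne', if_false]
        rw [gaussAvg_gaussAvg _ _ hfq, ← hST]
      have hmsm : Measurable m := ((W.measurable_unitPosition i).const_mul _).div_const _
      have hMim : Measurable Mi := ((W.measurable_unitPosition i).const_mul _).sub_const _
      have hsg := W.ae_signs hp.le hp1 hq hq' i
      have hm1 : ∀ᵐ ω ∂μ, |m ω| ≤ 1 := by
        filter_upwards [hsg] with ω hω
        have := abs_unitPosition_le hω
        simp only [hm]
        rw [abs_div, abs_mul, Nat.abs_cast, div_le_one (by positivity)]
        have h2 : |2 * p - 1| ≤ 1 := by rw [abs_le]; constructor <;> linarith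
        calc _ ≤ 1 * (i : ℝ) := mul_le_mul h2 this (abs_nonneg _) zero_le_one
          _ = i := one_mul _
      have hMb : ∀ᵐ ω ∂μ, |Mi ω| ≤ erwA p i * i + 1 := by
        filter_upwards [hsg] with ω hω
        have h1 := abs_unitPosition_le hω
        have h2 : |2 * q - 1| ≤ 1 := by rw [abs_le]; constructor <;> linarith
        refine (abs_sub _ _).trans (add_le_add ?_ h2)
        rw [abs_mul, abs_of_pos (erwA_pos hp hi1)]
        exact mul_le_mul_of_nonneg_left h1 (erwA_pos hp hi1).le
      have hint : ∀ {g : ℝ → ℝ}, QuadGrowth g → ∀ {Y : Ω → ℝ}, Measurable Y → ∀ R : ℝ,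
          (∀ᵐ ω ∂μ, |Y ω| ≤ R) → Integrable (fun ω => g (Y ω)) μ := by
        intro g hg Y hY R hR
        obtain ⟨C, hC⟩ := hg.exists_bound R
        refine Integrable.of_bound (hg.1.comp hY).aestronglyMeasurable C ?_
        filter_upwards [hR] with ω hω using hC _ hω
      have hbm : ∀ (e : ℝ), |e| = 1 → ∀ᵐ ω ∂μ, |Mi ω + a * (e - m ω)| ≤
          erwA p i * i + 1 + a * 2 := by
        intro e he
        filter_upwards [hm1, hMb] with ω h1 h2
        refine (abs_add_le _ _).trans (add_le_add h2 ?_)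
        rw [abs_mul, abs_of_pos ha0]
        refine mul_le_mul_of_nonneg_left ((abs_sub _ _).trans ?_) ha0.le
        rw [he]; linarith
      have hI : ∀ e : ℝ, |e| = 1 → Integrable (fun ω => (1 + e * m ω) / 2 *
          gaussAvg (S (i + 1)) f (Mi ω + a * (e - m ω))) μ := by
        intro e he
        refine (hint hgq (hMim.add ((hmsm.const_sub e).const_mul a)) _ (hbm e he)).bdd_mul (c := 1)
          ((((hmsm.const_mul e).const_add 1).div_const 2).aestronglyMeasurable) ?_
        filter_upwards [hm1] with ω h1
        rw [Real.norm_eq_abs, abs_div, abs_of_pos (by norm_num : (0 : ℝ) < 2), div_le_one (by norm_num)]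
        refine (abs_add_le _ _).trans ?_
        rw [abs_mul, he, abs_one]; linarith
      have hI1 := hI 1 (by norm_num)
      have hI2 := hI (-1) (by norm_num)
      simp only [one_mul, neg_mul, ← sub_eq_add_neg] at hI1 hI2
      have hI3 : Integrable (fun ω => gaussAvg (a ^ 2).toNNReal (gaussAvg (S (i + 1)) f) (Mi ω)) μ :=
        hint (hgq.gaussAvg _) hMim _ hMb
      have hI4 : Integrable (fun ω => m ω ^ 2) μ := hint quadGrowth_sq hmsm 1 hm1
      have hI12 : Integrable (fun ω => (1 + m ω) / 2 *
          gaussAvg (S (i + 1)) f (Mi ω + a * (1 - m ω)) +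
          (1 - m ω) / 2 * gaussAvg (S (i + 1)) f (Mi ω + a * (-1 - m ω))) μ := hI1.add hI2
      have hI5 : Integrable (fun ω => a ^ 2 * s ^ (r - 2) * m ω ^ 2) μ := hI4.const_mul _
      have hdiff : |Φ (i + 1) - Φ i| ≤ ∫ ω, K * B * (a ^ 2 * s ^ (r - 2) * m ω ^ 2 +
          a ^ 4 * s ^ (r - 4)) ∂μ := by
        rw [e1, e0, ← integral_sub hI12 hI3]
        refine abs_integral_le_integral_abs.trans (integral_mono_ae (hI12.sub hI3).abs
          ((hI5.add (integrable_const _)).const_mul _) ?_)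
        filter_upwards [hm1] with ω h1
        refine (htp (m ω) _ hwa h1 (Mi ω)).trans (le_of_eq ?_)
        ring
      have hdrift := W.mul_integral_drift_sq_le hp hp' hq hq' hi1
      rw [← hadef] at hdrift
      rw [integral_const_mul, integral_add hI5 (integrable_const _),
        integral_const_mul] at hdiff
      simp only [integral_const, probReal_univ, one_smul] at hdiff
      refine hdiff.trans (mul_le_mul_of_nonneg_left (le_trans ?_ hfin) hKB)
      have hx : 0 ≤ erwV p (i + 1) / ((i + 1 : ℕ) : ℝ) ^ 2 := by
        have := one_le_erwV hp (n := i + 1) (by omega)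
        positivity
      have h5 : a ^ 2 * ∫ ω, m ω ^ 2 ∂μ ≤ D * (erwV p (i + 1) / ((i + 1 : ℕ) : ℝ) ^ 2) := by
        refine hdrift.trans ?_
        rw [hD]
        linarith
      have h6 := mul_le_mul_of_nonneg_right h5 (Real.rpow_nonneg hs0.le (r - 2))
      linarith
  have hΦn : |Φ n - Φ 0| ≤ K * B * (2 * D + 9) * erwV p n ^ (r / 2) *
      (C₁ * ((n : ℝ) ^ (-(min r 1 / 2)) + 1 / erwV p n)) := by
    rw [← Finset.sum_range_sub]
    refine (Finset.abs_sum_le_sum_abs _ _).trans ((Finset.sum_le_sum hone).trans ?_)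
    rw [← Finset.mul_sum, ← Finset.mul_sum, ← mul_assoc, ← mul_assoc]
    exact mul_le_mul_of_nonneg_left (hsum n hn) (by positivity)
  have hwn : ((((erwA p n) ^ 2).toNNReal : NNReal) : ℝ) = erwA p n ^ 2 :=
    Real.coe_toNNReal _ (sq_nonneg _)
  have hend := fun x => hf.abs_gaussAvg_sub_le hr.le hr' ha.le hwn x
  have hpt : ∀ (v : NNReal) (x : ℝ), |gaussAvg (v + (erwA p n ^ 2).toNNReal) f x - gaussAvg v f x| ≤
      2 * B * erwA p n ^ r := by
    intro v x
    rw [← gaussAvg_gaussAvg _ _ hfq]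
    exact abs_avg_sub_avg_le (sqProb_gaussianReal _ _) (hfq.gaussAvg _) hfq hend x
  have hend0 : |Φ 0 - gaussAvg (w + V) f 0| ≤ 2 * B * erwA p n ^ r := by
    have : Φ 0 = gaussAvg (w + V + (erwA p n ^ 2).toNNReal) f 0 := by
      simp only [hΦ, if_true]
      congr 2
      ext
      rw [hSc 0 (by omega), NNReal.coe_add, NNReal.coe_add, hwn, hV]
      simp only [hU, erwV_zero]
      ring
    rw [this]
    exact hpt _ _
  have hendn : |Φ n - ∫ ω, gaussAvg w f (erwA p n * unitPosition X n ω - (2 * q - 1)) ∂μ| ≤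
      2 * B * erwA p n ^ r := by
    have hc : ∀ v : NNReal, Integrable
        (fun ω => gaussAvg v f (erwA p n * unitPosition X n ω - (2 * q - 1))) μ := fun v => by
      have := (hfq.gaussAvg v).comp_affine (erwA p n) (-(2 * q - 1))
      simp only [← sub_eq_add_neg] at this
      exact W.integrable_comp hp.le hp1 hq hq' this n
    have : Φ n = ∫ ω, gaussAvg (w + (erwA p n ^ 2).toNNReal) f
        (erwA p n * unitPosition X n ω - (2 * q - 1)) ∂μ := by
      simp only [hΦ]
      rw [if_neg (by omega)]
      simp only [hS, hU, sub_self, zero_add]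
    rw [this, ← integral_sub (hc _) (hc _)]
    refine abs_integral_le_integral_abs.trans ((integral_mono ((hc _).sub (hc _)).abs
      (integrable_const _) fun ω => hpt w _).trans ?_)
    simp
  have hA := erwA_rpow_le hp hr hr' hn
  have hn1 : (1 : ℝ) ≤ n := by exact_mod_cast hn
  have hpow : (n : ℝ) ^ (-(r / 2)) ≤ (n : ℝ) ^ (-(min r 1 / 2)) :=
    Real.rpow_le_rpow_of_exponent_le hn1 (by linarith [min_le_left r 1])
  set Y := (n : ℝ) ^ (-(min r 1 / 2)) with hY
  set E := erwV p n ^ (r / 2) with hE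
  have hE0 : 0 ≤ E := by positivity
  have hinv : 0 < 1 / erwV p n := by positivity
  have hA2 : B * erwA p n ^ r ≤ 3 * B * E * (Y + 1 / erwV p n) := by
    calc B * erwA p n ^ r ≤ B * (3 * E * (n : ℝ) ^ (-(r / 2))) := by gcongr
      _ ≤ B * (3 * E * (Y + 1 / erwV p n)) := by
          have : (n : ℝ) ^ (-(r / 2)) ≤ Y + 1 / erwV p n := by linarith
          gcongr
      _ = _ := by ring
  have htri : |∫ ω, gaussAvg w f (erwA p n * unitPosition X n ω - (2 * q - 1)) ∂μ -
      gaussAvg (w + V) f 0| ≤ K * B * (2 * D + 9) * E * (C₁ * (Y + 1 / erwV p n)) +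
        4 * (B * erwA p n ^ r) := by
    obtain ⟨l1, u1⟩ := abs_le.1 hΦn
    obtain ⟨l2, u2⟩ := abs_le.1 hend0
    obtain ⟨l3, u3⟩ := abs_le.1 hendn
    rw [abs_le]
    constructor <;> linarith
  refine htri.trans ?_
  linarith

/-! ### Zolotarev's test functions -/

/-- For r ≤ 2 only l = 0 and l = 1 occur. In the first case the linear coefficient is 0; in the
second it is f'(x), and the mean value inequality bounds the remainder by |y|^(r-1)|y|. -/
theorem holderTaylor_of_mem_zolotarevClass {r : ℝ} (hr : 0 < r) (hr' : r ≤ 2) {f : ℝ → ℝ}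
    (hf : f ∈ zolotarevClass r) : HolderTaylor r 1 f := by
  obtain ⟨l, hl, hl', hc, hH⟩ := hf
  refine ⟨hc.continuous.measurable, fun x => ?_⟩
  have hl2 : l < 2 := by
    have : (l : ℝ) < 2 := hl.trans_le hr'
    exact_mod_cast this
  interval_cases l
  · refine ⟨0, fun y => ?_⟩
    simpa using hH (x + y) x
  · simp only [iteratedDeriv_one, Nat.cast_one] at hH hl
    have hd : Differentiable ℝ f := hc.differentiable (by simp)
    refine ⟨deriv f x, fun y => ?_⟩
    have h1 : ∀ z ∈ Set.uIcc x (x + y), |deriv f z - deriv f x| ≤ |y| ^ (r - 1) := fun z hz => by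
      refine (hH z x).trans (Real.rpow_le_rpow (abs_nonneg _) ?_ (by linarith))
      simpa using Set.abs_sub_left_of_mem_uIcc hz
    have h2 := (convex_uIcc x (x + y)).norm_image_sub_le_of_norm_hasDerivWithin_le
      (f := fun z => f z - deriv f x * z) (f' := fun z => deriv f z - deriv f x)
      (fun z _ => ((hd z).hasDerivAt.sub
        (by simpa using (hasDerivAt_id z).const_mul (deriv f x))).hasDerivWithinAt)
      h1 Set.left_mem_uIcc Set.right_mem_uIcc
    have h3 : |y| ^ (r - 1) * |y| ≤ 1 * |y| ^ r := by
      rcases eq_or_ne y 0 with rfl | hy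
      · simp [Real.zero_rpow hr.ne']
      · have h := Real.rpow_add_one (abs_pos.2 hy).ne' (r - 1)
        rw [sub_add_cancel] at h
        rw [h, one_mul]
    refine le_trans (le_of_eq ?_) (h2.trans (le_trans (le_of_eq ?_) h3))
    · rw [Real.norm_eq_abs]; congr 1; ring
    · rw [Real.norm_eq_abs]; congr 2; ring

/-! ### Replacement of the random step sizes by a Gaussian -/

theorem measurable_sum_range {Ω : Type u} [MeasurableSpace Ω] {Y : ℕ → Ω → ℝ}
    (hm : ∀ k, Measurable (Y k)) (n : ℕ) : Measurable (∑ k ∈ Finset.range n, Y k) := by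
  rw [Finset.sum_fn]
  exact Finset.measurable_sum _ fun k _ => hm k

section Independence

variable {Ω : Type u} [MeasurableSpace Ω] {μ : Measure Ω} [IsProbabilityMeasure μ]

theorem map_sum_range_eq_convLaw {Y : ℕ → Ω → ℝ} (hY : iIndepFun Y μ) (hm : ∀ k, Measurable (Y k))
    (n : ℕ) : μ.map (∑ k ∈ Finset.range n, Y k) = convLaw (fun k => μ.map (Y k)) n := by
  induction n with
  | zero =>
    simp only [Finset.range_zero, Finset.sum_empty, convLaw]
    rw [show (0 : Ω → ℝ) = fun _ => 0 from rfl, Measure.map_const, measure_univ, one_smul]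
  | succ n ih =>
    rw [Finset.sum_range_succ, (hY.indepFun_sum_range_succ hm n).map_add_eq_map_conv_map
      (measurable_sum_range hm n) (hm n), ih]
    rfl

/-- Fubini for a function of two independent variables. -/
theorem IndepFun.integral_comp_eq {E F : Type*} [MeasurableSpace E] [MeasurableSpace F]
    {U : Ω → E} {V : Ω → F} (hUV : IndepFun U V μ) (hU : Measurable U) (hV : Measurable V)
    {G : E × F → ℝ} (hG : Measurable G) (hi : Integrable (fun ω => G (U ω, V ω)) μ) :
    Integrable (fun ω => ∫ ω', G (U ω, V ω') ∂μ) μ ∧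
      ∫ ω, G (U ω, V ω) ∂μ = ∫ ω, ∫ ω', G (U ω, V ω') ∂μ ∂μ := by
  have hP := (indepFun_iff_map_prod_eq_prod_map_map hU.aemeasurable hV.aemeasurable).1 hUV
  have := Measure.isProbabilityMeasure_map (μ := μ) hU.aemeasurable
  have := Measure.isProbabilityMeasure_map (μ := μ) hV.aemeasurable
  have hi' : Integrable G ((μ.map U).prod (μ.map V)) := by
    rw [← hP, integrable_map_measure hG.aestronglyMeasurable (hU.prodMk hV).aemeasurable]
    exact hi
  have hin : ∀ u, ∫ v, G (u, v) ∂μ.map V = ∫ ω', G (u, V ω') ∂μ := fun u =>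
    integral_map hV.aemeasurable (hG.comp measurable_prodMk_left).aestronglyMeasurable
  have hi2 := hi'.integral_prod_left
  have hm : AEStronglyMeasurable (fun u => ∫ v, G (u, v) ∂μ.map V) (μ.map U) :=
    hi2.aestronglyMeasurable
  constructor
  · rw [integrable_map_measure hm hU.aemeasurable] at hi2
    simpa only [Function.comp_def, hin] using hi2
  · calc ∫ ω, G (U ω, V ω) ∂μ = ∫ z, G z ∂μ.map (fun ω => (U ω, V ω)) :=
        (integral_map (hU.prodMk hV).aemeasurable hG.aestronglyMeasurable).symm
      _ = ∫ u, ∫ v, G (u, v) ∂μ.map V ∂μ.map U := by rw [hP, integral_prod _ hi']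
      _ = ∫ ω, ∫ v, G (U ω, v) ∂μ.map V ∂μ := integral_map hU.aemeasurable hm
      _ = _ := by simp only [hin]

end Independence

theorem IsStepSizes.memLp_all {Ω : Type u} [MeasurableSpace Ω] {μ : Measure Ω}
    {σ : ℝ} {X Z : ℕ → Ω → ℝ} (H : IsStepSizes μ σ X Z) (k : ℕ) : MemLp (Z (k + 1)) 2 μ :=
  (H.identDistrib (k + 1) (by omega)).memLp_iff.2 H.memLp

theorem IsStepSizes.integral_sub_one_sq {Ω : Type u} [MeasurableSpace Ω] {μ : Measure Ω}
    {σ : ℝ} {X Z : ℕ → Ω → ℝ} (H : IsStepSizes μ σ X Z) (k : ℕ) :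
    ∫ ω, (Z (k + 1) ω - 1) ^ 2 ∂μ = σ ^ 2 := by
  have hd := H.identDistrib (k + 1) (by omega)
  rw [← H.variance, ← hd.variance_eq, variance_eq_integral hd.aemeasurable_fst, hd.integral_eq,
    H.mean]

theorem abs_sub_one_rpow_le {e z : ℝ} (he : 0 ≤ e) (hz : 0 < z) : |z - 1| ^ e ≤ z ^ e + 1 := by
  rcases le_total z 1 with h | h
  · have : |z - 1| ≤ 1 := by rw [abs_le]; constructor <;> linarith
    have := Real.rpow_le_one (abs_nonneg _) this he
    have := Real.rpow_nonneg hz.le e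
    linarith
  · have : |z - 1| ≤ z := by rw [abs_le]; constructor <;> linarith
    have := Real.rpow_le_rpow (abs_nonneg _) this he
    linarith

/-- The centred step sizes with prescribed signs satisfy a central limit theorem with a rate. -/
theorem exists_stepSizes_clt {r ρ M : ℝ} (hr : 0 ≤ r) (hr' : r ≤ 2) (hρ : 0 < ρ) (hρ' : ρ ≤ 1)
    (σ : ℝ) (v : NNReal) (hv : (v : ℝ) = σ ^ 2) : ∃ A : ℝ, 0 < A ∧
    ∀ (Ω : Type u) [MeasurableSpace Ω] (μ : Measure Ω) [IsProbabilityMeasure μ]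
      (X Z : ℕ → Ω → ℝ), IsStepSizes μ σ X Z → Integrable (fun ω => Z 1 ω ^ (2 + ρ)) μ →
      ∫ ω, Z 1 ω ^ (2 + ρ) ∂μ = M → ∀ x : ℕ → ℝ, (∀ k, |x k| = 1) →
      ∀ (n : ℕ) (B : ℝ) (f : ℝ → ℝ), HolderTaylor r B f → ∀ y,
      |∫ ω, f (∑ k ∈ Finset.range n, x k * (Z (k + 1) ω - 1) + y) ∂μ - gaussAvg (n * v) f y| ≤
        A * B * cltGrowth r ρ n := by
  -- The limit theorem for independent summands needs positive variance. If σ = 0, all step sizes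
  -- are almost surely 1 and both sides agree.
  rcases eq_or_ne v 0 with rfl | hv0
  · refine ⟨1, one_pos, ?_⟩
    intro Ω _ μ _ X Z H _ _ x hx n B f hf y
    have hz : ∀ᵐ ω ∂μ, ∀ k, Z (k + 1) ω = 1 := ae_all_iff.2 fun k => by
      have h := H.integral_sub_one_sq k
      have hs : σ ^ 2 = 0 := by simpa using hv.symm
      have hi : Integrable (fun ω => (Z (k + 1) ω - 1) ^ 2) μ :=
        ((H.memLp_all k).sub (memLp_const 1)).integrable_sq
      rw [hs, integral_eq_zero_iff_of_nonneg (fun ω => sq_nonneg _) hi] at h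
      filter_upwards [h] with ω hω
      have : (Z (k + 1) ω - 1) ^ 2 = 0 := hω
      linarith [pow_eq_zero_iff (two_ne_zero) |>.1 this]
    have e : ∫ ω, f (∑ k ∈ Finset.range n, x k * (Z (k + 1) ω - 1) + y) ∂μ = f y := by
      rw [integral_congr_ae (g := fun _ => f y)]
      · simp
      · filter_upwards [hz] with ω hω
        simp [hω]
    have hB := hf.nonneg
    have := one_le_cltGrowth r ρ n
    rw [e, mul_zero, gaussAvg, gaussianReal_zero_var, avg_dirac_zero, sub_self, abs_zero]
    positivity
  -- Multiplication by a sign affects neither the mean zero nor the absolute moments, and |z -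
  -- 1|^(2+ρ) ≤ z^(2+ρ) + 1, whence the uniform bound M + 1. The signed summands need not share a
  -- law.
  · obtain ⟨A, hA, hclt⟩ := exists_convLaw_clt (M := M + 1) hr hr' hρ hρ' v (pos_iff_ne_zero.2 hv0)
    refine ⟨A, hA, ?_⟩
    intro Ω _ μ _ X Z H hZi hZM x hx n B f hf y
    set Y : ℕ → Ω → ℝ := fun k ω => x k * (Z (k + 1) ω - 1) with hY
    have hYm : ∀ k, Measurable (Y k) := fun k =>
      ((H.measurable_Z (k + 1) (by omega)).sub_const 1).const_mul (x k)
    have hYi : iIndepFun Y μ :=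
      H.indep.comp (fun k z => x k * (z - 1)) fun k => by fun_prop
    have hL : ∀ k, MemLp (Y k) 2 μ := fun k =>
      ((H.memLp_all k).sub (memLp_const 1)).const_mul (x k)
    have hZk : ∀ k, Integrable (fun ω => Z (k + 1) ω ^ (2 + ρ)) μ ∧
        ∫ ω, Z (k + 1) ω ^ (2 + ρ) ∂μ = M := fun k => by
      have hd := (H.identDistrib (k + 1) (by omega)).comp
        (u := fun z : ℝ => z ^ (2 + ρ)) (by fun_prop)
      exact ⟨hd.integrable_iff.2 hZi, hd.integral_eq.trans hZM⟩
    have hdom : ∀ k, (fun ω => |Y k ω| ^ (2 + ρ)) ≤ᵐ[μ] fun ω => Z (k + 1) ω ^ (2 + ρ) + 1 := by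
      intro k
      filter_upwards [H.pos (k + 1) (by omega)] with ω hω
      simp only [hY, abs_mul, hx, one_mul]
      exact abs_sub_one_rpow_le (by linarith) hω
    have hrm : Measurable fun z : ℝ => |z| ^ (2 + ρ) := by fun_prop
    have hYr : ∀ k, Integrable (fun ω => |Y k ω| ^ (2 + ρ)) μ := fun k =>
      ((hZk k).1.add (integrable_const 1)).mono' (hrm.comp (hYm k)).aestronglyMeasurable <| by
        filter_upwards [hdom k] with ω hω
        rw [Real.norm_eq_abs, abs_of_nonneg (by positivity)]
        exact hω
    have h := hclt (fun k => μ.map (Y k)) ?_ ?_ ?_ ?_ ?_ n B f hf y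
    · refine le_of_eq_of_le ?_ h
      rw [← map_sum_range_eq_convLaw hYi hYm, avg, integral_map
        (measurable_sum_range hYm n).aemeasurable
        (hf.comp_add y).1.aestronglyMeasurable]
      simp only [Finset.sum_apply, hY]
    · intro k
      refine ⟨Measure.isProbabilityMeasure_map (hYm k).aemeasurable, ?_⟩
      rw [integrable_map_measure (by fun_prop) (hYm k).aemeasurable]
      exact (hL k).integrable_sq
    · intro k
      rw [integral_map (hYm k).aemeasurable (by fun_prop)]
      have hd := H.identDistrib (k + 1) (by omega)
      simp only [hY]
      rw [integral_const_mul, integral_sub ((H.memLp_all k).integrable (by norm_num))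
        (integrable_const 1), hd.integral_eq, H.mean]
      simp
    · intro k
      rw [integral_map (hYm k).aemeasurable (by fun_prop), hv, ← H.integral_sub_one_sq k]
      refine integral_congr_ae (ae_of_all _ fun ω => ?_)
      simp only [hY]
      rw [mul_pow, ← sq_abs (x k), hx, one_pow, one_mul]
    · intro k
      rw [integrable_map_measure hrm.aestronglyMeasurable (hYm k).aemeasurable]
      exact hYr k
    · intro k
      rw [integral_map (hYm k).aemeasurable hrm.aestronglyMeasurable]
      refine (integral_mono_ae (hYr k) ((hZk k).1.add (integrable_const 1)) (hdom k)).trans ?_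
      simp only [Pi.add_apply]
      rw [integral_add (hZk k).1 (integrable_const 1), (hZk k).2]
      simp

theorem gaussAvg_comp_affine {f : ℝ → ℝ} (hf : Measurable f) (a m : ℝ) {v w : NNReal}
    (hw : (w : ℝ) = a ^ 2 * v) : gaussAvg v (fun x => f (a * x + m)) 0 = gaussAvg w f m := by
  have hs : (v : ℝ) = Real.sqrt v ^ 2 := (Real.sq_sqrt v.coe_nonneg).symm
  have hw' : (w : ℝ) = (a * Real.sqrt v) ^ 2 := by rw [mul_pow, ← hs, hw]
  unfold gaussAvg avg
  rw [integral_gaussianReal_scale hs (f := fun x => f (a * (x + 0) + m)) (hf.comp (by fun_prop)),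
    integral_gaussianReal_scale hw' (f := fun x => f (x + m)) (hf.comp (by fun_prop))]
  simp only [add_zero, mul_assoc]

theorem walkPosition_eq {Ω : Type u} (X Z : ℕ → Ω → ℝ) (n : ℕ) (ω : Ω) :
    walkPosition X Z n ω = ∑ i ∈ Finset.range n, X (i + 1) ω * Z (i + 1) ω := by
  unfold walkPosition
  induction n with
  | zero => simp
  | succ n ih => rw [Finset.sum_Icc_succ_top (by omega), ih, Finset.sum_range_succ]

theorem unitPosition_eq {Ω : Type u} (X : ℕ → Ω → ℝ) (n : ℕ) (ω : Ω) :
    unitPosition X n ω = ∑ i ∈ Finset.range n, X (i + 1) ω :=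
  Fin.sum_univ_eq_sum_range (fun i => X (i + 1) ω) n

section WalkPosition

variable {Ω : Type u} [MeasurableSpace Ω] {μ : Measure Ω} [IsProbabilityMeasure μ]
variable {p q σ : ℝ} {X α Z : ℕ → Ω → ℝ} {β : ℕ → Ω → ℕ}

theorem IsElephantWalk.ae_abs_eq_one (W : IsElephantWalk μ p q X α β) (hp : 0 ≤ p) (hp' : p ≤ 1)
    (hq : 0 ≤ q) (hq' : q ≤ 1) : ∀ᵐ ω ∂μ, ∀ k, |X (k + 1) ω| = 1 :=
  ae_all_iff.2 fun k => by
    filter_upwards [W.ae_sign hp hp' hq hq' (k + 1) (by omega)] with ω hω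
    rcases hω with h | h <;> simp [h]

theorem IsElephantWalk.memLp_walkPosition (W : IsElephantWalk μ p q X α β)
    (H : IsStepSizes μ σ X Z) (hp : 0 ≤ p) (hp' : p ≤ 1) (hq : 0 ≤ q) (hq' : q ≤ 1) (n : ℕ) :
    MemLp (walkPosition X Z n) 2 μ := by
  have h : walkPosition X Z n = fun ω => ∑ i ∈ Finset.range n, X (i + 1) ω * Z (i + 1) ω :=
    funext (walkPosition_eq X Z n)
  rw [h]
  refine memLp_finsetSum _ fun i _ => ?_
  refine (H.memLp_all i).mono ((W.measurable_X (i + 1) (by omega)).mul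
    (H.measurable_Z (i + 1) (by omega))).aestronglyMeasurable ?_
  filter_upwards [W.ae_abs_eq_one hp hp' hq hq'] with ω hω
  rw [norm_mul, Real.norm_eq_abs, hω, one_mul]

theorem IsElephantWalk.measurable_walkPosition (W : IsElephantWalk μ p q X α β)
    (H : IsStepSizes μ σ X Z) (n : ℕ) : Measurable (walkPosition X Z n) :=
  Finset.measurable_sum _ fun i hi =>
    (W.measurable_X i (Finset.mem_Icc.1 hi).1).mul (H.measurable_Z i (Finset.mem_Icc.1 hi).1)

theorem IsElephantWalk.sqProb_walkPosition (W : IsElephantWalk μ p q X α β)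
    (H : IsStepSizes μ σ X Z) (hp : 0 ≤ p) (hp' : p ≤ 1) (hq : 0 ≤ q) (hq' : q ≤ 1) (n : ℕ) :
    SqProb (μ.map (walkPosition X Z n)) := by
  have hm := W.measurable_walkPosition H n
  refine ⟨Measure.isProbabilityMeasure_map hm.aemeasurable, ?_⟩
  rw [integrable_map_measure (by fun_prop) hm.aemeasurable]
  exact (W.memLp_walkPosition H hp hp' hq hq' n).integrable_sq

theorem IsElephantWalk.integrable_comp_walkPosition (W : IsElephantWalk μ p q X α β)
    (H : IsStepSizes μ σ X Z) (hp : 0 ≤ p) (hp' : p ≤ 1) (hq : 0 ≤ q) (hq' : q ≤ 1) {f : ℝ → ℝ}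
    (hf : QuadGrowth f) (n : ℕ) : Integrable (fun ω => f (walkPosition X Z n ω)) μ := by
  have h := (W.sqProb_walkPosition H hp hp' hq hq' n).integrable hf
  rwa [integrable_map_measure hf.1.aestronglyMeasurable
    (W.measurable_walkPosition H n).aemeasurable] at h

end WalkPosition

/-- Conditionally on the signs, the fluctuation due to the step sizes is replaced by a Gaussian. -/
theorem exists_walkPosition_clt {r ρ M : ℝ} (hr : 0 ≤ r) (hr' : r ≤ 2) (hρ : 0 < ρ) (hρ' : ρ ≤ 1)
    (σ : ℝ) (v : NNReal) (hv : (v : ℝ) = σ ^ 2) : ∃ A : ℝ, 0 < A ∧ ∀ (p q : ℝ),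
    0 ≤ p → p ≤ 1 → 0 ≤ q → q ≤ 1 →
    ∀ (Ω : Type u) [MeasurableSpace Ω] (μ : Measure Ω) [IsProbabilityMeasure μ]
      (X α : ℕ → Ω → ℝ) (β : ℕ → Ω → ℕ) (Z : ℕ → Ω → ℝ), IsElephantWalk μ p q X α β →
      IsStepSizes μ σ X Z → Integrable (fun ω => Z 1 ω ^ (2 + ρ)) μ →
      ∫ ω, Z 1 ω ^ (2 + ρ) ∂μ = M → ∀ (n : ℕ) (a c : ℝ) (w : NNReal), (w : ℝ) = a ^ 2 * (n * v) →
      ∀ (B : ℝ) (f : ℝ → ℝ), HolderTaylor r B f →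
      |∫ ω, f (a * walkPosition X Z n ω - c) ∂μ -
          ∫ ω, gaussAvg w f (a * unitPosition X n ω - c) ∂μ| ≤
        A * (B * |a| ^ r) * cltGrowth r ρ n := by
  obtain ⟨A, hA, hclt⟩ := exists_stepSizes_clt.{u} (M := M) hr hr' hρ hρ' σ v hv
  refine ⟨A, hA, ?_⟩
  intro p q hp hp' hq hq' Ω _ μ _ X α β Z W H hZi hZM n a c w hw B f hf
  have hfq := hf.quadGrowth hr hr'
  set U : Ω → ℕ → ℝ := fun ω k => X (k + 1) ω with hU
  set S : Ω → ℕ → ℝ := fun ω k => Z (k + 1) ω with hS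
  have hUm : Measurable U := measurable_pi_iff.2 fun k => W.measurable_X (k + 1) (by omega)
  have hSm : Measurable S := measurable_pi_iff.2 fun k => H.measurable_Z (k + 1) (by omega)
  -- The rescaled walk as a function of signs and sizes separately. By independence the sizes can be
  -- integrated out first with the signs frozen, where `exists_stepSizes_clt` applies to an affine
  -- rescaling of f.
  set G : (ℕ → ℝ) × (ℕ → ℝ) → ℝ := fun z =>
    f (a * (∑ k ∈ Finset.range n, z.1 k * (z.2 k - 1)) +
      (a * (∑ k ∈ Finset.range n, z.1 k) - c)) with hG
  have hGm : Measurable G := hf.1.comp (by fun_prop)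
  have hGe : ∀ ω, G (U ω, S ω) = f (a * walkPosition X Z n ω - c) := fun ω => by
    simp only [hG, hU, hS, walkPosition_eq, mul_sub, mul_one, Finset.sum_sub_distrib]
    congr 1
    ring
  have hc := hfq.comp_affine a (-c)
  simp only [← sub_eq_add_neg] at hc
  have hGi : Integrable (fun ω => G (U ω, S ω)) μ := by
    simp only [hGe]
    exact W.integrable_comp_walkPosition H hp hp' hq hq' hc n
  obtain ⟨hi, he⟩ : Integrable (fun ω => ∫ ω', G (U ω, S ω') ∂μ) μ ∧
      ∫ ω, G (U ω, S ω) ∂μ = ∫ ω, ∫ ω', G (U ω, S ω') ∂μ ∂μ :=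
    IndepFun.integral_comp_eq H.indep_X hUm hSm hGm hGi
  have hgc := (hfq.gaussAvg w).comp_affine a (-c)
  simp only [← sub_eq_add_neg] at hgc
  have hgi := W.integrable_comp hp hp' hq hq' hgc n
  simp only [hGe] at he
  rw [he, ← integral_sub hi hgi]
  rw [← mul_one (A * _ * _), ← probReal_univ (μ := μ), ← Real.norm_eq_abs]
  refine norm_integral_le_of_norm_le_const ?_
  filter_upwards [W.ae_abs_eq_one hp hp' hq hq'] with ω hω
  have h := hclt Ω μ X Z H hZi hZM (U ω) hω n _ _
    (hf.comp_affine a (a * unitPosition X n ω - c)) 0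
  rw [gaussAvg_comp_affine hf.1 a _ (w := w) (by rw [hw]; push_cast; rfl)] at h
  simp only [add_zero] at h
  simp only [hG, hU, ← unitPosition_eq]
  exact h

/-! ### The main estimate -/

/-- The two entries of the maximum give the exponents -r/2 and -ρ/2, which is where r ∧ ρ arises. -/
theorem rpow_neg_mul_cltGrowth_le {r ρ : ℝ} {n : ℕ} (hn : 1 ≤ n) :
    (n : ℝ) ^ (-(r / 2)) * cltGrowth r ρ n ≤ (n : ℝ) ^ (-(min r ρ / 2)) := by
  have hn1 : (1 : ℝ) ≤ n := by exact_mod_cast hn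
  have hn0 : (0 : ℝ) < n := by linarith
  unfold cltGrowth
  rw [mul_max_of_nonneg _ _ (by positivity), mul_one, ← Real.rpow_add hn0]
  refine max_le (Real.rpow_le_rpow_of_exponent_le hn1 ?_)
    (Real.rpow_le_rpow_of_exponent_le hn1 ?_)
  · linarith [min_le_left r ρ]
  · linarith [min_le_right r ρ]

theorem theorem6 (p q r ρ σ M : ℝ) (hp : 0 < p) (hp' : p ≤ 3 / 4) (hq : 0 < q) (hq' : q ≤ 1)
    (hr : 0 < r) (hr' : r ≤ 2) (hρ : 0 < ρ) (hρ' : ρ ≤ 1) :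
    ∃ C : ℝ, 0 < C ∧
      ∀ (Ω : Type u) [MeasurableSpace Ω] (μ : Measure Ω) [IsProbabilityMeasure μ]
        (X α : ℕ → Ω → ℝ) (β : ℕ → Ω → ℕ) (Z : ℕ → Ω → ℝ),
        IsElephantWalk μ p q X α β → IsStepSizes μ σ X Z →
        Integrable (fun ω => Z 1 ω ^ (2 + ρ)) μ → ∫ ω, Z 1 ω ^ (2 + ρ) ∂μ = M →
        ∀ n : ℕ, 1 ≤ n →
          zolotarevDist r
              (μ.map (fun ω => (erwA p n * walkPosition X Z n ω - (2 * q - 1)) /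
                Real.sqrt (erwV p n + n * erwA p n ^ 2 * σ ^ 2)))
              (gaussianReal 0 1)
            ≤ ((C * (1 / (n : ℝ) ^ (min r ρ / 2) + 1 / erwV p n) : ℝ) : EReal) := by
  have hp1 : p ≤ 1 := by linarith
  obtain ⟨v, hv⟩ : ∃ v : NNReal, (v : ℝ) = σ ^ 2 :=
    ⟨(σ ^ 2).toNNReal, Real.coe_toNNReal _ (sq_nonneg σ)⟩
  obtain ⟨A, hA, hsize⟩ := exists_walkPosition_clt.{u} (M := M) hr.le hr' hρ hρ' σ v hv
  obtain ⟨C, hC, hwalk⟩ := exists_elephantWalk_clt.{u} hp hp' hr hr'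
  refine ⟨3 * A + C, by positivity, ?_⟩
  intro Ω _ μ _ X α β Z W H hZi hZM n hn
  have hn1 : (1 : ℝ) ≤ n := by exact_mod_cast hn
  have ha := erwA_pos hp hn
  have hV0 : 0 < erwV p n := one_pos.trans_le (one_le_erwV hp hn)
  set a := erwA p n with ha_def
  set T := erwV p n + n * a ^ 2 * σ ^ 2 with hT
  have hVT : erwV p n ≤ T := by rw [hT]; have : 0 ≤ n * a ^ 2 * σ ^ 2 := by positivity
                                linarith
  have hT0 : 0 < T := hV0.trans_le hVT
  set s := (Real.sqrt T)⁻¹ with hs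
  have hs0 : 0 < s := inv_pos.2 (Real.sqrt_pos.2 hT0)
  have hsT : s ^ 2 * T = 1 := by
    rw [hs, inv_pow, Real.sq_sqrt hT0.le, inv_mul_cancel₀ hT0.ne']
  obtain ⟨w, hw⟩ : ∃ w : NNReal, (w : ℝ) = a ^ 2 * (n * v) :=
    ⟨Real.toNNReal _, Real.coe_toNNReal _ (by positivity)⟩
  obtain ⟨V, hV⟩ : ∃ V : NNReal, (V : ℝ) = erwV p n :=
    ⟨Real.toNNReal _, Real.coe_toNNReal _ hV0.le⟩
  set Y : Ω → ℝ := fun ω => (a * walkPosition X Z n ω - (2 * q - 1)) / Real.sqrt T with hY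
  have hYm : Measurable Y :=
    (((W.measurable_walkPosition H n).const_mul a).sub_const _).div_const _
  have hYs : ∀ ω, Y ω = s * (a * walkPosition X Z n ω - (2 * q - 1)) + 0 := fun ω => by
    simp only [hY, hs, add_zero]
    rw [div_eq_mul_inv, mul_comm]
  have hint : ∀ f : ℝ → ℝ, QuadGrowth f → Integrable f (μ.map Y) ∧
      Integrable f (gaussianReal 0 1) := fun f hf => by
    refine ⟨?_, (sqProb_gaussianReal 0 1).integrable hf⟩
    rw [integrable_map_measure hf.1.aestronglyMeasurable hYm.aemeasurable]
    have h := W.integrable_comp_walkPosition H hp.le hp1 hq.le hq'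
      ((hf.comp_affine s 0).comp_affine a (-(2 * q - 1))) n
    simpa only [Function.comp_def, hYs, sub_eq_add_neg] using h
  have hmem := fun f (hf : f ∈ zolotarevClass r) => holderTaylor_of_mem_zolotarevClass hr hr' hf
  unfold zolotarevDist
  rw [if_pos fun f hf => hint f ((hmem f hf).quadGrowth hr.le hr')]
  refine iSup₂_le fun f hf => EReal.coe_le_coe ?_
  -- Normalization is put into the test function: x ↦ f(s x) has Taylor constant s^r, and both limit
  -- theorems are applied to it before rescaling.
  have hg := (hmem f hf).comp_affine s 0
  have hfm := (hmem f hf).1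
  rw [abs_of_pos hs0, one_mul] at hg
  have h1 := hsize p q hp.le hp1 hq.le hq' Ω μ X α β Z W H hZi hZM n a (2 * q - 1) w hw _ _ hg
  have h2 := hwalk q hq.le hq' Ω μ X α β W n hn _ _ hg w V hV
  rw [gaussAvg_comp_affine hfm s 0 (w := 1) (by
    rw [NNReal.coe_add, hw, hV, hv, NNReal.coe_one, ← hsT, hT]; ring)] at h2
  simp only [← hYs] at h1
  have e1 : ∫ x, f x ∂μ.map Y = ∫ ω, f (Y ω) ∂μ :=
    integral_map hYm.aemeasurable hfm.aestronglyMeasurable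
  have e2 : gaussAvg 1 f 0 = ∫ x, f x ∂gaussianReal 0 1 := by simp [avg]
  rw [e2] at h2
  rw [abs_of_pos ha] at h1
  -- Because s² (v_n + n a_n² σ²) = 1, the factor s^r cancels the growth v_n^(r/2) in both error
  -- bounds.
  have hsV : s ^ r * erwV p n ^ (r / 2) ≤ 1 := by
    have : s ^ r = (s ^ 2) ^ (r / 2) := by
      rw [← Real.rpow_natCast s 2, ← Real.rpow_mul hs0.le]; congr 1; push_cast; ring
    rw [this, ← Real.mul_rpow (sq_nonneg s) hV0.le]
    refine Real.rpow_le_one (by positivity) ?_ (by positivity)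
    rw [← hsT]
    gcongr
  have hsr : 0 ≤ s ^ r := Real.rpow_nonneg hs0.le r
  have hgr := rpow_neg_mul_cltGrowth_le (r := r) (ρ := ρ) hn
  have hcg : 0 ≤ cltGrowth r ρ n := zero_le_one.trans (one_le_cltGrowth r ρ n)
  have hpow : (n : ℝ) ^ (-(min r 1 / 2)) ≤ (n : ℝ) ^ (-(min r ρ / 2)) :=
    Real.rpow_le_rpow_of_exponent_le hn1 (by linarith [min_le_min_left r hρ'])
  rw [one_div ((n : ℝ) ^ _), ← Real.rpow_neg (by positivity)]
  set P := (n : ℝ) ^ (-(min r ρ / 2)) with hP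
  have hP0 : 0 ≤ P := by positivity
  have hVi : 0 ≤ 1 / erwV p n := by positivity
  have b1 : A * (s ^ r * a ^ r) * cltGrowth r ρ n ≤ 3 * A * P := by
    calc A * (s ^ r * a ^ r) * cltGrowth r ρ n
        ≤ A * (s ^ r * (3 * erwV p n ^ (r / 2) * (n : ℝ) ^ (-(r / 2)))) * cltGrowth r ρ n := by
          have := erwA_rpow_le hp hr hr' hn
          gcongr
      _ = 3 * A * (s ^ r * erwV p n ^ (r / 2)) * ((n : ℝ) ^ (-(r / 2)) * cltGrowth r ρ n) := by
          ring
      _ ≤ 3 * A * 1 * P := by gcongr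
      _ = _ := by ring
  have b2 : C * s ^ r * erwV p n ^ (r / 2) * ((n : ℝ) ^ (-(min r 1 / 2)) + 1 / erwV p n) ≤
      C * (P + 1 / erwV p n) := by
    calc _ = C * (s ^ r * erwV p n ^ (r / 2)) *
          ((n : ℝ) ^ (-(min r 1 / 2)) + 1 / erwV p n) := by ring
      _ ≤ C * 1 * (P + 1 / erwV p n) := by gcongr
      _ = _ := by ring
  have l1 := (abs_le.1 h1).2
  have l2 := (abs_le.1 h2).2
  rw [e1]
  have : 0 ≤ A * (1 / erwV p n) := by positivity
  linarith
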